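/- **Setting.** Let $n\ge1$ and let $H$ be a Hermitian operator on $n$ qubits whose traceless part $H_0=H-\frac{\mathrm{tr}H}{2^n}I$ satisfies $\|H_0\|_{\mathrm{op}}\le1$. $H$ is unknown and accessible only through queries to $e^{-iH\tau}$ and $e^{+iH\tau}$, $\tau>0$. Write $\sigma_{\vec v}=\sigma_{v_1}\otimes\cdots\otimes\sigma_{v_n}$ for $\vec v\in\{0,1,2,3\}^n$ ($\sigma_0,\dots,\sigma_3=I,X,Y,Z$) and $\mathtt{ctrl}(V)=|0\rangle\langle0|\otimes I+|1\rangle\langle1|\otimes V$, with one control qubit. Products are ordered as $\prod_{m=1}^N M_m=M_1\cdots M_N$. **Parameters to be estimated.** For integers $k$ and $N\ge 1$ put $A_{k,N}e^{i\theta_{k,N}}=\big(2^{-n}\,\mathrm{tr}\,e^{-i\frac{\pi k}{2N}H_0}\big)^N$ with $A_{k,N}\ge0$, $\theta_{k,N}\in[0,2\pi)$. With $W_{k,j}=\big[\prod_{m=1}^N\mathtt{ctrl}(\sigma_{\vec v_m})(I\otimes e^{-i\frac{k\pi}{2N}H})\mathtt{ctrl}(\sigma_{\vec v_m})\big](e^{-i\frac{k\pi}4Z}\otimes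 I)$, $j=(\vec v_1,\dots,\vec v_N)$, they are the parameters $A>0$, $\theta\in[0,2\pi)$ in the identity, for all $\phi\in\mathbb R$, $$4^{-nN}\sum_{j}W_{k,j}^\dagger\big([\cos\phi X-\sin\phi Y]\otimes I\big)W_{k,j}=A\,(e^{i\frac\theta2Z}\otimes I)\begin{pmatrix}0&e^{i\phi}e^{i\frac{k\pi}2(H_0+I)}\\e^{-i\phi}e^{-i\frac{k\pi}2(H_0+I)}&0\end{pmatrix}(e^{-i\frac\theta2Z}\otimes I).$$ **Random states.** Given $N,l,M\ge 1$, $\gamma$, $\Phi$, the random state $|\phi(N,l,\gamma,M,\Phi)\rangle$ is obtained from $|0\rangle\otimes|0\rangle$ by applying $N$ times $\widetilde W(e^{-i\gamma Y}\otimes I)\widetilde W^\dagger$, each time with fresh, uniformly random $\vec u_1,\dots,\vec u_{10l^2},\vec w_1,\dots,\vec w_{l^2M}\in\{0,1,2,3\}^n$ and $s\in\{\pm1\}$, where $$\widetilde W=(e^{-i\frac{s\Phi}2Z}\otimes I)\Big[\prod_{m=1}^{l^2M}\mathtt{ctrl}(\sigma_{\vec w_m})(I\otimes e^{i\frac{s\pi}{2lM}H})\mathtt{ctrl}(\sigma_{\vec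 w_m})\Big]\Big[\prod_{m=1}^{10l^2}\mathtt{ctrl}(\sigma_{\vec u_m})(I\otimes e^{-i\frac{s\pi}{20l}H})\mathtt{ctrl}(\sigma_{\vec u_m})\Big].$$ The $(0,k)$- and $(+,k)$-experiments prepare $|\phi(N',l,k\pi/N',25k,\Phi)\rangle$ with $N'=\big\lceil\max(40\sqrt2\,k^2\pi^2,\tfrac52k\pi)\big\rceil$ and measure the control qubit, success being the outcome $|0\rangle$, respectively $|+\rangle$. **Robust phase estimation** with allowed error $\sigma>0$, deviation bound $\delta$ and initial value $v_0$: let $K=\max(0,\lceil\log_2(3\pi/\sigma)\rceil)$, $M_j=F(\delta)(3(K-j)+1)$, $F(\delta)=\Big\lceil\frac{\log(\frac12(1-\sqrt8\delta))}{\log(1-\frac12(1-\sqrt8\delta)^2)}\Big\rceil$. For $j=1,\dots,K$, with $k=2^{j-1}$, perform $M_j$ experiments of type $(0,k)$ and $M_j$ of type $(+,k)$, with $a_0$ and $a_+$ successes, let $\varphi$ be the angle of the point $(2a_0/M_j-1,\,2a_+/M_j-1)$ (with $\varphi=0$ at the origin), and let $v_j$ be the element of $\{(\varphi+2\pi m)/k:m\in\mathbb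 Z\}$ in $(v_{j-1}-\pi/k,\,v_{j-1}+\pi/k]$. The output is $v_K$. **Estimation subroutine** (input $l\ge1$, $\epsilon,t>0$). (1) Run robust phase estimation with $\sigma=\epsilon/(\sqrt2t)$ for $\Phi=0$ (with $v_0=2\pi$) and for $\Phi=\pi/2$ (with $v_0=0$), obtaining $\hat v_0$, $\hat v_{\pi/2}$. (2) If $\frac1{2\pi}\sqrt{\hat v_0^2+\hat v_{\pi/2}^2}\le\frac12$, return to (1) with fresh randomness. (3) Output $\hat A_l\ge0$, $\hat\theta_l\in[0,2\pi)$ with $\hat A_l\cos\hat\theta_l=\hat v_0/2\pi$ and $\hat A_l\sin\hat\theta_l=-\hat v_{\pi/2}/2\pi$. The runtime counts one step for each query, each single-qubit gate on the control qubit, each measurement, each random sign and each classical update of an estimate, $n$ steps for each $\mathtt{ctrl}(\sigma_{\vec v})$ and for drawing each $\vec v$, and $n+1$ steps for each initialization, over all repetitions of (1); one further step per pass is charged for test (2). **Theorem.** There are universal constants $\delta\in(0,1/\sqrt8)$ and $c,C>0$ such that for all $n,l\ge1$ and all $H$ as above, with $A=A_{l,10l^2}$, $\theta=\theta_{l,10l^2}$: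 1. $A>0$, and $(A,\theta)$ satisfies the identity above for $k=l$, $N=10l^2$. 2. For $\Phi\in\{0,\pi/2\}$ and all $k\ge1$, the success probabilities of the $(0,k)$- and $(+,k)$-experiments differ by at most $\delta$ from $\frac12(1+\cos kv_\Phi)$ and $\frac12(1+\sin kv_\Phi)$, where $v_\Phi=2\pi A\cos(\theta+\Phi)$. 3. For all $\epsilon,t>0$ the subroutine, run with this $\delta$, halts almost surely, $\hat A_l>\frac12$, $\hat\theta_l\in[0,2\pi)$, and $$\Big(\mathbb E\,\Big|1-\frac{Ae^{i\theta}}{\hat A_le^{i\hat\theta_l}}\Big|^2\Big)^{1/2}\le\frac\epsilon t .$$ 4. If moreover $\epsilon\le t$, its expected runtime $T$ satisfies $c\,l^2t^3n/\epsilon^3\le T\le C\,l^2t^3n/\epsilon^3$, i.e. it is $\Theta(l^2t^3n/\epsilon^3)$. -/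

import Mathlib

open scoped Kronecker

noncomputable section

namespace UHET

/-! ### Qubits, Pauli strings, Hamiltonians -/

/-- Computational basis labels of the `n`-qubit system. -/
abbrev Q (n : ℕ) : Type := Fin n → Fin 2

/-- Operators on the `n`-qubit system. -/
abbrev Op (n : ℕ) : Type := Matrix (Q n) (Q n) ℂ

/-- Operators on control qubit ⊗ system. -/
abbrev COp (n : ℕ) : Type := Matrix (Fin 2 × Q n) (Fin 2 × Q n) ℂ

/-- (Not necessarily normalized) vectors of control qubit ⊗ system. -/
abbrev Ket (n : ℕ) : Type := Fin 2 × Q n → ℂ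

def pauliX : Matrix (Fin 2) (Fin 2) ℂ := !![0, 1; 1, 0]

def pauliY : Matrix (Fin 2) (Fin 2) ℂ := !![0, -Complex.I; Complex.I, 0]

def pauliZ : Matrix (Fin 2) (Fin 2) ℂ := !![1, 0; 0, -1]

/-- The four Pauli matrices `I, X, Y, Z`. -/
def pauli : Fin 4 → Matrix (Fin 2) (Fin 2) ℂ := ![1, pauliX, pauliY, pauliZ]

/-- The Pauli string `σ_v = σ_{v_1} ⊗ ⋯ ⊗ σ_{v_n}`. -/
def pauliString {n : ℕ} (v : Fin n → Fin 4) : Op n :=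
  Matrix.of fun x y => ∏ i, pauli (v i) (x i) (y i)

/-- `ctrl(V) = |0⟩⟨0| ⊗ I + |1⟩⟨1| ⊗ V`. -/
def ctrl {n : ℕ} (V : Op n) : COp n :=
  !![1, 0; 0, 0] ⊗ₖ (1 : Op n) + !![0, 0; 0, 1] ⊗ₖ V

/-- The traceless part `H₀ = H - (tr H / 2^n) I`. -/
def traceless {n : ℕ} (H : Op n) : Op n := H - (H.trace / 2 ^ n) • (1 : Op n)

/-- The dynamics `e^{-iHτ}`, for both signs of `τ`. -/
def evolution {n : ℕ} (H : Op n) (τ : ℝ) : Op n := NormedSpace.exp ((-(Complex.I * τ)) • H)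

/-- The seed Hamiltonian is Hermitian and `‖H₀‖_op ≤ 1`. -/
def IsSeed {n : ℕ} (H : Op n) : Prop :=
  H.IsHermitian ∧ ‖Matrix.toEuclideanCLM (𝕜 := ℂ) (traceless H)‖ ≤ 1

/-! ### Circuits with a black box

A circuit is a list of gates.  It does not depend on the Hamiltonian: the latter enters only
through the oracle `U`, which is queried at chosen times, when a circuit is executed. -/

inductive Gate (n : ℕ) : Type
  /-- The Clifford gate `ctrl(σ_v)`. -/
  | ctrlPauli (v : Fin n → Fin 4) : Gate n
  /-- A query `I ⊗ U(τ)` to the black box. -/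
  | query (τ : ℝ) : Gate n
  /-- `e^{-iθY} ⊗ I` on the control qubit. -/
  | rotY (θ : ℝ) : Gate n
  /-- `e^{-iθZ} ⊗ I` on the control qubit. -/
  | rotZ (θ : ℝ) : Gate n

namespace Gate

def matrix {n : ℕ} (U : ℝ → Op n) : Gate n → COp n
  | ctrlPauli v => ctrl (pauliString v)
  | query τ => (1 : Matrix (Fin 2) (Fin 2) ℂ) ⊗ₖ U τ
  | rotY θ => NormedSpace.exp ((-(Complex.I * θ)) • pauliY) ⊗ₖ (1 : Op n)
  | rotZ θ => NormedSpace.exp ((-(Complex.I * θ)) • pauliZ) ⊗ₖ (1 : Op n)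

/-- The inverse gate. -/
def inverse {n : ℕ} : Gate n → Gate n
  | ctrlPauli v => ctrlPauli v
  | query τ => query (-τ)
  | rotY θ => rotY (-θ)
  | rotZ θ => rotZ (-θ)

/-- Execution time: a controlled Pauli string on `n` qubits consists of `n` controlled
single-qubit Pauli gates, every other gate takes one step. -/
def cost {n : ℕ} : Gate n → ℕ
  | ctrlPauli _ => n
  | query _ => 1
  | rotY _ => 1
  | rotZ _ => 1

end Gate

/-- Gates in the order of matrix multiplication (the last gate of the list acts first). -/
abbrev Circuit (n : ℕ) : Type := List (Gate n)

namespace Circuit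

def matrix {n : ℕ} (U : ℝ → Op n) (C : Circuit n) : COp n := (C.map (Gate.matrix U)).prod

def inverse {n : ℕ} (C : Circuit n) : Circuit n := (C.map Gate.inverse).reverse

def cost {n : ℕ} (C : Circuit n) : ℕ := (C.map Gate.cost).sum

end Circuit

/-- `∏_{m=1}^N ctrl(σ_{v_m}) (I ⊗ U(τ)) ctrl(σ_{v_m})`. -/
def ladder {n N : ℕ} (τ : ℝ) (v : Fin N → Fin n → Fin 4) : Circuit n :=
  (List.ofFn v).flatMap fun a => [Gate.ctrlPauli a, Gate.query τ, Gate.ctrlPauli a]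

/-! ### Compensation parameters -/

/-- `W^{(N)}_{k,j}
= [∏_{m=1}^N ctrl(σ_{v_m}) (I ⊗ e^{-i(kπ/2N)H}) ctrl(σ_{v_m})] (e^{-i(kπ/4)Z} ⊗ I)`. -/
def circuitW {n : ℕ} (k : ℤ) (N : ℕ) (v : Fin N → Fin n → Fin 4) : Circuit n :=
  ladder (k * Real.pi / (2 * N)) v ++ [Gate.rotZ (k * Real.pi / 4)]

/-- The operator with blocks `0`, `e^{iφ} e^{i(kπ/2)(H₀+I)}`, `e^{-iφ} e^{-i(kπ/2)(H₀+I)}`, `0`. -/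
def targetBlock {n : ℕ} (H : Op n) (k : ℤ) (φ : ℝ) : COp n :=
  !![0, 1; 0, 0] ⊗ₖ (Complex.exp (Complex.I * φ) •
      NormedSpace.exp ((Complex.I * (k * Real.pi / 2)) • (traceless H + 1))) +
  !![0, 0; 1, 0] ⊗ₖ (Complex.exp (-(Complex.I * φ)) •
      NormedSpace.exp ((-(Complex.I * (k * Real.pi / 2))) • (traceless H + 1)))

/-- `A > 0` and `θ ∈ [0, 2π)` are the compensation parameters of `H` for `k` and `N`: averaging
`W† ([cos φ X - sin φ Y] ⊗ I) W` over all Pauli strings gives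
`A (e^{iθZ/2} ⊗ I) targetBlock (e^{-iθZ/2} ⊗ I)`. -/
def IsCompensation {n : ℕ} (H : Op n) (k : ℤ) (N : ℕ) (A θ : ℝ) : Prop :=
  0 < A ∧ 0 ≤ θ ∧ θ < 2 * Real.pi ∧ ∀ φ : ℝ,
    ((1 / 4 : ℂ) ^ (n * N)) • ∑ v : Fin N → Fin n → Fin 4,
      ((circuitW k N v).matrix (evolution H)).conjTranspose *
        (((Real.cos φ : ℂ) • pauliX - (Real.sin φ : ℂ) • pauliY) ⊗ₖ (1 : Op n)) *
        (circuitW k N v).matrix (evolution H)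
    = (A : ℂ) • ((Gate.rotZ (-(θ / 2))).matrix (evolution H) * targetBlock H k φ *
        (Gate.rotZ (θ / 2)).matrix (evolution H))

/-- `A e^{iθ} = (tr e^{-i(kπ/2N)H₀} / 2^n)^N`. -/
def compZ {n : ℕ} (H : Op n) (k : ℤ) (N : ℕ) : ℂ :=
  ((evolution (traceless H) (k * Real.pi / (2 * N))).trace / 2 ^ n) ^ N

/-- `A_{k,N}`. -/
def compA {n : ℕ} (H : Op n) (k : ℤ) (N : ℕ) : ℝ := ‖compZ H k N‖

/-- `θ_{k,N} ∈ [0, 2π)`. -/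
def compTheta {n : ℕ} (H : Op n) (k : ℤ) (N : ℕ) : ℝ :=
  toIcoMod Real.two_pi_pos 0 (compZ H k N).arg

/-! ### Randomized programs with a step count -/

/-- A randomized program: the joint law of its result and of the number of steps it takes. -/
def Prog (α : Type) : Type := PMF (α × ℕ)

namespace Prog

def law {α : Type} (p : Prog α) : PMF (α × ℕ) := p

/-- Sequential composition; the step counts add up. -/
instance : Monad Prog where
  pure a := PMF.pure (a, 0)
  bind p f := PMF.bind p fun x => PMF.map (fun y => (y.1, x.2 + y.2)) (law (f x.1))

/-- Spend `c` steps. -/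
def tick (c : ℕ) : Prog Unit := PMF.pure ((), c)

/-- A uniformly random element, at the cost of `c` steps. -/
def uniform (α : Type) [Fintype α] [Nonempty α] (c : ℕ) : Prog α :=
  PMF.map (fun a => (a, c)) (PMF.uniformOfFintype α)

/-- `true` with probability `p`, in one step.  The truncation at `1` makes this total; it is inert
for the Born probabilities of unit vectors. -/
def coin (p : NNReal) : Prog Bool :=
  PMF.map (fun b => (b, 1)) (PMF.ofFintype (fun b : Bool => cond b (min p 1 : NNReal)
    (1 - min p 1 : NNReal) ) (by
      rw [Fintype.sum_bool]
      simp only [cond_true, cond_false]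
      rw [← ENNReal.coe_add, add_tsub_cancel_of_le (min_le_right p 1), ENNReal.coe_one]))

end Prog

/-! ### Generation of the random state -/

/-- `|0⟩ ⊗ |0⟩`. -/
def initKet (n : ℕ) : Ket n := Pi.single (0, fun _ => 0) 1

/-- `W̃_{l,j,Φ}` for `j = (u, w, s)`:
`(e^{-i(sΦ/2)Z} ⊗ I) [∏_{m''=1}^{l²M} ctrl(σ_w) (I ⊗ e^{i(sπ/2lM)H}) ctrl(σ_w)]
[∏_{m'=1}^{10l²} ctrl(σ_u) (I ⊗ e^{-i(sπ/20l)H}) ctrl(σ_u)]`. -/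
def circuitWTilde {n : ℕ} (l M : ℕ) (Φ : ℝ) (u : Fin (10 * l ^ 2) → Fin n → Fin 4)
    (w : Fin (l ^ 2 * M) → Fin n → Fin 4) (s : ℤˣ) : Circuit n :=
  [Gate.rotZ (((s : ℤ) : ℝ) * Φ / 2)] ++
    ladder (-(((s : ℤ) : ℝ) * Real.pi / (2 * l * M))) w ++
    ladder (((s : ℤ) : ℝ) * Real.pi / (20 * l)) u

/-- `W̃ (e^{-iγY} ⊗ I) W̃†`. -/
def stepCircuit {n : ℕ} (l M : ℕ) (γ Φ : ℝ) (u : Fin (10 * l ^ 2) → Fin n → Fin 4)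
    (w : Fin (l ^ 2 * M) → Fin n → Fin 4) (s : ℤˣ) : Circuit n :=
  circuitWTilde l M Φ u w s ++ [Gate.rotY γ] ++ (circuitWTilde l M Φ u w s).inverse

/-- The random state `|φ(N, l, γ, M, Φ)⟩`: starting from `|0⟩ ⊗ |0⟩`, apply `N` times
`W̃_{l,j,Φ} (e^{-iγY} ⊗ I) W̃_{l,j,Φ}†` with a fresh uniformly random `j = (u, w, s)`. -/
def genState {n : ℕ} (U : ℝ → Op n) (l : ℕ) (γ : ℝ) (M : ℕ) (Φ : ℝ) : ℕ → Prog (Ket n)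
  | 0 => do
      Prog.tick (n + 1)
      return initKet n
  | N + 1 => do
      let ψ ← genState U l γ M Φ N
      let u ← Prog.uniform (Fin (10 * l ^ 2) → Fin n → Fin 4) (10 * l ^ 2 * n)
      let w ← Prog.uniform (Fin (l ^ 2 * M) → Fin n → Fin 4) (l ^ 2 * M * n)
      let s ← Prog.uniform ℤˣ 1
      Prog.tick (stepCircuit l M γ Φ u w s).cost
      return ((stepCircuit l M γ Φ u w s).matrix U).mulVec ψ

/-! ### Measurements of the control qubit -/

/-- The two bases in which the control qubit is measured; success means the outcome
`|0⟩`, respectively `|+⟩`. -/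
inductive Basis : Type
  | zero : Basis
  | plus : Basis

/-- Born probability of success for a unit vector. -/
def bornProb {n : ℕ} (ψ : Ket n) : Basis → NNReal
  | Basis.zero => ∑ x : Q n, ‖ψ (0, x)‖₊ ^ 2
  | Basis.plus => ∑ x : Q n, ‖(ψ (0, x) + ψ (1, x)) / (Real.sqrt 2 : ℂ)‖₊ ^ 2

/-- The qDRIFT iteration number `N(λ, t, ε) = ⌈max(10 λ² t² / ε, 5 λ t / 2)⌉`. -/
def qdriftN (lam t ε : ℝ) : ℕ := ⌈max (10 * lam ^ 2 * t ^ 2 / ε) (5 * lam * t / 2)⌉₊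

/-- `N' = N(1, kπ, 1/(4√2))`. -/
def iterN (k : ℕ) : ℕ := qdriftN 1 (k * Real.pi) (1 / (4 * Real.sqrt 2))

/-- The `(0,k)`- and `(+,k)`-measurements: prepare `|φ(N', l, kπ/N', 25k, Φ)⟩` and measure. -/
def experiment {n : ℕ} (U : ℝ → Op n) (l : ℕ) (Φ : ℝ) (b : Basis) (k : ℕ) : Prog Bool := do
  let ψ ← genState U l (k * Real.pi / iterN k) (25 * k) Φ (iterN k)
  Prog.coin (bornProb ψ b)

/-- Success probability of an experiment. -/
def successProb {n : ℕ} (U : ℝ → Op n) (l : ℕ) (Φ : ℝ) (b : Basis) (k : ℕ) : ℝ :=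
  ((PMF.map Prod.fst (experiment U l Φ b k).law) true).toReal

/-- Number of successes in `M` independent experiments. -/
def countSuccesses {n : ℕ} (U : ℝ → Op n) (l : ℕ) (Φ : ℝ) (b : Basis) (k : ℕ) : ℕ → Prog ℕ
  | 0 => return 0
  | M + 1 => do
      let a ← countSuccesses U l Φ b k M
      let r ← experiment U l Φ b k
      return (if r then a + 1 else a)

/-! ### Robust phase estimation -/

/-- `F(δ) = ⌈log((1-√8 δ)/2) / log(1 - (1-√8 δ)²/2)⌉`. -/
def rpeF (δ : ℝ) : ℕ :=
  ⌈Real.log ((1 / 2) * (1 - Real.sqrt 8 * δ)) /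
    Real.log (1 - (1 / 2) * (1 - Real.sqrt 8 * δ) ^ 2)⌉₊

/-- Number of stages `K = ⌈log₂(3π/σ)⌉` for the allowed root mean square error `σ`. -/
def rpeK (σ : ℝ) : ℕ := ⌈Real.logb 2 (3 * Real.pi / σ)⌉₊

/-- `M_j = F(δ) (3(K-j)+1)`. -/
def rpeM (δ : ℝ) (K j : ℕ) : ℕ := rpeF δ * (3 * (K - j) + 1)

/-- One refinement: `aZero, aPlus` successes out of `M` determine `kv` modulo `2π` as the angle of the
point `(2aZero/M - 1, 2aPlus/M - 1)`; the new estimate of `v` is the one compatible with this angle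
in the interval `(v - π/k, v + π/k]` around the previous estimate `v`. -/
def rpeUpdate (k M aZero aPlus : ℕ) (v : ℝ) : ℝ :=
  toIocMod Real.two_pi_pos (k * v - Real.pi)
    (Complex.arg ⟨2 * (aZero : ℝ) / M - 1, 2 * (aPlus : ℝ) / M - 1⟩) / k

/-- The first `J` of the `K` stages; stage `j` uses `k = 2^{j-1}` and `M_j` experiments of both
types.  `v₀` is the centre of the interval of length `2π` that is known to contain the phase. -/
def rpe {n : ℕ} (U : ℝ → Op n) (l : ℕ) (Φ δ : ℝ) (K : ℕ) (v₀ : ℝ) : ℕ → Prog ℝ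
  | 0 => return v₀
  | J + 1 => do
      let v ← rpe U l Φ δ K v₀ J
      let aZero ← countSuccesses U l Φ Basis.zero (2 ^ J) (rpeM δ K (J + 1))
      let aPlus ← countSuccesses U l Φ Basis.plus (2 ^ J) (rpeM δ K (J + 1))
      Prog.tick 1
      return rpeUpdate (2 ^ J) (rpeM δ K (J + 1)) aZero aPlus v

/-! ### The estimation subroutine -/

/-- One pass: robust phase estimation with allowed error `ε/(√2 t)` for `Φ = 0` and `Φ = π/2`;
returns `(v̂_0, v̂_{π/2})`. -/
def onePass {n : ℕ} (U : ℝ → Op n) (l : ℕ) (ε t δ : ℝ) : Prog (ℝ × ℝ) := do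
  let K := rpeK (ε / (Real.sqrt 2 * t))
  let v ← rpe U l 0 δ K (2 * Real.pi) K
  let v' ← rpe U l (Real.pi / 2) δ K 0 K
  Prog.tick 1
  return (v, v')

/-- The pass is rejected iff `(1/2π) √(v̂_0² + v̂_{π/2}²) ≤ 1/2`. -/
def Rejected (v : ℝ × ℝ) : Prop :=
  1 / (2 * Real.pi) * Real.sqrt (v.1 ^ 2 + v.2 ^ 2) ≤ 1 / 2

/-- Outcomes and step counts of all passes. -/
abbrev History : Type := ℕ → (ℝ × ℝ) × ℕ

/-- Independent passes of the subroutine. -/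
def runLaw {n : ℕ} (U : ℝ → Op n) (l : ℕ) (ε t δ : ℝ) : MeasureTheory.Measure History :=
  MeasureTheory.Measure.infinitePi fun _ : ℕ => (onePass U l ε t δ).law.toMeasure

/-- The subroutine halts: some pass is not rejected. -/
def Halts (ω : History) : Prop := ∃ i, ¬ Rejected (ω i).1

/-- `(v̂_0, v̂_{π/2})` of the first pass that is not rejected. -/
def accepted (ω : History) : ℝ × ℝ := (ω (sInf {i | ¬ Rejected (ω i).1})).1

/-- `Â cos θ̂ = v̂_0 / 2π`, `Â sin θ̂ = - v̂_{π/2} / 2π`. -/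
def outputZ (ω : History) : ℂ :=
  ⟨(accepted ω).1 / (2 * Real.pi), -(accepted ω).2 / (2 * Real.pi)⟩

/-- The estimate `Â_l`. -/
def outputA (ω : History) : ℝ := ‖outputZ ω‖

/-- The estimate `θ̂_l ∈ [0, 2π)`. -/
def outputTheta (ω : History) : ℝ := toIcoMod Real.two_pi_pos 0 (outputZ ω).arg

open Classical in
/-- Total number of steps of all passes up to and including the first that is not rejected. -/
def runtime (ω : History) : ENNReal :=
  ∑' i, if ∀ j < i, Rejected (ω j).1 then ((ω i).2 : ENNReal) else 0

end UHET

end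

open UHET

namespace UHET

section

open scoped ENNReal Matrix

/-! ### Expectations of programs -/

/-! Compensation identity. The circuits are block diagonal in the control qubit. On `|0⟩` the
queries compose to an ordinary evolution; on `|1⟩` each query is conjugated by its own random Pauli
string. Twirling turns each such factor into its normalized trace, so the average of the `|1⟩`
branch is scalar (`avg_conjProd`). The observable is off-diagonal, hence linear in that branch, and
the scalar comes out as `compZ`; the phases due to `tr H` cancel between the branches
(`isCompensation`). As `H₀` is traceless, the normalized trace differs from 1 only to second order,
which gives |z - 1| ≤ 1/8 for z = `compZ H l (10 * l ^ 2)`.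

Random states. In `circuitWTilde` the two ladders have opposite total times, so the `|0⟩` branch
reduces to a phase, and one random step is cos γ + sin γ K with K² = -1 (`stepCircuit_matrix`). The
average of K is -i r Y with r close to Re(e^{iΦ} z). In the Heisenberg picture one step therefore
rotates cos α Z + sin α X by the angle 2γr up to an error 4γ² (`norm_heis_rot_sub_le`). Averaged
conjugations are contractions, so the errors only add up. With γ = kπ/N' and N' of order k² the
total is a small constant, and both success probabilities are within 1/5 of the ideal ones for the
phase k v_Φ (`abs_quadForm_heis_le`).

Phase estimation. Allowing another 1/10 for sampling, the measured point lies within √(18/25) < √3/2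
of the ideal point on the unit circle, so its angle is off by less than π/3. A stage entered with
error at most 2π/3 in units of 1/k is left with error below π/3, which is again 2π/3 in the next
unit (`abs_rpeUpdate_sub_lt`). Failed stages are handled by the potential `rpePotential`: it does
not grow in a good stage, and grows by O(4^{-J}) in a bad one. Chernoff bounds and the growth of M_j
towards early stages make the expected potential geometric (`expect_rpePotential_le`), so the mean
square error is at most π²/(2·4^K).

Repetition. A rejected pass has an error of at least 3π/4 in v̂_0, so by Markov it has probability
at most 8/9, and there are at most 9 passes on average (`lintegral_tsum_prefix`). The squared error
of the accepted pass is bounded by the sum over all passes that are run, which costs the same factor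
9 and needs no conditioning. Every pass takes the same number of steps, a sum over stages k = 2^J of
terms of order l² n k³ that is dominated by the last stage, where k is of order t/ε. -/

/-- Expectation of a nonnegative function under a discrete law. -/
noncomputable def expect {α : Type} (p : PMF α) (f : α → ℝ≥0∞) : ℝ≥0∞ := ∑' a, p a * f a

/-- The law of the result of a program. -/
noncomputable def Prog.val {α : Type} (p : Prog α) : PMF α := PMF.map Prod.fst p.law

/-- Every run of the program takes exactly `c` steps. -/
def Prog.HasCost {α : Type} (p : Prog α) (c : ℕ) : Prop := ∀ x ∈ p.law.support, x.2 = c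

section Expect

variable {α β : Type}

theorem expect_pure (a : α) (f : α → ℝ≥0∞) : expect (PMF.pure a) f = f a := by
  unfold expect
  rw [tsum_eq_single a]
  · simp
  · intro b hb
    simp [PMF.pure_apply, hb]

theorem expect_bind (p : PMF α) (g : α → PMF β) (f : β → ℝ≥0∞) :
    expect (p.bind g) f = expect p fun a => expect (g a) f := by
  unfold expect
  simp only [PMF.bind_apply, ← ENNReal.tsum_mul_right, ← ENNReal.tsum_mul_left]
  rw [ENNReal.tsum_comm]
  simp only [mul_assoc]

theorem expect_map (p : PMF α) (g : α → β) (f : β → ℝ≥0∞) :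
    expect (p.map g) f = expect p fun a => f (g a) := by
  rw [← PMF.bind_pure_comp, expect_bind]
  simp only [Function.comp, expect_pure]

theorem expect_mono (p : PMF α) {f g : α → ℝ≥0∞} (h : ∀ a, f a ≤ g a) :
    expect p f ≤ expect p g :=
  ENNReal.tsum_le_tsum fun a => mul_le_mul_right (h a) _

theorem expect_congr_support (p : PMF α) {f g : α → ℝ≥0∞} (h : ∀ a ∈ p.support, f a = g a) :
    expect p f = expect p g := by
  refine tsum_congr fun a => ?_
  by_cases ha : a ∈ p.support
  · rw [h a ha]
  · rw [(PMF.apply_eq_zero_iff p a).2 ha, zero_mul, zero_mul]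

theorem expect_const (p : PMF α) (c : ℝ≥0∞) : expect p (fun _ => c) = c := by
  unfold expect
  rw [ENNReal.tsum_mul_right, p.tsum_coe, one_mul]

theorem expect_add (p : PMF α) (f g : α → ℝ≥0∞) :
    expect p (fun a => f a + g a) = expect p f + expect p g := by
  unfold expect
  simp only [mul_add]
  exact ENNReal.tsum_add

theorem expect_const_mul (p : PMF α) (c : ℝ≥0∞) (f : α → ℝ≥0∞) :
    expect p (fun a => c * f a) = c * expect p f := by
  unfold expect
  rw [← ENNReal.tsum_mul_left]
  exact tsum_congr fun a => mul_left_comm _ _ _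

theorem expect_uniform [Fintype α] [Nonempty α] (f : α → ℝ≥0∞) :
    expect (PMF.uniformOfFintype α) f = (Fintype.card α : ℝ≥0∞)⁻¹ * ∑ a, f a := by
  unfold expect
  rw [tsum_fintype, Finset.mul_sum]
  simp [PMF.uniformOfFintype_apply]

theorem expect_uniform_ofReal [Fintype α] [Nonempty α] (f : α → ℝ) (hf : ∀ a, 0 ≤ f a) :
    expect (PMF.uniformOfFintype α) (fun a => ENNReal.ofReal (f a)) =
      ENNReal.ofReal ((Fintype.card α : ℝ)⁻¹ * ∑ a, f a) := by
  rw [expect_uniform, ENNReal.ofReal_mul (by positivity),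
    ENNReal.ofReal_sum_of_nonneg fun a _ => hf a, ENNReal.ofReal_inv_of_pos, ENNReal.ofReal_natCast]
  exact_mod_cast Fintype.card_pos

/-- The measure is a sum of weighted Dirac masses. The type need not be countable: the results of
phase estimation are real numbers. -/
theorem lintegral_toMeasure [MeasurableSpace α] (p : PMF α) {f : α → ℝ≥0∞} (hf : Measurable f) :
    ∫⁻ a, f a ∂p.toMeasure = expect p f := by
  have h : p.toMeasure = MeasureTheory.Measure.sum fun a => p a • MeasureTheory.Measure.dirac a := by
    ext s hs
    rw [p.toMeasure_apply hs, MeasureTheory.Measure.sum_apply _ hs]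
    refine tsum_congr fun a => ?_
    rw [MeasureTheory.Measure.smul_apply, MeasureTheory.Measure.dirac_apply' _ hs, smul_eq_mul]
    by_cases ha : a ∈ s <;> simp [ha]
  rw [h, MeasureTheory.lintegral_sum_measure]
  refine tsum_congr fun a => ?_
  rw [MeasureTheory.lintegral_smul_measure, MeasureTheory.lintegral_dirac' _ hf, smul_eq_mul]

end Expect

/-! ### Laws of results and deterministic step counts of programs. -/

namespace Prog

variable {α β : Type}

theorem val_pure (a : α) : val (pure a : Prog α) = PMF.pure a := by
  show PMF.map Prod.fst (PMF.pure (a, 0)) = _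
  rw [PMF.pure_map]

theorem val_bind (p : Prog α) (f : α → Prog β) :
    val (p >>= f) = (val p).bind fun a => val (f a) := by
  show PMF.map Prod.fst (PMF.bind (law p) fun x => PMF.map (fun y => (y.1, x.2 + y.2)) (law (f x.1))) = _
  rw [PMF.map_bind, val, PMF.bind_map]
  congr 1
  funext x
  rw [PMF.map_comp]
  rfl

theorem expect_val_pure (a : α) (f : α → ℝ≥0∞) : expect (val (pure a : Prog α)) f = f a := by
  rw [val_pure, expect_pure]

theorem expect_val_bind (p : Prog α) (g : α → Prog β) (f : β → ℝ≥0∞) :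
    expect (val (p >>= g)) f = expect (val p) fun a => expect (val (g a)) f := by
  rw [val_bind, expect_bind]

theorem val_tick (c : ℕ) : val (tick c) = PMF.pure () := by
  show PMF.map Prod.fst (PMF.pure ((), c)) = _
  rw [PMF.pure_map]

theorem expect_val_tick (c : ℕ) (f : Unit → ℝ≥0∞) : expect (val (tick c)) f = f () := by
  rw [val_tick, expect_pure]

theorem val_uniform [Fintype α] [Nonempty α] (c : ℕ) :
    val (uniform α c) = PMF.uniformOfFintype α := by
  show PMF.map Prod.fst (PMF.map (fun a => (a, c)) (PMF.uniformOfFintype α)) = _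
  rw [PMF.map_comp]
  exact PMF.map_id _

theorem expect_val_coin (p : NNReal) (f : Bool → ℝ≥0∞) :
    expect (val (coin p)) f = (min p 1 : NNReal) * f true + (1 - min p 1 : NNReal) * f false := by
  show expect (PMF.map Prod.fst (PMF.map _ _)) f = _
  rw [expect_map, expect_map]
  unfold expect
  rw [tsum_fintype, Fintype.sum_bool]
  simp [PMF.ofFintype_apply]

theorem hasCost_pure (a : α) : HasCost (pure a : Prog α) 0 := by
  intro x hx
  have : x ∈ (PMF.pure (a, 0)).support := hx
  rw [PMF.mem_support_pure_iff] at this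
  rw [this]

theorem hasCost_bind {p : Prog α} {f : α → Prog β} {c d : ℕ} (hp : HasCost p c)
    (hf : ∀ a, HasCost (f a) d) : HasCost (p >>= f) (c + d) := by
  intro x hx
  have : x ∈ (PMF.bind (law p) fun x =>
    PMF.map (fun y => (y.1, x.2 + y.2)) (law (f x.1))).support := hx
  rw [PMF.mem_support_bind_iff] at this
  obtain ⟨y, hy, hxy⟩ := this
  rw [PMF.mem_support_map_iff] at hxy
  obtain ⟨z, hz, rfl⟩ := hxy
  have h1 := hp y hy
  have h2 := hf _ z hz
  simp only [h1, h2]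

theorem hasCost_tick (c : ℕ) : HasCost (tick c) c := by
  intro x hx
  have : x ∈ (PMF.pure ((), c)).support := hx
  rw [PMF.mem_support_pure_iff] at this
  rw [this]

theorem hasCost_uniform [Fintype α] [Nonempty α] (c : ℕ) : HasCost (uniform α c) c := by
  intro x hx
  have : x ∈ (PMF.map (fun a => (a, c)) (PMF.uniformOfFintype α)).support := hx
  rw [PMF.mem_support_map_iff] at this
  obtain ⟨a, -, rfl⟩ := this
  rfl

theorem hasCost_coin (p : NNReal) : HasCost (coin p) 1 := by
  intro x hx
  unfold law coin at hx
  rw [PMF.mem_support_map_iff] at hx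
  obtain ⟨a, -, rfl⟩ := hx
  rfl

end Prog

/-! ### Block operators on control qubit ⊗ system -/

/-- The operator with blocks `a b` over `c d` with respect to the control qubit. -/
def blk {n : ℕ} (a b c d : Op n) : COp n :=
  Matrix.of fun p q => (![![a, b], ![c, d]] p.1 q.1) p.2 q.2

section Blk

variable {n : ℕ}

theorem blk_mul (a b c d a' b' c' d' : Op n) :
    blk a b c d * blk a' b' c' d' =
      blk (a * a' + b * c') (a * b' + b * d') (c * a' + d * c') (c * b' + d * d') := by
  ext ⟨i, x⟩ ⟨j, y⟩
  fin_cases i <;> fin_cases j <;>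
    simp [blk, Matrix.mul_apply, Fintype.sum_prod_type, Fin.sum_univ_two]

theorem blk_add (a b c d a' b' c' d' : Op n) :
    blk a b c d + blk a' b' c' d' = blk (a + a') (b + b') (c + c') (d + d') := by
  ext ⟨i, x⟩ ⟨j, y⟩
  fin_cases i <;> fin_cases j <;> simp [blk]

theorem blk_sub (a b c d a' b' c' d' : Op n) :
    blk a b c d - blk a' b' c' d' = blk (a - a') (b - b') (c - c') (d - d') := by
  ext ⟨i, x⟩ ⟨j, y⟩
  fin_cases i <;> fin_cases j <;> simp [blk]

theorem smul_blk (r : ℂ) (a b c d : Op n) :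
    r • blk a b c d = blk (r • a) (r • b) (r • c) (r • d) := by
  ext ⟨i, x⟩ ⟨j, y⟩
  fin_cases i <;> fin_cases j <;> simp [blk]

theorem sum_blk {ι : Type*} (s : Finset ι) (a b c d : ι → Op n) :
    ∑ i ∈ s, blk (a i) (b i) (c i) (d i) =
      blk (∑ i ∈ s, a i) (∑ i ∈ s, b i) (∑ i ∈ s, c i) (∑ i ∈ s, d i) := by
  ext ⟨i, x⟩ ⟨j, y⟩
  fin_cases i <;> fin_cases j <;> simp [blk, Matrix.sum_apply]

theorem blk_conjTranspose (a b c d : Op n) : (blk a b c d)ᴴ = blk aᴴ cᴴ bᴴ dᴴ := by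
  ext ⟨i, x⟩ ⟨j, y⟩
  fin_cases i <;> fin_cases j <;> simp [blk]

theorem one_eq_blk : (1 : COp n) = blk 1 0 0 1 := by
  ext ⟨i, x⟩ ⟨j, y⟩
  fin_cases i <;> fin_cases j <;> simp [blk, Matrix.one_apply]

theorem kronecker_eq_blk (A : Matrix (Fin 2) (Fin 2) ℂ) (M : Op n) :
    A ⊗ₖ M = blk (A 0 0 • M) (A 0 1 • M) (A 1 0 • M) (A 1 1 • M) := by
  ext ⟨i, x⟩ ⟨j, y⟩
  fin_cases i <;> fin_cases j <;> simp [blk]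

theorem ctrl_eq_blk (V : Op n) : ctrl V = blk 1 0 0 V := by
  simp [ctrl, kronecker_eq_blk, blk_add]

theorem query_matrix (U : ℝ → Op n) (τ : ℝ) :
    (Gate.query τ).matrix U = blk (U τ) 0 0 (U τ) := by
  simp [Gate.matrix, kronecker_eq_blk]

theorem exp_smul_pauliZ (a : ℂ) :
    NormedSpace.exp (a • pauliZ) = !![Complex.exp a, 0; 0, Complex.exp (-a)] := by
  have h : a • pauliZ = Matrix.diagonal ![a, -a] := by
    ext i j
    fin_cases i <;> fin_cases j <;> simp [pauliZ]
  rw [h, Matrix.exp_diagonal]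
  ext i j
  fin_cases i <;> fin_cases j <;> simp [Pi.coe_exp, Complex.exp_eq_exp_ℂ]

theorem exp_smul_pauliY (a : ℂ) :
    NormedSpace.exp (a • pauliY) =
      !![Complex.cosh a, -Complex.I * Complex.sinh a; Complex.I * Complex.sinh a,
        Complex.cosh a] := by
  -- The columns (1, i) and (1, -i) are eigenvectors of Y for 1 and -1, so conjugation by V reduces
  -- the exponential to that of Z.
  let V : (Matrix (Fin 2) (Fin 2) ℂ)ˣ :=
    ⟨!![1, 1; Complex.I, -Complex.I], !![1 / 2, -Complex.I / 2; 1 / 2, Complex.I / 2],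
      by
        ext i j
        fin_cases i <;> fin_cases j <;>
          simp [Matrix.mul_apply, Fin.sum_univ_two] <;> ring_nf <;> simp,
      by
        ext i j
        fin_cases i <;> fin_cases j <;>
          simp [Matrix.mul_apply, Fin.sum_univ_two] <;> ring_nf <;> simp <;> norm_num⟩
  have h : a • pauliY = (V : Matrix (Fin 2) (Fin 2) ℂ) * (a • pauliZ) *
      ((V⁻¹ : (Matrix (Fin 2) (Fin 2) ℂ)ˣ) : Matrix (Fin 2) (Fin 2) ℂ) := by
    show _ = !![1, 1; Complex.I, -Complex.I] * (a • pauliZ) *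
      !![1 / 2, -Complex.I / 2; 1 / 2, Complex.I / 2]
    ext i j
    fin_cases i <;> fin_cases j <;>
      simp [Matrix.mul_apply, Fin.sum_univ_two, pauliY, pauliZ] <;> ring_nf
  rw [h, Matrix.exp_units_conj, exp_smul_pauliZ]
  show !![1, 1; Complex.I, -Complex.I] * _ * !![1 / 2, -Complex.I / 2; 1 / 2, Complex.I / 2] = _
  ext i j
  fin_cases i <;> fin_cases j <;>
    simp [Matrix.mul_apply, Fin.sum_univ_two, Complex.cosh, Complex.sinh] <;> ring_nf <;>
    simp <;> ring

theorem rotZ_matrix (U : ℝ → Op n) (θ : ℝ) : (Gate.rotZ θ).matrix U =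
    blk (Complex.exp (-(Complex.I * θ)) • 1) 0 0 (Complex.exp (Complex.I * θ) • 1) := by
  rw [Gate.matrix, exp_smul_pauliZ, kronecker_eq_blk]
  simp

theorem rotY_matrix (U : ℝ → Op n) (θ : ℝ) : (Gate.rotY θ).matrix U =
    blk ((Real.cos θ : ℂ) • 1) (-(Real.sin θ : ℂ) • 1) ((Real.sin θ : ℂ) • 1)
      ((Real.cos θ : ℂ) • 1) := by
  have h1 : Complex.cosh (-(Complex.I * θ)) = Real.cos θ := by
    rw [Complex.cosh_neg, mul_comm, Complex.cosh_mul_I, Complex.ofReal_cos]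
  have h2 : Complex.sinh (-(Complex.I * θ)) = -(Real.sin θ * Complex.I) := by
    rw [Complex.sinh_neg, mul_comm, Complex.sinh_mul_I, Complex.ofReal_sin]
  have h3 : Complex.I * (Real.sin θ * Complex.I) = -(Real.sin θ : ℂ) := by
    rw [mul_left_comm, Complex.I_mul_I, mul_neg_one]
  rw [Gate.matrix, exp_smul_pauliY, kronecker_eq_blk, h1, h2]
  simp only [Matrix.of_apply, Matrix.cons_val', Matrix.cons_val_zero, Matrix.cons_val_one,
    Matrix.cons_val_fin_one, mul_neg, neg_mul, neg_neg, h3]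

end Blk

/-! ### Pauli strings -/

section Pauli

variable {n : ℕ}

theorem pauli_conjTranspose (b : Fin 4) : (pauli b)ᴴ = pauli b := by
  fin_cases b <;> ext i j <;> fin_cases i <;> fin_cases j <;>
    simp [pauli, pauliX, pauliY, pauliZ]

theorem pauli_mul_self (b : Fin 4) : pauli b * pauli b = 1 := by
  fin_cases b <;> ext i j <;> fin_cases i <;> fin_cases j <;>
    simp [pauli, pauliX, pauliY, pauliZ, Matrix.mul_apply, Fin.sum_univ_two]

/-- Completeness of the Pauli basis of 2×2 matrices; its n-fold product is what makes the Pauli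
twirl work. -/
theorem sum_pauli_mul_pauli (x y z w : Fin 2) :
    ∑ b, pauli b x y * pauli b z w = if x = w ∧ y = z then 2 else 0 := by
  fin_cases x <;> fin_cases y <;> fin_cases z <;> fin_cases w <;>
    simp [pauli, pauliX, pauliY, pauliZ, Fin.sum_univ_four] <;> norm_num

theorem pauliString_conjTranspose (v : Fin n → Fin 4) : (pauliString v)ᴴ = pauliString v := by
  ext x y
  simp only [Matrix.conjTranspose_apply, pauliString, Matrix.of_apply, star_prod]
  refine Finset.prod_congr rfl fun i _ => ?_
  rw [← Matrix.conjTranspose_apply, pauli_conjTranspose]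

theorem pauliString_mul_self (v : Fin n → Fin 4) : pauliString v * pauliString v = 1 := by
  ext x y
  simp only [Matrix.mul_apply, pauliString, Matrix.of_apply, ← Finset.prod_mul_distrib]
  rw [← Fintype.prod_sum (fun i (b : Fin 2) => pauli (v i) (x i) b * pauli (v i) b (y i))]
  simp only [← Matrix.mul_apply, pauli_mul_self]
  simp only [Matrix.one_apply, Finset.prod_ite_zero, Finset.prod_const_one]
  simp [funext_iff]

/-- Averaging over all Pauli strings projects onto multiples of the identity. -/
theorem sum_pauliString_conj (M : Op n) :
    ∑ v : Fin n → Fin 4, pauliString v * M * pauliString v = (2 ^ n * M.trace) • (1 : Op n) := by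
  ext x w
  have h : ∀ y z : Q n, ∑ v : Fin n → Fin 4, pauliString v x y * pauliString v z w =
      if x = w ∧ y = z then 2 ^ n else 0 := by
    intro y z
    simp only [pauliString, Matrix.of_apply, ← Finset.prod_mul_distrib]
    rw [← Fintype.prod_sum (fun i (b : Fin 4) => pauli b (x i) (y i) * pauli b (z i) (w i))]
    simp only [sum_pauli_mul_pauli, Finset.prod_ite_zero]
    simp [funext_iff, forall_and]
  simp only [Matrix.sum_apply, Matrix.mul_apply, Matrix.smul_apply, Matrix.one_apply, smul_eq_mul,
    Finset.sum_mul]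
  rw [Finset.sum_comm]
  simp only [Finset.sum_comm (s := (Finset.univ : Finset (Fin n → Fin 4)))]
  have h' : ∀ y z : Q n, ∑ v : Fin n → Fin 4, pauliString v x y * M y z * pauliString v z w =
      if x = w ∧ y = z then 2 ^ n * M y z else 0 := by
    intro y z
    have : ∀ v : Fin n → Fin 4, pauliString v x y * M y z * pauliString v z w =
      (pauliString v x y * pauliString v z w) * M y z := fun v => by ring
    simp only [this]
    rw [← Finset.sum_mul, h]
    split_ifs <;> simp
  simp only [h']
  by_cases hxw : x = w
  · simp [hxw, Matrix.trace, Finset.mul_sum]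
  · simp [hxw]

/-- Distributivity, with the order of the factors kept. It lets the average of a ladder be taken
factor by factor. -/
theorem sum_prod_ofFn {R β : Type*} [Semiring R] [Fintype β] (N : ℕ) (f : β → R) :
    ∑ v : Fin N → β, ((List.ofFn v).map f).prod = (∑ b, f b) ^ N := by
  induction N with
  | zero => simp
  | succ N ih =>
    rw [← (Fin.consEquiv fun _ : Fin (N + 1) => β).sum_comp, Fintype.sum_prod_type, pow_succ', ← ih,
      Finset.sum_mul_sum]
    simp [Fin.consEquiv, List.ofFn_succ]

end Pauli

/-! ### Evolution -/

section Evolution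

variable {n : ℕ} {H : Op n}

theorem evolution_zero : evolution H 0 = 1 := by
  simp [evolution, NormedSpace.exp_zero]

theorem evolution_add (a b : ℝ) : evolution H (a + b) = evolution H a * evolution H b := by
  unfold evolution
  rw [← Matrix.exp_add_of_commute _ _ (((Commute.refl H).smul_left _).smul_right _), ← add_smul]
  congr 2
  push_cast
  ring

theorem evolution_pow (τ : ℝ) (N : ℕ) : evolution H τ ^ N = evolution H (N * τ) := by
  unfold evolution
  rw [← Matrix.exp_nsmul, ← Nat.cast_smul_eq_nsmul ℂ, smul_smul]
  congr 2
  push_cast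
  ring

theorem evolution_conjTranspose (hH : H.IsHermitian) (τ : ℝ) :
    (evolution H τ)ᴴ = evolution H (-τ) := by
  unfold evolution
  rw [← Matrix.exp_conjTranspose, Matrix.conjTranspose_smul, hH.eq]
  simp

theorem evolution_neg_mul (τ : ℝ) : evolution H (-τ) * evolution H τ = 1 := by
  rw [← evolution_add, neg_add_cancel, evolution_zero]

theorem exp_smul_one (a : ℂ) : NormedSpace.exp (a • (1 : Op n)) = Complex.exp a • 1 := by
  rw [← Matrix.diagonal_one, ← Matrix.diagonal_smul, ← Matrix.diagonal_smul, Matrix.exp_diagonal]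
  congr 1
  ext i
  simp [Pi.coe_exp, Complex.exp_eq_exp_ℂ]

theorem exp_smul_add_smul_one (a c : ℂ) (M : Op n) :
    NormedSpace.exp (a • (M + c • (1 : Op n))) = Complex.exp (a * c) • NormedSpace.exp (a • M) := by
  rw [smul_add, Matrix.exp_add_of_commute, smul_smul, exp_smul_one, Matrix.mul_smul, mul_one]
  exact ((Commute.one_right M).smul_right c).smul_left a |>.smul_right a

theorem eq_traceless_add (H : Op n) : H = traceless H + (H.trace / 2 ^ n) • (1 : Op n) := by
  simp [traceless]

/-- The trace part of `H` is central, so it contributes only a scalar. All such scalars cancel later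
between the two control branches or the two ladders. -/
theorem evolution_eq_phase (τ : ℝ) : evolution H τ =
    Complex.exp (-(Complex.I * τ) * (H.trace / 2 ^ n)) • evolution (traceless H) τ := by
  conv_lhs => rw [evolution, eq_traceless_add H, exp_smul_add_smul_one]
  rfl

theorem card_Q : Fintype.card (Q n) = 2 ^ n := by simp

theorem trace_traceless : (traceless H).trace = 0 := by
  rw [traceless, Matrix.trace_sub, Matrix.trace_smul, Matrix.trace_one, card_Q]
  simp

theorem star_trace_of_isHermitian (hH : H.IsHermitian) :
    (starRingEnd ℂ) H.trace = H.trace := by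
  have := Matrix.trace_conjTranspose H
  rw [hH.eq] at this
  exact this.symm

theorem traceless_isHermitian (hH : H.IsHermitian) : (traceless H).IsHermitian := by
  unfold Matrix.IsHermitian traceless
  rw [Matrix.conjTranspose_sub, Matrix.conjTranspose_smul, hH.eq, Matrix.conjTranspose_one]
  congr 2
  rw [star_div₀, star_pow]
  congr 1
  · exact star_trace_of_isHermitian hH
  · simp

/-- The normalized trace `2^{-n} tr e^{-iτH}`. -/
noncomputable def normTrace (H : Op n) (τ : ℝ) : ℂ := (evolution H τ).trace / 2 ^ n

theorem normTrace_eq_phase (τ : ℝ) : normTrace H τ =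
    Complex.exp (-(Complex.I * τ) * (H.trace / 2 ^ n)) * normTrace (traceless H) τ := by
  rw [normTrace, evolution_eq_phase, Matrix.trace_smul, smul_eq_mul, normTrace, mul_div_assoc]

theorem normTrace_neg (hH : H.IsHermitian) (τ : ℝ) :
    normTrace H (-τ) = (starRingEnd ℂ) (normTrace H τ) := by
  rw [normTrace, normTrace, ← evolution_conjTranspose hH, Matrix.trace_conjTranspose, map_div₀,
    map_pow, Complex.conj_ofNat]
  rfl

theorem compZ_eq (k : ℤ) (N : ℕ) :
    compZ H k N = normTrace (traceless H) (k * Real.pi / (2 * N)) ^ N := rfl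

/-! ### Spectral estimates for the normalized trace. -/

theorem abs_eigenvalues_le (hH : H.IsHermitian) (hn : ‖Matrix.toEuclideanCLM (𝕜 := ℂ) H‖ ≤ 1)
    (i : Q n) : |hH.eigenvalues i| ≤ 1 := by
  have h1 := (Matrix.toEuclideanCLM (𝕜 := ℂ) H).le_opNorm (hH.eigenvectorBasis i)
  have h2 : Matrix.toEuclideanCLM (𝕜 := ℂ) H (hH.eigenvectorBasis i) =
      (hH.eigenvalues i : ℂ) • hH.eigenvectorBasis i := by
    have := hH.mulVec_eigenvectorBasis i
    apply (WithLp.ofLp_injective 2)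
    rw [Matrix.ofLp_toEuclideanCLM, this]
    rfl
  rw [h2, norm_smul, hH.eigenvectorBasis.orthonormal.1 i, mul_one, mul_one, Complex.norm_real] at h1
  exact h1.trans hn

theorem trace_evolution (hH : H.IsHermitian) (τ : ℝ) : (evolution H τ).trace =
    ∑ i, Complex.exp (-(Complex.I * τ) * hH.eigenvalues i) := by
  have h := hH.spectral_theorem
  rw [Unitary.conjStarAlgAut_apply] at h
  let V : (Op n)ˣ := Unitary.toUnits hH.eigenvectorUnitary
  have hV : (-(Complex.I * τ)) • H = (V : Op n) *
      Matrix.diagonal (fun i => -(Complex.I * τ) * (hH.eigenvalues i : ℂ)) *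
      ((V⁻¹ : (Op n)ˣ) : Op n) := by
    have h3 : Matrix.diagonal (fun i => -(Complex.I * τ) * (hH.eigenvalues i : ℂ)) =
      (-(Complex.I * τ)) • Matrix.diagonal (RCLike.ofReal ∘ hH.eigenvalues) := by
      rw [← Matrix.diagonal_smul]; rfl
    rw [h3, Matrix.mul_smul, Matrix.smul_mul]
    congr 1
  rw [evolution, hV, Matrix.exp_units_conj, Matrix.trace_mul_comm, ← mul_assoc, Units.inv_mul,
    one_mul, Matrix.exp_diagonal, Matrix.trace_diagonal]
  simp [Pi.coe_exp, Complex.exp_eq_exp_ℂ]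

theorem norm_exp_sub_one_sub_le (x : ℝ) (hx : |x| ≤ 4 / 25) :
    ‖Complex.exp (Complex.I * x) - 1 - Complex.I * x‖ ≤ 501 / 1000 * x ^ 2 := by
  have h : Complex.exp (Complex.I * x) - 1 - Complex.I * x =
      ((Real.cos x - 1 : ℝ) : ℂ) + ((Real.sin x - x : ℝ) : ℂ) * Complex.I := by
    rw [mul_comm, Complex.exp_mul_I]
    push_cast
    ring
  have h1 : |Real.cos x - 1| ≤ x ^ 2 / 2 := by
    rw [abs_le]
    constructor <;> linarith [Real.one_sub_sq_div_two_le_cos (x := x), Real.cos_le_one x,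
      sq_nonneg x]
  have h2 : |Real.sin x - x| ≤ |x| ^ 3 / 6 := by
    rw [abs_sub_comm]
    exact Real.abs_sub_sin_le x
  have h1' : (Real.cos x - 1) ^ 2 ≤ (x ^ 2 / 2) ^ 2 := sq_le_sq' (abs_le.1 h1).1 (abs_le.1 h1).2
  have h2' : (Real.sin x - x) ^ 2 ≤ (|x| ^ 3 / 6) ^ 2 := sq_le_sq' (abs_le.1 h2).1 (abs_le.1 h2).2
  have hx2 : x ^ 2 ≤ (4 / 25) ^ 2 := by
    rw [← sq_abs]
    gcongr
  rw [h, Complex.norm_add_mul_I]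
  apply Real.sqrt_le_iff.2
  refine ⟨by positivity, ?_⟩
  -- The sum of squares is at most x⁴ (1/4 + x²/36), and |x| ≤ 4/25 makes the bracket smaller than
  -- (501/1000)².
  have h3 : (|x| ^ 3 / 6) ^ 2 = x ^ 4 * x ^ 2 / 36 := by
    rw [div_pow, ← pow_mul, mul_comm, pow_mul, sq_abs]
    ring
  have h4 : 0 ≤ x ^ 4 := by positivity
  nlinarith [mul_le_mul_of_nonneg_left hx2 h4]

/-- The normalized trace averages e^{-iτλ} over eigenvalues with |λ| ≤ 1 and sum 0, so the first
order term drops out. The range 4/25 covers the largest query time used later, π/20. -/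
theorem norm_normTrace_sub_one_le (hH : IsSeed H) (τ : ℝ) (hτ : |τ| ≤ 4 / 25) :
    ‖normTrace (traceless H) τ - 1‖ ≤ 501 / 1000 * τ ^ 2 := by
  have hh := traceless_isHermitian hH.1
  have hlam := abs_eigenvalues_le hh hH.2
  have htr : ∑ i, (hh.eigenvalues i : ℂ) = 0 := by
    have := hh.trace_eq_sum_eigenvalues
    rw [trace_traceless] at this
    exact this.symm
  have h2 : (2 ^ n : ℂ) ≠ 0 := pow_ne_zero _ two_ne_zero
  have hsum : normTrace (traceless H) τ - 1 =
      (∑ i, (Complex.exp (Complex.I * ((-τ * hh.eigenvalues i : ℝ) : ℂ)) - 1 -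
        Complex.I * ((-τ * hh.eigenvalues i : ℝ) : ℂ))) / 2 ^ n := by
    have h3 : ∑ i, Complex.I * ((-τ * hh.eigenvalues i : ℝ) : ℂ) = 0 := by
      have : ∀ i, Complex.I * ((-τ * hh.eigenvalues i : ℝ) : ℂ) =
        (-(Complex.I * τ)) * hh.eigenvalues i := fun i => by push_cast; ring
      simp only [this]
      rw [← Finset.mul_sum, htr, mul_zero]
    rw [Finset.sum_sub_distrib, h3, sub_zero, Finset.sum_sub_distrib, Finset.sum_const,
      Finset.card_univ, card_Q, normTrace, trace_evolution hh, sub_div]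
    congr 1
    · congr 1
      refine Finset.sum_congr rfl fun i _ => ?_
      congr 1
      push_cast
      ring
    · simp [h2]
  have hi : ∀ i, |(-τ) * hh.eigenvalues i| ≤ |τ| := fun i => by
    rw [abs_mul, abs_neg]
    exact mul_le_of_le_one_right (abs_nonneg _) (hlam i)
  rw [hsum, norm_div, norm_pow, Complex.norm_ofNat, div_le_iff₀ (by positivity)]
  refine (norm_sum_le _ _).trans ?_
  have : ∀ i ∈ (Finset.univ : Finset (Q n)),
      ‖Complex.exp (Complex.I * ((-τ * hh.eigenvalues i : ℝ) : ℂ)) - 1 -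
        Complex.I * ((-τ * hh.eigenvalues i : ℝ) : ℂ)‖ ≤ 501 / 1000 * τ ^ 2 := fun i _ => by
    refine (norm_exp_sub_one_sub_le _ ((hi i).trans hτ)).trans ?_
    have := sq_le_sq.2 (hi i)
    linarith
  refine (Finset.sum_le_card_nsmul _ _ _ this).trans ?_
  rw [Finset.card_univ, card_Q, nsmul_eq_mul]
  push_cast
  linarith

theorem norm_normTrace_le (hH : H.IsHermitian) (τ : ℝ) : ‖normTrace H τ‖ ≤ 1 := by
  rw [normTrace, trace_evolution hH, norm_div, norm_pow, Complex.norm_ofNat,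
    div_le_iff₀ (by positivity)]
  refine (norm_sum_le _ _).trans ?_
  have : ∀ i, ‖Complex.exp (-(Complex.I * τ) * hH.eigenvalues i)‖ = 1 := fun i => by
    have h : -(Complex.I * τ) * hH.eigenvalues i =
        Complex.I * ((-τ * hH.eigenvalues i : ℝ) : ℂ) := by push_cast; ring
    rw [h, Complex.norm_exp_I_mul_ofReal]
  simp only [this, Finset.sum_const, Finset.card_univ, card_Q]
  simp

theorem norm_pow_sub_one_le {z : ℂ} (hz : ‖z‖ ≤ 1) (N : ℕ) : ‖z ^ N - 1‖ ≤ N * ‖z - 1‖ := by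
  induction N with
  | zero => simp
  | succ N ih =>
    have : z ^ (N + 1) - 1 = z * (z ^ N - 1) + (z - 1) := by ring
    rw [this]
    refine (norm_add_le _ _).trans ?_
    rw [norm_mul]
    have h1 : ‖z‖ * ‖z ^ N - 1‖ ≤ 1 * ‖z ^ N - 1‖ := by gcongr
    push_cast
    linarith

theorem norm_compZ_le (hH : IsSeed H) (k : ℤ) (N : ℕ) : ‖compZ H k N‖ ≤ 1 := by
  rw [compZ_eq, norm_pow]
  exact pow_le_one₀ (norm_nonneg _) (norm_normTrace_le (traceless_isHermitian hH.1) _)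

theorem norm_compZ_sub_one_le (hH : IsSeed H) (k : ℤ) (N : ℕ)
    (hk : |(k : ℝ) * Real.pi / (2 * N)| ≤ 4 / 25) :
    ‖compZ H k N - 1‖ ≤ N * (501 / 1000 * (k * Real.pi / (2 * N)) ^ 2) := by
  rw [compZ_eq]
  refine (norm_pow_sub_one_le (norm_normTrace_le (traceless_isHermitian hH.1) _) N).trans ?_
  gcongr
  exact norm_normTrace_sub_one_le hH _ hk

end Evolution

/-! ### Averages over finite types -/

/-- The uniform average. -/
noncomputable def avg {α E : Type*} [Fintype α] [AddCommGroup E] [Module ℂ E] (f : α → E) : E :=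
  (Fintype.card α : ℂ)⁻¹ • ∑ a, f a

section Avg

variable {α E : Type*} [Fintype α] [AddCommGroup E] [Module ℂ E]

theorem avg_add (f g : α → E) : avg (fun a => f a + g a) = avg f + avg g := by
  simp only [avg, Finset.sum_add_distrib, smul_add]

theorem avg_sub (f g : α → E) : avg (fun a => f a - g a) = avg f - avg g := by
  simp only [avg, Finset.sum_sub_distrib, smul_sub]

theorem avg_smul (c : ℂ) (f : α → E) : avg (fun a => c • f a) = c • avg f := by
  simp only [avg, ← Finset.smul_sum, smul_comm c]

theorem avg_map {F : Type*} [AddCommGroup F] [Module ℂ F] (L : E →ₗ[ℂ] F) (f : α → E) :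
    avg (fun a => L (f a)) = L (avg f) := by
  simp only [avg, map_smul, map_sum]

theorem avg_mul_left {R : Type*} [Ring R] [Algebra ℂ R] (x : R) (f : α → R) :
    avg (fun a => x * f a) = x * avg f :=
  avg_map (LinearMap.mulLeft ℂ x) f

theorem avg_mul_right {R : Type*} [Ring R] [Algebra ℂ R] (x : R) (f : α → R) :
    avg (fun a => f a * x) = avg f * x :=
  avg_map (LinearMap.mulRight ℂ x) f

theorem avg_const [Nonempty α] (x : E) : avg (fun _ : α => x) = x := by
  have : (Fintype.card α : ℂ) ≠ 0 := Nat.cast_ne_zero.2 Fintype.card_ne_zero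
  simp [avg, ← Nat.cast_smul_eq_nsmul ℂ, smul_smul, this]

theorem avg_unitsInt (f : ℤˣ → E) : avg f = (1 / 2 : ℂ) • (f 1 + f (-1)) := by
  rw [avg, UnitsInt.univ, Finset.sum_pair (by decide)]
  norm_num

end Avg

theorem norm_avg_le {α E : Type*} [Fintype α] [Nonempty α] [NormedAddCommGroup E]
    [NormedSpace ℂ E] (f : α → E) (C : ℝ) (h : ∀ a, ‖f a‖ ≤ C) : ‖avg f‖ ≤ C := by
  have hc : (0 : ℝ) < Fintype.card α := Nat.cast_pos.2 Fintype.card_pos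
  rw [avg, norm_smul, norm_inv, Complex.norm_natCast, inv_mul_le_iff₀ hc]
  refine (norm_sum_le_of_le _ fun a _ => h a).trans ?_
  simp

theorem norm_mul_exp_toIcoMod_arg (z : ℂ) :
    (‖z‖ : ℂ) * Complex.exp (Complex.I * (toIcoMod Real.two_pi_pos 0 z.arg : ℝ)) = z := by
  have h : Complex.exp (Complex.I * (toIcoMod Real.two_pi_pos 0 z.arg : ℝ)) =
      Complex.exp (z.arg * Complex.I) := by
    rw [Complex.exp_eq_exp_iff_exists_int]
    refine ⟨-toIcoDiv Real.two_pi_pos 0 z.arg, ?_⟩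
    rw [toIcoMod]
    push_cast
    simp
    ring
  rw [h, Complex.norm_mul_exp_arg_mul_I]

/-! ### Matrices of the circuits -/

/-- `∏_m σ_{v_m} M σ_{v_m}`. -/
noncomputable def conjProd {n N : ℕ} (M : Op n) (v : Fin N → Fin n → Fin 4) : Op n :=
  ((List.ofFn v).map fun a => pauliString a * M * pauliString a).prod

section Circuits

variable {n : ℕ} {H : Op n}

theorem Circuit.matrix_append (U : ℝ → Op n) (C D : Circuit n) :
    Circuit.matrix U (C ++ D) = C.matrix U * D.matrix U := by
  simp [Circuit.matrix]

/-- With control `|0⟩` the Pauli strings are idle and the queries multiply; with control `|1⟩` each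
query is sandwiched between two copies of its string. -/
theorem ladder_matrix (U : ℝ → Op n) (τ : ℝ) {N : ℕ} (v : Fin N → Fin n → Fin 4) :
    (ladder τ v).matrix U = blk (U τ ^ N) 0 0 (conjProd (U τ) v) := by
  have h : ∀ L : List (Fin n → Fin 4),
      Circuit.matrix U (L.flatMap fun a => [Gate.ctrlPauli a, Gate.query τ, Gate.ctrlPauli a]) =
        blk (U τ ^ L.length) 0 0 ((L.map fun a => pauliString a * U τ * pauliString a).prod) := by
    intro L
    induction L with
    | nil => simp [Circuit.matrix, one_eq_blk]
    | cons a L ih =>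
      rw [List.flatMap_cons, Circuit.matrix_append, ih]
      simp only [Circuit.matrix, List.map_cons, List.map_nil, List.prod_cons, List.prod_nil,
        mul_one, query_matrix]
      simp only [Gate.matrix, ctrl_eq_blk, blk_mul]
      simp [pow_succ', mul_assoc]
  rw [ladder, h, List.length_ofFn, conjProd]

/-- The strings are independent, so each factor is twirled separately to its normalized trace. -/
theorem avg_conjProd (τ : ℝ) (N : ℕ) :
    avg (fun v : Fin N → Fin n → Fin 4 => conjProd (evolution H τ) v) =
      (normTrace H τ ^ N) • (1 : Op n) := by
  unfold avg conjProd
  rw [sum_prod_ofFn N (fun a => pauliString a * evolution H τ * pauliString a),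
    sum_pauliString_conj, smul_pow, one_pow, smul_smul]
  congr 1
  have h : (2 ^ n * (evolution H τ).trace : ℂ) = 4 ^ n * normTrace H τ := by
    rw [normTrace, mul_div_assoc', eq_div_iff (pow_ne_zero _ two_ne_zero),
      mul_right_comm, ← mul_pow]
    norm_num
  rw [h, mul_pow]
  simp only [Fintype.card_pi, Fintype.card_fin, Finset.prod_const, Finset.card_univ]
  push_cast
  rw [inv_mul_cancel_left₀]
  exact pow_ne_zero _ (pow_ne_zero _ (by norm_num))

theorem Circuit.inverse_matrix (hH : H.IsHermitian) (C : Circuit n) :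
    C.inverse.matrix (evolution H) = (C.matrix (evolution H))ᴴ := by
  have hg : ∀ g : Gate n, g.inverse.matrix (evolution H) = (g.matrix (evolution H))ᴴ := by
    intro g
    cases g with
    | ctrlPauli v =>
      simp [Gate.inverse, Gate.matrix, ctrl_eq_blk, blk_conjTranspose, pauliString_conjTranspose]
    | query τ =>
      simp only [Gate.inverse, query_matrix, blk_conjTranspose, evolution_conjTranspose hH,
        Matrix.conjTranspose_zero]
    | rotY θ =>
      simp only [Gate.inverse, rotY_matrix, blk_conjTranspose, Matrix.conjTranspose_smul,
        Matrix.conjTranspose_one, Complex.star_def, map_neg, Complex.conj_ofReal]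
      simp
    | rotZ θ =>
      simp only [Gate.inverse, rotZ_matrix, blk_conjTranspose, Matrix.conjTranspose_smul,
        Matrix.conjTranspose_one, Matrix.conjTranspose_zero, Complex.star_def, ← Complex.exp_conj]
      simp
  unfold Circuit.inverse Circuit.matrix
  induction C with
  | nil => simp
  | cons g C ih =>
    simp only [List.map_cons, List.reverse_cons, List.map_append, List.prod_append, List.prod_cons,
      List.map_nil, List.prod_nil, mul_one, Matrix.conjTranspose_mul, ih, hg]

theorem evolution_mem_unitary (hH : H.IsHermitian) (τ : ℝ) :
    evolution H τ ∈ Matrix.unitaryGroup (Q n) ℂ := by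
  rw [Matrix.mem_unitaryGroup_iff', Matrix.star_eq_conjTranspose, evolution_conjTranspose hH,
    evolution_neg_mul]

theorem conjProd_mem_unitary {N : ℕ} {M : Op n} (hM : M ∈ Matrix.unitaryGroup (Q n) ℂ)
    (v : Fin N → Fin n → Fin 4) : conjProd M v ∈ Matrix.unitaryGroup (Q n) ℂ := by
  have hp : ∀ a : Fin n → Fin 4, pauliString a ∈ Matrix.unitaryGroup (Q n) ℂ := fun a => by
    rw [Matrix.mem_unitaryGroup_iff, Matrix.star_eq_conjTranspose, pauliString_conjTranspose,
      pauliString_mul_self]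
  apply Submonoid.list_prod_mem
  intro x hx
  obtain ⟨a, -, rfl⟩ := List.mem_map.1 hx
  exact mul_mem (mul_mem (hp a) hM) (hp a)

/-! ### The compensation identity -/

/-- The phase due to `tr H` depends only on the total time kπ/2 and not on N. Hence it can cancel
against a branch with another number of queries. -/
theorem normTrace_pow_eq (k : ℤ) {N : ℕ} (hN : N ≠ 0) :
    normTrace H (k * Real.pi / (2 * N)) ^ N =
      Complex.exp (-(Complex.I * (k * Real.pi / 2)) * (H.trace / 2 ^ n)) * compZ H k N := by
  have hN' : (N : ℂ) ≠ 0 := Nat.cast_ne_zero.2 hN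
  rw [normTrace_eq_phase, mul_pow, ← Complex.exp_nat_mul, compZ_eq]
  congr 2
  push_cast
  field_simp

theorem evolution_pow_eq (k : ℤ) {N : ℕ} (hN : N ≠ 0) :
    evolution H (k * Real.pi / (2 * N)) ^ N = evolution H (k * Real.pi / 2) := by
  have hN' : (N : ℝ) ≠ 0 := Nat.cast_ne_zero.2 hN
  rw [evolution_pow]
  congr 1
  field_simp

theorem circuitW_matrix (k : ℤ) {N : ℕ} (hN : N ≠ 0) (v : Fin N → Fin n → Fin 4) :
    (circuitW k N v).matrix (evolution H) =
      blk (Complex.exp (-(Complex.I * (k * Real.pi / 4))) • evolution H (k * Real.pi / 2)) 0 0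
        (Complex.exp (Complex.I * (k * Real.pi / 4)) •
          conjProd (evolution H (k * Real.pi / (2 * N))) v) := by
  rw [circuitW, Circuit.matrix_append, ladder_matrix, evolution_pow_eq k hN]
  simp only [Circuit.matrix, List.map_cons, List.map_nil, List.prod_cons, List.prod_nil, mul_one,
    rotZ_matrix, blk_mul]
  push_cast
  simp

theorem targetBlock_eq (hH : H.IsHermitian) (k : ℤ) (φ : ℝ) : ∃ T : Op n,
    T = Complex.exp (Complex.I * φ) • Complex.exp (Complex.I * (k * Real.pi / 2)) •
      evolution (traceless H) (-(k * Real.pi / 2)) ∧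
    targetBlock H k φ = blk 0 T Tᴴ 0 := by
  refine ⟨_, rfl, ?_⟩
  have h : ∀ a : ℂ, NormedSpace.exp (a • (traceless H + 1)) =
      Complex.exp a • NormedSpace.exp (a • traceless H) := fun a => by
    have := exp_smul_add_smul_one a 1 (traceless H)
    rwa [one_smul, mul_one] at this
  have h1 : ∀ x : ℝ, NormedSpace.exp ((-(Complex.I * x)) • traceless H) =
    evolution (traceless H) x := fun x => rfl
  have h2 : (k * Real.pi / 2 : ℂ) = ((k * Real.pi / 2 : ℝ) : ℂ) := by push_cast; ring
  have h3 : Complex.I * ((k * Real.pi / 2 : ℝ) : ℂ) =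
    -(Complex.I * ((-(k * Real.pi / 2) : ℝ) : ℂ)) := by push_cast; ring
  rw [targetBlock, h, h, h2, h1, h3, h1, ← h3]
  simp only [kronecker_eq_blk, blk_add, Matrix.conjTranspose_smul, Complex.star_def,
    ← Complex.exp_conj, evolution_conjTranspose (traceless_isHermitian hH)]
  simp [Complex.conj_ofNat]

theorem compTheta_identity (H : Op n) (k : ℤ) (N : ℕ) :
    (compA H k N : ℂ) * Complex.exp (Complex.I * compTheta H k N) = compZ H k N :=
  norm_mul_exp_toIcoMod_arg _

/-- Conjugating an off-diagonal observable by the block diagonal circuit leaves the twirled branch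
linearly in one corner and its adjoint in the other, so averaging replaces it by a scalar. The
rotation of the control supplies the summand I in H₀ + I. -/
theorem isCompensation (hH : H.IsHermitian) (k : ℤ) {N : ℕ} (hN : N ≠ 0)
    (hz : compZ H k N ≠ 0) : IsCompensation H k N (compA H k N) (compTheta H k N) := by
  have hmod := toIcoMod_mem_Ico Real.two_pi_pos 0 (compZ H k N).arg
  rw [zero_add] at hmod
  refine ⟨norm_pos_iff.2 hz, hmod.1, hmod.2, fun φ => ?_⟩
  obtain ⟨T, hT, hTb⟩ := targetBlock_eq hH k φ
  have hX : ((Real.cos φ : ℂ) • pauliX - (Real.sin φ : ℂ) • pauliY) ⊗ₖ (1 : Op n) =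
      blk 0 (Complex.exp (Complex.I * φ) • 1) (Complex.exp (-(Complex.I * φ)) • 1) 0 := by
    have h1 : Complex.exp (Complex.I * φ) = Real.cos φ + Real.sin φ * Complex.I := by
      rw [mul_comm, Complex.exp_mul_I, Complex.ofReal_cos, Complex.ofReal_sin]
    have h2 : Complex.exp (-(Complex.I * φ)) = Real.cos φ - Real.sin φ * Complex.I := by
      rw [← mul_neg, mul_comm, Complex.exp_mul_I, Complex.cos_neg, Complex.sin_neg,
        Complex.ofReal_cos, Complex.ofReal_sin]
      ring
    rw [kronecker_eq_blk, h1, h2]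
    simp [pauliX, pauliY, sub_eq_add_neg]
  obtain ⟨a, ha⟩ : ∃ a : Op n, a =
      Complex.exp (-(Complex.I * (k * Real.pi / 4))) • evolution H (k * Real.pi / 2) := ⟨_, rfl⟩
  have hsum : ∀ v : Fin N → Fin n → Fin 4, ((circuitW k N v).matrix (evolution H))ᴴ *
      (((Real.cos φ : ℂ) • pauliX - (Real.sin φ : ℂ) • pauliY) ⊗ₖ (1 : Op n)) *
      (circuitW k N v).matrix (evolution H) =
      blk 0 (Complex.exp (Complex.I * φ) • (aᴴ * (Complex.exp (Complex.I * (k * Real.pi / 4)) •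
          conjProd (evolution H (k * Real.pi / (2 * N))) v)))
        (Complex.exp (Complex.I * φ) • (aᴴ * (Complex.exp (Complex.I * (k * Real.pi / 4)) •
          conjProd (evolution H (k * Real.pi / (2 * N))) v)))ᴴ 0 := by
    intro v
    rw [circuitW_matrix k hN, hX, blk_conjTranspose, blk_mul, blk_mul, ← ha]
    have h3 : star (Complex.exp (Complex.I * φ)) = Complex.exp (-(Complex.I * φ)) := by
      rw [Complex.star_def, ← Complex.exp_conj]
      simp
    simp [Matrix.conjTranspose_mul, h3, smul_smul, mul_comm]
  have hcard : (1 / 4 : ℂ) ^ (n * N) = (Fintype.card (Fin N → Fin n → Fin 4) : ℂ)⁻¹ := by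
    simp [pow_mul]
  have hB : avg (fun v : Fin N → Fin n → Fin 4 => Complex.exp (Complex.I * φ) • (aᴴ *
      (Complex.exp (Complex.I * (k * Real.pi / 4)) •
        conjProd (evolution H (k * Real.pi / (2 * N))) v))) = compZ H k N • T := by
    rw [avg_smul, avg_mul_left, avg_smul, avg_conjProd, normTrace_pow_eq k hN, hT, ha,
      Matrix.conjTranspose_smul, evolution_conjTranspose hH, evolution_eq_phase,
      Complex.star_def, ← Complex.exp_conj]
    simp only [Matrix.mul_smul, mul_one, smul_smul]
    congr 1
    have hexp : ∀ x y z w v : ℂ, x * (y * (z * compZ H k N) * (w * v)) =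
        compZ H k N * (x * (y * z * w * v)) := fun x y z w v => by ring
    rw [hexp]
    -- The phases due to `tr H` from the evolution and from the trace are inverse to each other; the
    -- two factors e^{ikπ/4} combine to e^{ikπ/2}.
    simp only [← Complex.exp_add]
    congr 2
    simp only [map_neg, map_mul, map_div₀, Complex.conj_I, Complex.conj_ofReal, map_intCast,
      Complex.conj_ofNat]
    push_cast
    ring_nf
  simp only [hsum]
  rw [sum_blk, smul_blk, hcard, hTb, rotZ_matrix, rotZ_matrix, blk_mul, blk_mul, smul_blk]
  have hA := compTheta_identity H k N
  have e1 : Complex.I * ((compTheta H k N / 2 : ℝ) : ℂ) +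
      Complex.I * ((compTheta H k N / 2 : ℝ) : ℂ) = Complex.I * compTheta H k N := by
    push_cast; ring
  have hUR : (compZ H k N) • T = (compA H k N : ℂ) • Complex.exp (Complex.I * compTheta H k N) • T := by
    rw [smul_smul, hA]
  have hstar : star (Complex.exp (Complex.I * compTheta H k N)) =
      Complex.exp (-(Complex.I * compTheta H k N)) := by
    rw [Complex.star_def, ← Complex.exp_conj]
    simp
  have hLL : (Fintype.card (Fin N → Fin n → Fin 4) : ℂ)⁻¹ • ∑ v : Fin N → Fin n → Fin 4,
      (Complex.exp (Complex.I * φ) • (aᴴ * (Complex.exp (Complex.I * (k * Real.pi / 4)) •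
          conjProd (evolution H (k * Real.pi / (2 * N))) v)))ᴴ = (compZ H k N • T)ᴴ := by
    rw [← hB, avg, Matrix.conjTranspose_smul, Matrix.conjTranspose_sum]
    simp
  rw [hLL]
  unfold avg at hB
  rw [hB, hUR, Matrix.conjTranspose_smul, Matrix.conjTranspose_smul, hstar]
  congr 1
  · simp
  · simp only [Complex.ofReal_neg, mul_neg, neg_neg, zero_mul, mul_zero, add_zero, zero_add,
      Matrix.smul_mul, Matrix.mul_smul, one_mul, mul_one, smul_smul, ← Complex.exp_add, e1]
  · simp only [Complex.ofReal_neg, mul_neg, zero_mul, mul_zero, add_zero, zero_add,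
      Matrix.smul_mul, Matrix.mul_smul, one_mul, mul_one, smul_smul, ← Complex.exp_add, ← neg_add,
      e1, Complex.star_def, Complex.conj_ofReal]
  · simp

end Circuits

/-! ### One step of the random state generation -/

/-- The anti-Hermitian operator with blocks `0, -Gᴴ, G, 0`. -/
def skew {n : ℕ} (G : Op n) : COp n := blk 0 (-Gᴴ) G 0

/-- The operator `(cos α Z + sin α X) ⊗ I`. -/
noncomputable def rot {n : ℕ} (α : ℝ) : COp n :=
  blk ((Real.cos α : ℂ) • 1) ((Real.sin α : ℂ) • 1) ((Real.sin α : ℂ) • 1)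
    (-(Real.cos α : ℂ) • 1)

/-- The unitary `e^{isΦ} ∏ σ_w e^{-iHτ_w} σ_w ∏ σ_u e^{-iHτ_u} σ_u`. -/
noncomputable def relUnitary {n : ℕ} (H : Op n) (l M : ℕ) (Φ : ℝ)
    (u : Fin (10 * l ^ 2) → Fin n → Fin 4) (w : Fin (l ^ 2 * M) → Fin n → Fin 4) (s : ℤˣ) : Op n :=
  Complex.exp (Complex.I * (((s : ℤ) : ℝ) * Φ)) •
    (conjProd (evolution H (-(((s : ℤ) : ℝ) * Real.pi / (2 * l * M)))) w *
      conjProd (evolution H (((s : ℤ) : ℝ) * Real.pi / (20 * l))) u)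

section Step

variable {n : ℕ} {H : Op n}

theorem smul_exp_mem_unitary (x : ℝ) {V : Op n} (hV : V ∈ Matrix.unitaryGroup (Q n) ℂ) :
    Complex.exp (Complex.I * x) • V ∈ Matrix.unitaryGroup (Q n) ℂ := by
  rw [Matrix.mem_unitaryGroup_iff, Matrix.star_eq_conjTranspose] at hV ⊢
  rw [Matrix.conjTranspose_smul, smul_mul_smul_comm, hV, Complex.star_def, ← Complex.exp_conj,
    ← Complex.exp_add]
  simp

theorem relUnitary_mem_unitary (hH : H.IsHermitian) (l M : ℕ) (Φ : ℝ)
    (u : Fin (10 * l ^ 2) → Fin n → Fin 4) (w : Fin (l ^ 2 * M) → Fin n → Fin 4) (s : ℤˣ) :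
    relUnitary H l M Φ u w s ∈ Matrix.unitaryGroup (Q n) ℂ := by
  rw [relUnitary, ← Complex.ofReal_mul]
  exact smul_exp_mem_unitary _ (mul_mem (conjProd_mem_unitary (evolution_mem_unitary hH _) w)
    (conjProd_mem_unitary (evolution_mem_unitary hH _) u))

theorem circuitWTilde_matrix {l M : ℕ} (hl : l ≠ 0) (hM : M ≠ 0) (Φ : ℝ)
    (u : Fin (10 * l ^ 2) → Fin n → Fin 4) (w : Fin (l ^ 2 * M) → Fin n → Fin 4) (s : ℤˣ) :
    (circuitWTilde l M Φ u w s).matrix (evolution H) =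
      blk (Complex.exp (-(Complex.I * (((s : ℤ) : ℝ) * Φ / 2 : ℝ))) • 1) 0 0
        (Complex.exp (Complex.I * (((s : ℤ) : ℝ) * Φ / 2 : ℝ)) •
          (conjProd (evolution H (-(((s : ℤ) : ℝ) * Real.pi / (2 * l * M)))) w *
            conjProd (evolution H (((s : ℤ) : ℝ) * Real.pi / (20 * l))) u)) := by
  have hl' : (l : ℝ) ≠ 0 := Nat.cast_ne_zero.2 hl
  have hM' : (M : ℝ) ≠ 0 := Nat.cast_ne_zero.2 hM
  -- The two ladders have total times -slπ/2 and slπ/2, so the `|0⟩` branch carries no evolution.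
  have h : evolution H (-(((s : ℤ) : ℝ) * Real.pi / (2 * l * M))) ^ (l ^ 2 * M) *
      evolution H (((s : ℤ) : ℝ) * Real.pi / (20 * l)) ^ (10 * l ^ 2) = 1 := by
    rw [evolution_pow, evolution_pow, ← evolution_add, ← evolution_zero (H := H)]
    congr 1
    push_cast
    field_simp
    ring
  rw [circuitWTilde, Circuit.matrix_append, Circuit.matrix_append, ladder_matrix, ladder_matrix]
  have h1 : Circuit.matrix (evolution H) [Gate.rotZ (((s : ℤ) : ℝ) * Φ / 2)] =
      (Gate.rotZ (((s : ℤ) : ℝ) * Φ / 2)).matrix (evolution H) := by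
    simp [Circuit.matrix]
  rw [h1, rotZ_matrix, mul_assoc, blk_mul, blk_mul, h]
  simp

/-- The `Y` rotation is a multiple of the identity plus an off-diagonal part. Conjugation by a block
diagonal unitary fixes the former and inserts the relative unitary of the two branches into the
latter. -/
theorem stepCircuit_matrix (hH : H.IsHermitian) {l M : ℕ} (hl : l ≠ 0) (hM : M ≠ 0) (γ Φ : ℝ)
    (u : Fin (10 * l ^ 2) → Fin n → Fin 4) (w : Fin (l ^ 2 * M) → Fin n → Fin 4) (s : ℤˣ) :
    (stepCircuit l M γ Φ u w s).matrix (evolution H) =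
      (Real.cos γ : ℂ) • 1 + (Real.sin γ : ℂ) • skew (relUnitary H l M Φ u w s) := by
  have hP := mul_mem (conjProd_mem_unitary (evolution_mem_unitary hH
      (-(((s : ℤ) : ℝ) * Real.pi / (2 * l * M)))) w)
    (conjProd_mem_unitary (evolution_mem_unitary hH (((s : ℤ) : ℝ) * Real.pi / (20 * l))) u)
  rw [Matrix.mem_unitaryGroup_iff, Matrix.star_eq_conjTranspose] at hP
  have h1 : Circuit.matrix (evolution H) [Gate.rotY γ] =
      (Gate.rotY γ).matrix (evolution H) := by
    simp [Circuit.matrix]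
  rw [stepCircuit, Circuit.matrix_append, Circuit.matrix_append, Circuit.inverse_matrix hH, h1,
    rotY_matrix, circuitWTilde_matrix hl hM, relUnitary]
  generalize conjProd (evolution H (-(((s : ℤ) : ℝ) * Real.pi / (2 * l * M)))) w *
    conjProd (evolution H (((s : ℤ) : ℝ) * Real.pi / (20 * l))) u = P at hP ⊢
  have e1 : Complex.exp (Complex.I * (((s : ℤ) : ℝ) * Φ)) =
      Complex.exp (Complex.I * (((s : ℤ) : ℝ) * Φ / 2 : ℝ)) *
        Complex.exp (Complex.I * (((s : ℤ) : ℝ) * Φ / 2 : ℝ)) := by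
    rw [← Complex.exp_add]
    congr 1
    push_cast
    ring
  rw [e1]
  have e2 : star (Complex.exp (Complex.I * (((s : ℤ) : ℝ) * Φ / 2 : ℝ))) =
      Complex.exp (-(Complex.I * (((s : ℤ) : ℝ) * Φ / 2 : ℝ))) := by
    rw [Complex.star_def, ← Complex.exp_conj, map_mul, Complex.conj_I, Complex.conj_ofReal, neg_mul]
  have e3 : star (Complex.exp (-(Complex.I * (((s : ℤ) : ℝ) * Φ / 2 : ℝ)))) =
      Complex.exp (Complex.I * (((s : ℤ) : ℝ) * Φ / 2 : ℝ)) := by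
    rw [← e2, star_star]
  have e4 : Complex.exp (Complex.I * (((s : ℤ) : ℝ) * Φ / 2 : ℝ)) *
      Complex.exp (-(Complex.I * (((s : ℤ) : ℝ) * Φ / 2 : ℝ))) = 1 := by
    rw [← Complex.exp_add, add_neg_cancel, Complex.exp_zero]
  generalize Complex.exp (Complex.I * (((s : ℤ) : ℝ) * Φ / 2 : ℝ)) = p at *
  generalize Complex.exp (-(Complex.I * (((s : ℤ) : ℝ) * Φ / 2 : ℝ))) = q at *
  rw [skew, one_eq_blk, smul_blk, smul_blk, blk_add, blk_conjTranspose, blk_mul, blk_mul]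
  congr 1
  · simp only [Matrix.conjTranspose_smul, e3, smul_smul, Matrix.mul_smul, mul_one,
      zero_mul, mul_zero, add_zero, smul_zero, Matrix.conjTranspose_one, Matrix.conjTranspose_zero]
    congr 1
    linear_combination (Real.cos γ : ℂ) * e4
  · simp only [Matrix.conjTranspose_smul, e2, smul_smul, star_mul', Matrix.smul_mul,
      Matrix.mul_smul, mul_one, one_mul, zero_mul, mul_zero, add_zero, zero_add, smul_zero,
      smul_neg, neg_smul, Matrix.conjTranspose_zero, neg_mul, mul_neg]
    congr 2
    ring
  · simp only [Matrix.conjTranspose_smul, e3, smul_smul, Matrix.mul_smul, mul_one, zero_mul,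
      mul_zero, add_zero, zero_add, smul_zero, Matrix.conjTranspose_one, Matrix.conjTranspose_zero]
    congr 1
    ring
  · simp only [Matrix.conjTranspose_smul, e2, smul_smul, Matrix.smul_mul,
      Matrix.mul_smul, mul_one, zero_mul, mul_zero, add_zero, zero_add, smul_zero,
      Matrix.conjTranspose_zero, hP]
    congr 1
    linear_combination (Real.cos γ : ℂ) * e4

/-! ### Averages of the generator -/

theorem avg_skew {α : Type*} [Fintype α] (f : α → Op n) :
    avg (fun a => skew (f a)) = skew (avg f) := by
  have h : star ((Fintype.card α : ℂ)⁻¹) = (Fintype.card α : ℂ)⁻¹ := by simp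
  simp only [skew, avg]
  rw [sum_blk, smul_blk, Matrix.conjTranspose_smul, Matrix.conjTranspose_sum, h,
    Finset.sum_neg_distrib, smul_neg]
  simp

/-- The coefficient of `Y` in the averaged generator. -/
noncomputable def genCoeff (H : Op n) (l M : ℕ) (Φ : ℝ) : ℝ :=
  (Complex.exp (Complex.I * Φ) * (compZ H l (10 * l ^ 2) * compZ H (-l) (l ^ 2 * M))).re

theorem compZ_neg (hH : H.IsHermitian) (k : ℤ) (N : ℕ) :
    compZ H (-k) N = (starRingEnd ℂ) (compZ H k N) := by
  rw [compZ_eq, compZ_eq, map_pow, ← normTrace_neg (traceless_isHermitian hH)]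
  congr 2
  push_cast
  ring

/-- The ladders run for opposite total times, so their `tr H` phases cancel and only traces of
evolutions under `H₀` remain. -/
theorem avg_relUnitary_of_sign {l M : ℕ} (hl : l ≠ 0) (hM : M ≠ 0) (Φ : ℝ)
    (s : ℤˣ) : (avg fun u => avg fun w => relUnitary H l M Φ u w s) =
      (Complex.exp (Complex.I * (((s : ℤ) : ℝ) * Φ)) *
        (compZ H ((s : ℤ) * l) (10 * l ^ 2) * compZ H (-((s : ℤ) * l)) (l ^ 2 * M))) •
        (1 : Op n) := by
  have hl' : (l : ℝ) ≠ 0 := Nat.cast_ne_zero.2 hl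
  have hM' : (M : ℝ) ≠ 0 := Nat.cast_ne_zero.2 hM
  have t1 : ((s : ℤ) : ℝ) * Real.pi / (20 * l) =
      (((s : ℤ) * l : ℤ) : ℝ) * Real.pi / (2 * ((10 * l ^ 2 : ℕ) : ℝ)) := by
    push_cast
    field_simp
    ring
  have t2 : -(((s : ℤ) : ℝ) * Real.pi / (2 * l * M)) =
      ((-((s : ℤ) * l) : ℤ) : ℝ) * Real.pi / (2 * ((l ^ 2 * M : ℕ) : ℝ)) := by
    push_cast
    field_simp
  have hz := normTrace_pow_eq (H := H) ((s : ℤ) * l) (N := 10 * l ^ 2) (by positivity)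
  have hζ := normTrace_pow_eq (H := H) (-((s : ℤ) * l)) (N := l ^ 2 * M) (by positivity)
  rw [← t1] at hz
  rw [← t2] at hζ
  unfold relUnitary
  simp only [avg_smul, avg_mul_left, avg_mul_right, avg_conjProd]
  rw [hz, hζ, Matrix.smul_mul, one_mul, smul_smul, smul_smul]
  congr 1
  have hexp : ∀ e x y z w : ℂ, x * z = 1 → e * (x * y) * (z * w) = e * (w * y) :=
    fun e x y z w h => by linear_combination (e * y * w) * h
  refine hexp _ _ _ _ _ ?_
  rw [← Complex.exp_add, ← Complex.exp_zero]
  congr 1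
  push_cast
  ring

/-- Flipping the sign conjugates the scalar, so the average over s keeps its real part. A complex
scalar would tilt the rotation axis away from Y. -/
theorem avg_relUnitary (hH : H.IsHermitian) {l M : ℕ} (hl : l ≠ 0) (hM : M ≠ 0) (Φ : ℝ) :
    (avg fun u => avg fun w => avg fun s => relUnitary H l M Φ u w s) =
      (genCoeff H l M Φ : ℂ) • (1 : Op n) := by
  simp only [avg_unitsInt, avg_smul, avg_add]
  rw [avg_relUnitary_of_sign hl hM, avg_relUnitary_of_sign hl hM, ← add_smul, smul_smul]
  congr 1
  rw [genCoeff, Complex.re_eq_add_conj]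
  simp only [map_mul, ← compZ_neg hH, ← Complex.exp_conj, Complex.conj_I, Complex.conj_ofReal]
  simp
  ring

end Step

/-! ### The Heisenberg picture of one random step -/

/-- Adjoint of the random step, acting on observables. -/
noncomputable def heis {n : ℕ} (H : Op n) (l M : ℕ) (γ Φ : ℝ) : COp n →ₗ[ℂ] COp n where
  toFun O := avg fun u => avg fun w => avg fun s =>
    ((stepCircuit l M γ Φ u w s).matrix (evolution H))ᴴ * O *
      (stepCircuit l M γ Φ u w s).matrix (evolution H)
  map_add' A B := by simp only [mul_add, add_mul, avg_add]
  map_smul' c A := by simp only [Matrix.mul_smul, Matrix.smul_mul, avg_smul, RingHom.id_apply]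

section Heis

open scoped Matrix.Norms.L2Operator

variable {n : ℕ} {H : Op n}

theorem heis_apply (l M : ℕ) (γ Φ : ℝ) (O : COp n) : heis H l M γ Φ O =
    avg fun u => avg fun w => avg fun s =>
      ((stepCircuit l M γ Φ u w s).matrix (evolution H))ᴴ * O *
        (stepCircuit l M γ Φ u w s).matrix (evolution H) := rfl

theorem skew_conjTranspose (G : Op n) : (skew G)ᴴ = -skew G := by
  have : -skew G = (-1 : ℂ) • skew G := by simp
  rw [this, skew, blk_conjTranspose, smul_blk]
  simp

theorem skew_mul_self {G : Op n} (hG : G ∈ Matrix.unitaryGroup (Q n) ℂ) :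
    skew G * skew G = -1 := by
  have h1 := Matrix.mem_unitaryGroup_iff.1 hG
  have h2 := Matrix.mem_unitaryGroup_iff'.1 hG
  rw [Matrix.star_eq_conjTranspose] at h1 h2
  have : (-1 : COp n) = (-1 : ℂ) • 1 := by simp
  rw [this, one_eq_blk, smul_blk, skew, blk_mul]
  simp [h1, h2]

theorem skew_mem_unitary {G : Op n} (hG : G ∈ Matrix.unitaryGroup (Q n) ℂ) :
    skew G ∈ unitary (COp n) := by
  rw [Unitary.mem_iff, Matrix.star_eq_conjTranspose, skew_conjTranspose]
  simp [skew_mul_self hG]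

theorem rot_mem_unitary (α : ℝ) : (rot α : COp n) ∈ unitary (COp n) := by
  have h1 : (rot α : COp n)ᴴ = rot α := by
    rw [rot, blk_conjTranspose]
    simp only [Matrix.conjTranspose_smul, Matrix.conjTranspose_one, star_neg, Complex.star_def,
      Complex.conj_ofReal]
  have h2 : (rot α : COp n) * rot α = 1 := by
    rw [rot, blk_mul, one_eq_blk]
    have h : (Real.cos α : ℂ) * Real.cos α + Real.sin α * Real.sin α = 1 := by
      rw [← Complex.ofReal_mul, ← Complex.ofReal_mul, ← Complex.ofReal_add, ← sq, ← sq,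
        Real.cos_sq_add_sin_sq, Complex.ofReal_one]
    congr 1
    · simp only [Matrix.smul_mul, one_mul, smul_smul, ← add_smul, h, one_smul]
    · simp [smul_smul, mul_comm]
    · simp [smul_smul, mul_comm]
    · simp only [Matrix.smul_mul, one_mul, smul_smul, ← add_smul, neg_mul_neg]
      rw [add_comm, h, one_smul]
  rw [Unitary.mem_iff, Matrix.star_eq_conjTranspose, h1]
  exact ⟨h2, h2⟩

theorem norm_rot_le (α : ℝ) : ‖(rot α : COp n)‖ ≤ 1 :=
  (CStarRing.norm_of_mem_unitary (rot_mem_unitary α)).le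

theorem stepCircuit_mem_unitary (hH : H.IsHermitian) {l M : ℕ} (hl : l ≠ 0) (hM : M ≠ 0)
    (γ Φ : ℝ) (u : Fin (10 * l ^ 2) → Fin n → Fin 4) (w : Fin (l ^ 2 * M) → Fin n → Fin 4)
    (s : ℤˣ) : (stepCircuit l M γ Φ u w s).matrix (evolution H) ∈ unitary (COp n) := by
  have hG := skew_mul_self (relUnitary_mem_unitary hH l M Φ u w s)
  have h : (Real.cos γ : ℂ) * Real.cos γ + Real.sin γ * Real.sin γ = 1 := by
    rw [← Complex.ofReal_mul, ← Complex.ofReal_mul, ← Complex.ofReal_add, ← sq, ← sq,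
      Real.cos_sq_add_sin_sq, Complex.ofReal_one]
  rw [Unitary.mem_iff, Matrix.star_eq_conjTranspose, stepCircuit_matrix hH hl hM,
    Matrix.conjTranspose_add, Matrix.conjTranspose_smul, Matrix.conjTranspose_smul,
    skew_conjTranspose, Matrix.conjTranspose_one, Complex.star_def,
    Complex.conj_ofReal, Complex.conj_ofReal]
  generalize skew (relUnitary H l M Φ u w s) = K at hG ⊢
  have hres : ((Real.cos γ : ℂ) * Real.cos γ + Real.sin γ * Real.sin γ) • (1 : COp n) = 1 := by
    rw [h, one_smul]
  rw [add_smul] at hres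
  constructor
  · simp only [add_mul, mul_add, Matrix.smul_mul, Matrix.mul_smul, one_mul, mul_one, smul_smul,
      neg_mul, smul_neg, hG, neg_neg]
    rw [mul_comm (Real.sin γ : ℂ) (Real.cos γ)]
    refine Eq.trans ?_ hres
    abel
  · simp only [add_mul, mul_add, Matrix.smul_mul, Matrix.mul_smul, one_mul, mul_one, smul_smul,
      mul_neg, smul_neg, hG]
    rw [mul_comm (Real.sin γ : ℂ) (Real.cos γ)]
    refine Eq.trans ?_ hres
    abel

/-- Each term is a conjugation by a unitary, hence an isometry; their average is a contraction, so
errors are not amplified by later steps. -/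
theorem norm_heis_le (hH : H.IsHermitian) {l M : ℕ} (hl : l ≠ 0) (hM : M ≠ 0)
    (γ Φ : ℝ) (O : COp n) : ‖heis H l M γ Φ O‖ ≤ ‖O‖ := by
  rw [heis_apply]
  refine norm_avg_le _ _ fun u => norm_avg_le _ _ fun w => norm_avg_le _ _ fun s => ?_
  have hS := stepCircuit_mem_unitary hH hl hM γ Φ u w s
  rw [CStarRing.norm_mul_mem_unitary _ hS, ← Matrix.star_eq_conjTranspose,
    CStarRing.norm_mem_unitary_mul _ (Unitary.star_mem hS)]

theorem heis_one (hH : H.IsHermitian) {l M : ℕ} (hl : l ≠ 0) (hM : M ≠ 0) (γ Φ : ℝ) :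
    heis H l M γ Φ 1 = 1 := by
  have h : ∀ u w s, ((stepCircuit l M γ Φ u w s).matrix (evolution H))ᴴ * 1 *
      (stepCircuit l M γ Φ u w s).matrix (evolution H) = 1 := fun u w s => by
    rw [mul_one, ← Matrix.star_eq_conjTranspose]
    exact (Unitary.mem_iff.1 (stepCircuit_mem_unitary hH hl hM γ Φ u w s)).1
  rw [heis_apply]
  simp only [h, avg_const]

theorem rot_commutator (α : ℝ) : (rot α : COp n) * skew 1 - skew 1 * rot α =
    (2 : ℂ) • rot (α - Real.pi / 2) := by
  rw [rot, rot, skew, blk_mul, blk_mul, blk_sub, smul_blk, Real.cos_sub_pi_div_two,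
    Real.sin_sub_pi_div_two]
  congr 1 <;> simp [two_smul, sub_eq_add_neg]

theorem rot_sub (α β : ℝ) : (rot (α - β) : COp n) =
    (Real.cos β : ℂ) • rot α + (Real.sin β : ℂ) • rot (α - Real.pi / 2) := by
  unfold rot
  rw [Real.cos_sub_pi_div_two, Real.sin_sub_pi_div_two, Real.cos_sub, Real.sin_sub]
  simp only [smul_blk, blk_add, smul_smul, ← add_smul]
  push_cast
  congr 2 <;> ring

/-- With S = cos γ + sin γ K, the observable O becomes cos²γ O + sin γ cos γ [O, K] - sin²γ K O K.
The commutator averages to 2r times the observable at angle α - π/2, which matches the rotation by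
2γr to first order. The error 4γ² splits as 2γ² for the cosine coefficient, γ² for the sine
coefficient and γ² for the last term. -/
theorem norm_heis_rot_sub_le (hH : H.IsHermitian) {l M : ℕ} (hl : l ≠ 0) (hM : M ≠ 0)
    (γ Φ : ℝ) (hγ : |γ| ≤ 1 / 4) (hr : |genCoeff H l M Φ| ≤ 1) (α : ℝ) :
    ‖heis H l M γ Φ (rot α) - rot (α - 2 * γ * genCoeff H l M Φ)‖ ≤ 4 * γ ^ 2 := by
  set r := genCoeff H l M Φ with hr_def
  set Qd : COp n := avg fun u => avg fun w => avg fun s =>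
    skew (relUnitary H l M Φ u w s) * rot α * skew (relUnitary H l M Φ u w s) with hQ
  have hQn : ‖Qd‖ ≤ 1 := by
    refine norm_avg_le _ _ fun u => norm_avg_le _ _ fun w => norm_avg_le _ _ fun s => ?_
    have hS := skew_mem_unitary (relUnitary_mem_unitary hH l M Φ u w s)
    rw [CStarRing.norm_mul_mem_unitary _ hS, CStarRing.norm_mem_unitary_mul _ hS]
    exact norm_rot_le α
  have hskew : (avg fun u => avg fun w => avg fun s => skew (relUnitary H l M Φ u w s)) =
      (r : ℂ) • (skew 1 : COp n) := by
    simp only [avg_skew]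
    rw [avg_relUnitary hH hl hM, skew, skew, smul_blk]
    simp [← hr_def]
  have hexpand : heis H l M γ Φ (rot α) = (Real.cos γ ^ 2 : ℂ) • rot α +
      ((2 * Real.sin γ * Real.cos γ * r : ℂ)) • rot (α - Real.pi / 2) -
      (Real.sin γ ^ 2 : ℂ) • Qd := by
    have hS : ∀ u w s, ((stepCircuit l M γ Φ u w s).matrix (evolution H))ᴴ * rot α *
        (stepCircuit l M γ Φ u w s).matrix (evolution H) =
        ((Real.cos γ ^ 2 : ℂ) • rot α + (Real.cos γ * Real.sin γ : ℂ) •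
          (rot α * skew (relUnitary H l M Φ u w s) - skew (relUnitary H l M Φ u w s) * rot α)) -
        (Real.sin γ ^ 2 : ℂ) •
          (skew (relUnitary H l M Φ u w s) * rot α * skew (relUnitary H l M Φ u w s)) := by
      intro u w s
      rw [stepCircuit_matrix hH hl hM, Matrix.conjTranspose_add, Matrix.conjTranspose_smul,
        Matrix.conjTranspose_smul, skew_conjTranspose, Matrix.conjTranspose_one, Complex.star_def,
        Complex.conj_ofReal, Complex.conj_ofReal]
      generalize skew (relUnitary H l M Φ u w s) = K
      simp only [add_mul, mul_add, Matrix.smul_mul, Matrix.mul_smul, one_mul, mul_one, smul_smul,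
        neg_mul, smul_neg, smul_sub, sq]
      rw [mul_comm (Real.sin γ : ℂ) (Real.cos γ)]
      abel
    rw [heis_apply]
    simp only [hS, avg_sub, avg_add, avg_smul, avg_const, avg_mul_left, avg_mul_right, hskew]
    rw [← hQ, Matrix.mul_smul, Matrix.smul_mul, ← smul_sub, rot_commutator, smul_smul, smul_smul]
    congr 3
    ring
  rw [hexpand, rot_sub α (2 * γ * r)]
  have hdiff : (Real.cos γ ^ 2 : ℂ) • rot α +
      ((2 * Real.sin γ * Real.cos γ * r : ℂ)) • rot (α - Real.pi / 2) -
      (Real.sin γ ^ 2 : ℂ) • Qd - ((Real.cos (2 * γ * r) : ℂ) • rot α +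
        (Real.sin (2 * γ * r) : ℂ) • rot (α - Real.pi / 2)) =
      ((Real.cos γ ^ 2 - Real.cos (2 * γ * r) : ℝ) : ℂ) • rot α +
      ((2 * Real.sin γ * Real.cos γ * r - Real.sin (2 * γ * r) : ℝ) : ℂ) •
        rot (α - Real.pi / 2) - ((Real.sin γ ^ 2 : ℝ) : ℂ) • Qd := by
    push_cast
    module
  rw [hdiff]
  have hs2 : Real.sin γ ^ 2 ≤ γ ^ 2 := sq_le_sq.2 Real.abs_sin_le_abs
  have hr2 : r ^ 2 ≤ 1 := by
    rw [← sq_abs]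
    exact pow_le_one₀ (abs_nonneg _) hr
  have hγ2 : 0 ≤ γ ^ 2 := sq_nonneg γ
  have hc1 : |Real.cos γ ^ 2 - Real.cos (2 * γ * r)| ≤ 2 * γ ^ 2 := by
    have e1 : Real.cos (2 * γ * r) = 1 - 2 * Real.sin (γ * r) ^ 2 := by
      rw [mul_assoc, Real.cos_two_mul, Real.cos_sq']
      ring
    have e2 : Real.sin (γ * r) ^ 2 ≤ γ ^ 2 := by
      refine (sq_le_sq.2 Real.abs_sin_le_abs).trans ?_
      rw [mul_pow]
      nlinarith
    rw [e1, Real.cos_sq', abs_le]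
    constructor <;> nlinarith [sq_nonneg (Real.sin (γ * r)), sq_nonneg (Real.sin γ)]
  have hc2 : |2 * Real.sin γ * Real.cos γ * r - Real.sin (2 * γ * r)| ≤ γ ^ 2 := by
    have e1 := Real.abs_sub_sin_le (2 * γ)
    have e2 := Real.abs_sub_sin_le (2 * γ * r)
    have e3 : 2 * Real.sin γ * Real.cos γ * r - Real.sin (2 * γ * r) =
        -((2 * γ - Real.sin (2 * γ)) * r) + (2 * γ * r - Real.sin (2 * γ * r)) := by
      rw [Real.sin_two_mul]
      ring
    -- The bound |γ| ≤ 1/4 trades the cubic Taylor remainder for a quadratic one.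
    have e4 : |2 * γ| ^ 3 / 6 ≤ γ ^ 2 / 2 := by
      rw [abs_mul, abs_two, ← sq_abs γ]
      nlinarith [sq_nonneg |γ|, abs_nonneg γ, mul_nonneg (sq_nonneg |γ|) (sub_nonneg.2 hγ)]
    have e5 : |2 * γ * r| ≤ |2 * γ| := by
      rw [abs_mul (2 * γ)]
      exact mul_le_of_le_one_right (abs_nonneg _) hr
    have e6 : |2 * γ * r| ^ 3 ≤ |2 * γ| ^ 3 := by gcongr
    have e7 : |(2 * γ - Real.sin (2 * γ)) * r| ≤ |2 * γ| ^ 3 / 6 := by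
      rw [abs_mul]
      exact (mul_le_of_le_one_right (abs_nonneg _) hr).trans e1
    rw [e3]
    refine (abs_add_le _ _).trans ?_
    rw [abs_neg]
    linarith
  refine (norm_sub_le _ _).trans ((add_le_add_left (norm_add_le _ _) _).trans ?_)
  rw [norm_smul, norm_smul, norm_smul, Complex.norm_real, Complex.norm_real, Complex.norm_real,
    Real.norm_eq_abs, Real.norm_eq_abs, Real.norm_eq_abs, abs_of_nonneg (sq_nonneg (Real.sin γ))]
  have f1 := mul_le_mul hc1 (norm_rot_le (n := n) α) (norm_nonneg _) (by positivity)
  have f2 := mul_le_mul hc2 (norm_rot_le (n := n) (α - Real.pi / 2)) (norm_nonneg _) (by positivity)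
  have f3 := mul_le_mul hs2 hQn (norm_nonneg _) (by positivity)
  linarith

/-- Telescoping: the error of one step is carried through the remaining contractions. The induction
runs over all α because each step shifts the angle. -/
theorem norm_heis_iterate_rot_sub_le (hH : H.IsHermitian) {l M : ℕ} (hl : l ≠ 0) (hM : M ≠ 0)
    (γ Φ : ℝ) (hγ : |γ| ≤ 1 / 4) (hr : |genCoeff H l M Φ| ≤ 1) (N : ℕ) (α : ℝ) :
    ‖(heis H l M γ Φ)^[N] (rot α) - rot (α - N * (2 * γ * genCoeff H l M Φ))‖ ≤
      N * (4 * γ ^ 2) := by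
  have hcontr : ∀ (N : ℕ) (O : COp n), ‖(heis H l M γ Φ)^[N] O‖ ≤ ‖O‖ := by
    intro N
    induction N with
    | zero => intro O; simp
    | succ N ih =>
      intro O
      rw [Function.iterate_succ_apply]
      exact (ih _).trans (norm_heis_le hH hl hM γ Φ O)
  induction N generalizing α with
  | zero => simp
  | succ N ih =>
    have h1 := ih (α - 2 * γ * genCoeff H l M Φ)
    have h2 := (hcontr N _).trans (norm_heis_rot_sub_le hH hl hM γ Φ hγ hr α)
    rw [iterate_map_sub] at h2
    rw [Function.iterate_succ_apply]
    have e : α - ((N + 1 : ℕ) : ℝ) * (2 * γ * genCoeff H l M Φ) =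
        α - 2 * γ * genCoeff H l M Φ - N * (2 * γ * genCoeff H l M Φ) := by
      push_cast
      ring
    rw [e]
    refine (norm_sub_le_norm_sub_add_norm_sub _
      ((heis H l M γ Φ)^[N] (rot (α - 2 * γ * genCoeff H l M Φ))) _).trans ?_
    push_cast
    linarith

theorem norm_entry_le (D : COp n) (i : Fin 2 × Q n) : ‖D i i‖ ≤ ‖D‖ := by
  have h := Matrix.l2_opNorm_mulVec D (EuclideanSpace.single i 1)
  rw [PiLp.norm_single, norm_one, mul_one] at h
  refine le_trans ?_ h
  have h2 := PiLp.norm_apply_le (WithLp.toLp 2 (D.mulVec (EuclideanSpace.single i (1 : ℂ)))) i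
  refine le_trans (le_of_eq ?_) h2
  simp

end Heis

/-! ### Success probabilities -/

/-- The quadratic form `Re ⟨ψ, Oψ⟩`. -/
def quadForm {n : ℕ} (O : COp n) (ψ : Ket n) : ℝ := (star ψ ⬝ᵥ O *ᵥ ψ).re

/-- The projector of the control qubit for success. -/
noncomputable def successOp {n : ℕ} : Basis → COp n
  | Basis.zero => (1 / 2 : ℂ) • (1 + rot 0)
  | Basis.plus => (1 / 2 : ℂ) • (1 + rot (Real.pi / 2))

theorem Prog.mem_support_val_bind {α β : Type} {p : Prog α} {f : α → Prog β} {b : β}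
    (hb : b ∈ (Prog.val (p >>= f)).support) :
    ∃ a ∈ (Prog.val p).support, b ∈ (Prog.val (f a)).support := by
  rw [Prog.val_bind, PMF.mem_support_bind_iff] at hb
  exact hb

theorem expect_cond (p : PMF Bool) : expect p (fun b => cond b 1 0) = p true := by
  unfold expect
  rw [tsum_fintype, Fintype.sum_bool]
  simp

section Success

variable {n : ℕ} {H : Op n}

theorem quadForm_conj (O S : COp n) (ψ : Ket n) :
    quadForm (Sᴴ * O * S) ψ = quadForm O (S *ᵥ ψ) := by
  rw [quadForm, quadForm, ← Matrix.mulVec_mulVec, ← Matrix.mulVec_mulVec,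
    Matrix.dotProduct_mulVec, Matrix.vecMul_conjTranspose, star_star]

theorem quadForm_add (A B : COp n) (ψ : Ket n) :
    quadForm (A + B) ψ = quadForm A ψ + quadForm B ψ := by
  simp [quadForm, Matrix.add_mulVec, dotProduct_add]

theorem quadForm_smul_real (c : ℝ) (A : COp n) (ψ : Ket n) :
    quadForm ((c : ℂ) • A) ψ = c * quadForm A ψ := by
  simp [quadForm, Matrix.smul_mulVec, dotProduct_smul]

theorem quadForm_avg {α : Type*} [Fintype α] (f : α → COp n) (ψ : Ket n) :
    quadForm (avg f) ψ = (Fintype.card α : ℝ)⁻¹ * ∑ a, quadForm (f a) ψ := by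
  have h : avg f = (((Fintype.card α : ℝ)⁻¹ : ℝ) : ℂ) • ∑ a, f a := by
    simp [avg]
  rw [h, quadForm_smul_real]
  congr 1
  simp [quadForm, Matrix.sum_mulVec, dotProduct_sum]

theorem expect_uniform_quadForm {α : Type} [Fintype α] [Nonempty α] (c : ℕ) (f : α → COp n)
    (ψ : Ket n) (hf : ∀ a, 0 ≤ quadForm (f a) ψ) :
    expect (Prog.val (Prog.uniform α c)) (fun a => ENNReal.ofReal (quadForm (f a) ψ)) =
      ENNReal.ofReal (quadForm (avg f) ψ) := by
  rw [Prog.val_uniform, expect_uniform_ofReal _ hf, quadForm_avg]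

theorem quadForm_avg_nonneg {α : Type*} [Fintype α] (f : α → COp n) (ψ : Ket n)
    (hf : ∀ a, 0 ≤ quadForm (f a) ψ) : 0 ≤ quadForm (avg f) ψ := by
  rw [quadForm_avg]
  exact mul_nonneg (by positivity) (Finset.sum_nonneg fun a _ => hf a)

/-- Each step draws fresh randomness, so averaging over the last step replaces O by its Heisenberg
image. Nonnegativity is carried along because expectations take values in `ℝ≥0∞`, where
`ENNReal.ofReal` commutes with averages only of nonnegative terms. -/
theorem expect_genState (l M : ℕ) (γ Φ : ℝ) (N : ℕ) (O : COp n) (hO : ∀ ψ, 0 ≤ quadForm O ψ) :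
    0 ≤ quadForm ((heis H l M γ Φ)^[N] O) (initKet n) ∧
    expect (Prog.val (genState (evolution H) l γ M Φ N)) (fun ψ => ENNReal.ofReal (quadForm O ψ)) =
      ENNReal.ofReal (quadForm ((heis H l M γ Φ)^[N] O) (initKet n)) := by
  induction N generalizing O with
  | zero =>
    refine ⟨hO _, ?_⟩
    rw [genState, Prog.expect_val_bind, Prog.expect_val_tick, Prog.expect_val_pure]
    rfl
  | succ N ih =>
    have h1 : ∀ ψ u w s, 0 ≤ quadForm (((stepCircuit l M γ Φ u w s).matrix (evolution H))ᴴ * O *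
        (stepCircuit l M γ Φ u w s).matrix (evolution H)) ψ := fun ψ u w s => by
      rw [quadForm_conj]
      exact hO _
    have h2 : ∀ ψ u w, 0 ≤ quadForm (avg fun s =>
        ((stepCircuit l M γ Φ u w s).matrix (evolution H))ᴴ * O *
        (stepCircuit l M γ Φ u w s).matrix (evolution H)) ψ :=
      fun ψ u w => quadForm_avg_nonneg _ _ (h1 ψ u w)
    have h3 : ∀ ψ u, 0 ≤ quadForm (avg fun w => avg fun s =>
        ((stepCircuit l M γ Φ u w s).matrix (evolution H))ᴴ * O *
        (stepCircuit l M γ Φ u w s).matrix (evolution H)) ψ :=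
      fun ψ u => quadForm_avg_nonneg _ _ (h2 ψ u)
    have h4 : ∀ ψ, 0 ≤ quadForm (heis H l M γ Φ O) ψ :=
      fun ψ => quadForm_avg_nonneg _ _ (h3 ψ)
    rw [Function.iterate_succ_apply]
    have h5 := ih (heis H l M γ Φ O) h4
    refine ⟨h5.1, ?_⟩
    rw [← h5.2, genState, Prog.expect_val_bind]
    congr 1
    funext ψ
    simp only [Prog.expect_val_bind, Prog.expect_val_tick, Prog.expect_val_pure, ← quadForm_conj]
    rw [heis_apply, ← expect_uniform_quadForm (10 * l ^ 2 * n) _ _ (h3 ψ)]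
    congr 1
    funext u
    rw [← expect_uniform_quadForm (l ^ 2 * M * n) _ _ (h2 ψ u)]
    congr 1
    funext w
    rw [← expect_uniform_quadForm 1 _ _ (h1 ψ u w)]

/-- Every reachable state is a unit vector; this makes the truncation in `Prog.coin` harmless. -/
theorem quadForm_one_genState (hH : H.IsHermitian) {l M : ℕ} (hl : l ≠ 0) (hM : M ≠ 0) (γ Φ : ℝ)
    (N : ℕ) : ∀ ψ ∈ (Prog.val (genState (evolution H) l γ M Φ N)).support,
      quadForm (1 : COp n) ψ = 1 := by
  induction N with
  | zero =>
    intro ψ hψ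
    rw [genState] at hψ
    obtain ⟨a, -, hψ⟩ := Prog.mem_support_val_bind hψ
    rw [Prog.val_pure, PMF.mem_support_pure_iff] at hψ
    rw [hψ, quadForm, Matrix.one_mulVec, initKet]
    simp
  | succ N ih =>
    intro ψ hψ
    rw [genState] at hψ
    obtain ⟨χ, hχ, hψ⟩ := Prog.mem_support_val_bind hψ
    obtain ⟨u, -, hψ⟩ := Prog.mem_support_val_bind hψ
    obtain ⟨w, -, hψ⟩ := Prog.mem_support_val_bind hψ
    obtain ⟨s, -, hψ⟩ := Prog.mem_support_val_bind hψ
    obtain ⟨-, -, hψ⟩ := Prog.mem_support_val_bind hψ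
    rw [Prog.val_pure, PMF.mem_support_pure_iff] at hψ
    rw [hψ, ← quadForm_conj, mul_one, ← Matrix.star_eq_conjTranspose,
      (Unitary.mem_iff.1 (stepCircuit_mem_unitary hH hl hM γ Φ u w s)).1]
    exact ih χ hχ

theorem quadForm_blk_real (a b d : ℝ) (ψ : Ket n) :
    quadForm (blk ((a : ℂ) • 1) ((b : ℂ) • 1) ((b : ℂ) • 1) ((d : ℂ) • 1)) ψ =
      ∑ x, (a * ‖ψ (0, x)‖ ^ 2 + 2 * b * ((starRingEnd ℂ) (ψ (0, x)) * ψ (1, x)).re +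
        d * ‖ψ (1, x)‖ ^ 2) := by
  have h1 : ∀ x, (blk ((a : ℂ) • 1) ((b : ℂ) • 1) ((b : ℂ) • 1) ((d : ℂ) • 1) *ᵥ ψ) (0, x) =
      a * ψ (0, x) + b * ψ (1, x) := fun x => by
    simp [Matrix.mulVec, dotProduct, blk, Fintype.sum_prod_type, Matrix.one_apply]
  have h2 : ∀ x, (blk ((a : ℂ) • 1) ((b : ℂ) • 1) ((b : ℂ) • 1) ((d : ℂ) • 1) *ᵥ ψ) (1, x) =
      b * ψ (0, x) + d * ψ (1, x) := fun x => by
    simp [Matrix.mulVec, dotProduct, blk, Fintype.sum_prod_type, Matrix.one_apply]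
  rw [quadForm, dotProduct, Fintype.sum_prod_type, Fin.sum_univ_two, Complex.add_re,
    Complex.re_sum, Complex.re_sum, ← Finset.sum_add_distrib]
  refine Finset.sum_congr rfl fun x _ => ?_
  rw [h1, h2]
  simp only [Pi.star_apply, Complex.star_def, Complex.sq_norm, Complex.normSq_apply, Complex.mul_re,
    Complex.mul_im, Complex.add_re, Complex.add_im, Complex.conj_re, Complex.conj_im,
    Complex.ofReal_re, Complex.ofReal_im]
  ring

theorem bornProb_eq_quadForm (b : Basis) (ψ : Ket n) :
    (bornProb ψ b : ℝ) = quadForm (successOp b) ψ := by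
  have hs : ∀ α : ℝ, (1 / 2 : ℂ) • (1 + rot α : COp n) =
      blk ((((1 + Real.cos α) / 2 : ℝ) : ℂ) • 1) (((Real.sin α / 2 : ℝ) : ℂ) • 1)
        (((Real.sin α / 2 : ℝ) : ℂ) • 1) ((((1 - Real.cos α) / 2 : ℝ) : ℂ) • 1) := by
    intro α
    rw [rot, one_eq_blk, blk_add, smul_blk]
    push_cast
    congr 1 <;> module
  cases b with
  | zero =>
    rw [successOp, hs, quadForm_blk_real, bornProb]
    push_cast
    simp
  | plus =>
    rw [successOp, hs, quadForm_blk_real, bornProb]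
    push_cast
    refine Finset.sum_congr rfl fun x _ => ?_
    rw [norm_div, Complex.norm_real, div_pow, Real.norm_eq_abs, sq_abs, Real.sq_sqrt two_pos.le,
      Complex.sq_norm, Complex.sq_norm, Complex.sq_norm]
    simp only [Complex.normSq_apply, Complex.mul_re, Complex.add_re, Complex.add_im,
      Complex.conj_re, Complex.conj_im, Real.cos_pi_div_two, Real.sin_pi_div_two]
    ring

theorem bornProb_le (b : Basis) (ψ : Ket n) : (bornProb ψ b : ℝ) ≤ quadForm (1 : COp n) ψ := by
  have h1 : (1 : COp n) = blk (((1 : ℝ) : ℂ) • 1) (((0 : ℝ) : ℂ) • 1) (((0 : ℝ) : ℂ) • 1)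
      (((1 : ℝ) : ℂ) • 1) := by
    rw [one_eq_blk]
    simp
  rw [h1, quadForm_blk_real]
  cases b with
  | zero =>
    rw [bornProb]
    push_cast
    refine Finset.sum_le_sum fun x _ => ?_
    nlinarith [sq_nonneg ‖ψ (1, x)‖]
  | plus =>
    rw [bornProb]
    push_cast
    refine Finset.sum_le_sum fun x _ => ?_
    rw [norm_div, Complex.norm_real, div_pow, Real.norm_eq_abs, sq_abs, Real.sq_sqrt two_pos.le,
      Complex.sq_norm, Complex.sq_norm, Complex.sq_norm]
    simp only [Complex.normSq_apply, Complex.add_re, Complex.add_im]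
    nlinarith [sq_nonneg ((ψ (0, x)).re - (ψ (1, x)).re),
      sq_nonneg ((ψ (0, x)).im - (ψ (1, x)).im)]

/-! ### Comparison of the experiments with an exact phase. -/

theorem le_iterN {k : ℕ} (hk : 0 < k) :
    40 * Real.sqrt 2 * (k * Real.pi) ^ 2 ≤ iterN k := by
  have h := Nat.le_ceil (max (10 * 1 ^ 2 * (k * Real.pi) ^ 2 / (1 / (4 * Real.sqrt 2)))
    (5 * 1 * (k * Real.pi) / 2))
  refine le_trans ?_ h
  refine le_trans (le_of_eq ?_) (le_max_left _ _)
  field_simp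
  ring

theorem successProb_eq (hH : H.IsHermitian) {l : ℕ} (hl : 0 < l) (Φ : ℝ) (b : Basis) {k : ℕ}
    (hk : 0 < k) : successProb (evolution H) l Φ b k =
      quadForm ((heis H l (25 * k) (k * Real.pi / iterN k) Φ)^[iterN k] (successOp b))
        (initKet n) := by
  have hnn : ∀ ψ, 0 ≤ quadForm (successOp b : COp n) ψ := fun ψ => by
    rw [← bornProb_eq_quadForm]
    exact NNReal.coe_nonneg _
  have h := expect_genState (H := H) l (25 * k) (k * Real.pi / iterN k) Φ (iterN k)
    (successOp b) hnn
  have h2 : PMF.map Prod.fst (experiment (evolution H) l Φ b k).law true =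
      ENNReal.ofReal (quadForm ((heis H l (25 * k) (k * Real.pi / iterN k) Φ)^[iterN k]
        (successOp b)) (initKet n)) := by
    rw [← h.2, ← expect_cond]
    show expect (Prog.val (experiment (evolution H) l Φ b k)) _ = _
    rw [experiment, Prog.expect_val_bind]
    refine expect_congr_support _ fun ψ hψ => ?_
    have h1 := quadForm_one_genState hH hl.ne' (by positivity) _ _ _ ψ hψ
    have hle : bornProb ψ b ≤ 1 := by
      have := bornProb_le b ψ
      rw [h1] at this
      exact_mod_cast this
    rw [Prog.expect_val_coin, min_eq_left hle, ← bornProb_eq_quadForm]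
    simp
  rw [successProb, h2, ENNReal.toReal_ofReal h.1]

/-- The phase `v_Φ`. -/
noncomputable def truePhase (H : Op n) (l : ℕ) (Φ : ℝ) : ℝ :=
  2 * Real.pi * compA H l (10 * l ^ 2) * Real.cos (compTheta H l (10 * l ^ 2) + Φ)

theorem truePhase_eq (l : ℕ) (Φ : ℝ) :
    truePhase H l Φ =
      2 * Real.pi * (Complex.exp (Complex.I * Φ) * compZ H l (10 * l ^ 2)).re := by
  have h := compTheta_identity H l (10 * l ^ 2)
  have e : Complex.exp (Complex.I * Φ) * compZ H l (10 * l ^ 2) = (compA H l (10 * l ^ 2) : ℂ) *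
      Complex.exp ((compTheta H l (10 * l ^ 2) + Φ : ℝ) * Complex.I) := by
    rw [← h, mul_left_comm, ← Complex.exp_add]
    congr 2
    push_cast
    ring
  rw [truePhase, e, Complex.re_ofReal_mul, Complex.exp_ofReal_mul_I_re, mul_assoc]

/-- The two phases differ only by the trace factor of the compensating ladder, which is 1 + O(1/M).
With M = 25k the k-fold phase is then wrong only by a constant independent of k. -/
theorem abs_truePhase_sub_genCoeff_le (hH : IsSeed H) {l : ℕ} (hl : 0 < l) (Φ : ℝ) {M : ℕ}
    (hM : 25 ≤ M) :
    |2 * Real.pi * genCoeff H l M Φ - truePhase H l Φ| ≤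
      2 * Real.pi * (501 / 1000 * Real.pi ^ 2 / (4 * M)) := by
  have hl1 : (1 : ℝ) ≤ l := by exact_mod_cast hl
  have hM1 : (25 : ℝ) ≤ M := by exact_mod_cast hM
  have hpi := Real.pi_pos
  have hz : ‖compZ H (-(l : ℤ)) (l ^ 2 * M) - 1‖ ≤ 501 / 1000 * Real.pi ^ 2 / (4 * M) := by
    have e : ((-(l : ℤ) : ℤ) : ℝ) * Real.pi / (2 * ((l ^ 2 * M : ℕ) : ℝ)) =
        -(Real.pi / (2 * l * M)) := by
      push_cast
      field_simp
    refine (norm_compZ_sub_one_le hH _ _ ?_).trans (le_of_eq ?_)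
    · rw [e, abs_neg, abs_of_nonneg (by positivity), div_le_iff₀ (by positivity)]
      have : (25 : ℝ) ≤ l * M := by nlinarith
      nlinarith [Real.pi_lt_d2]
    · rw [e]
      push_cast
      field_simp
      norm_num
  rw [truePhase_eq, genCoeff, ← mul_sub, abs_mul, abs_of_pos (by positivity : 0 < 2 * Real.pi),
    ← Complex.sub_re, ← mul_sub]
  have e2 : compZ H l (10 * l ^ 2) * compZ H (-l) (l ^ 2 * M) - compZ H l (10 * l ^ 2) =
    compZ H l (10 * l ^ 2) * (compZ H (-l) (l ^ 2 * M) - 1) := by ring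
  refine mul_le_mul_of_nonneg_left ?_ (by positivity)
  refine (Complex.abs_re_le_norm _).trans ?_
  rw [norm_mul, Complex.norm_exp_I_mul_ofReal, one_mul, e2, norm_mul]
  refine le_trans ?_ hz
  exact mul_le_of_le_one_left (norm_nonneg _) (norm_compZ_le hH _ _)

theorem abs_genCoeff_le (hH : IsSeed H) (l M : ℕ) (Φ : ℝ) : |genCoeff H l M Φ| ≤ 1 := by
  refine (Complex.abs_re_le_norm _).trans ?_
  rw [norm_mul, Complex.norm_exp_I_mul_ofReal, one_mul, norm_mul]
  exact mul_le_one₀ (norm_compZ_le hH _ _) (norm_nonneg _) (norm_compZ_le hH _ _)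

open scoped Matrix.Norms.L2Operator in
-- Two errors are added: the drift of the iterated step away from an exact rotation, and the
-- replacement of the generator coefficient by the true phase. In the state `|0⟩ ⊗ |0⟩` the rotated
-- observable has expectation cos(α - kv); α = 0 and α = π/2 give the two experiments.
theorem abs_quadForm_heis_le (hH : IsSeed H) {l : ℕ} (hl : 0 < l) (Φ : ℝ) {k : ℕ}
    (hk : 0 < k) (α : ℝ) :
    |quadForm ((heis H l (25 * k) (k * Real.pi / iterN k) Φ)^[iterN k]
        ((1 / 2 : ℂ) • (1 + rot α))) (initKet n) -
      (1 + Real.cos (α - k * truePhase H l Φ)) / 2| ≤ 1 / 5 := by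
  have hpi3 := Real.pi_gt_d2
  have hpi4 := Real.pi_lt_d2
  have hk1 : (1 : ℝ) ≤ k := by exact_mod_cast hk
  have hN := le_iterN hk
  have hsqrt : (7 / 5 : ℝ) ≤ Real.sqrt 2 := by
    apply Real.le_sqrt_of_sq_le
    norm_num
  set N := iterN k
  set r := genCoeff H l (25 * k) Φ with hr
  have hkpi : 3 ≤ k * Real.pi := by nlinarith
  have hN1 : 56 * (k * Real.pi) ^ 2 ≤ N := by nlinarith [sq_nonneg (k * Real.pi)]
  have hNpos : (0 : ℝ) < N := by nlinarith
  have hγ : |k * Real.pi / N| ≤ 1 / 4 := by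
    rw [abs_of_nonneg (by positivity), div_le_iff₀ hNpos]
    nlinarith
  have hnorm := norm_heis_iterate_rot_sub_le hH.1 hl.ne' (M := 25 * k) (by positivity)
    (k * Real.pi / N) Φ hγ (abs_genCoeff_le hH _ _ _) N α
  have hphase : (N : ℝ) * (2 * (k * Real.pi / N) * r) = k * (2 * Real.pi * r) := by
    field_simp
  rw [← hr, hphase] at hnorm
  have hbound : (N : ℝ) * (4 * (k * Real.pi / N) ^ 2) ≤ 1 / 14 := by
    have : (N : ℝ) * (4 * (k * Real.pi / N) ^ 2) = 4 * (k * Real.pi) ^ 2 / N := by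
      field_simp
    rw [this, div_le_iff₀ hNpos]
    linarith
  have hfix := Function.iterate_fixed (heis_one hH.1 hl.ne' (M := 25 * k) (by positivity)
    (k * Real.pi / N) Φ) N
  have hlin : (heis H l (25 * k) (k * Real.pi / N) Φ)^[N] ((1 / 2 : ℂ) • (1 + rot α)) =
      ((1 / 2 : ℝ) : ℂ) • (1 + (heis H l (25 * k) (k * Real.pi / N) Φ)^[N] (rot α)) := by
    have h1 : ∀ (m : ℕ) (A : COp n), (heis H l (25 * k) (k * Real.pi / N) Φ)^[m]
        ((1 / 2 : ℂ) • A) = (1 / 2 : ℂ) • (heis H l (25 * k) (k * Real.pi / N) Φ)^[m] A := by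
      intro m
      induction m with
      | zero => intro A; rfl
      | succ m ih => intro A; rw [Function.iterate_succ_apply, map_smul, ih]; rfl
    rw [h1, iterate_map_add, hfix]
    norm_num
  have hq1 : quadForm (1 : COp n) (initKet n) = 1 := by
    rw [quadForm, Matrix.one_mulVec, initKet]
    simp
  have hqe : ∀ D : COp n, quadForm D (initKet n) = (D (0, fun _ => 0) (0, fun _ => 0)).re := by
    intro D
    rw [quadForm, initKet]
    simp
  rw [hlin, quadForm_smul_real, quadForm_add, hq1, hqe]
  have hrot : ∀ β : ℝ, ((rot β : COp n) (0, fun _ => 0) (0, fun _ => 0)) = Real.cos β := by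
    intro β
    simp [rot, blk]
  have hent := (Complex.abs_re_le_norm _).trans
    ((norm_entry_le _ ((0 : Fin 2), fun _ : Fin n => (0 : Fin 2))).trans hnorm)
  rw [Matrix.sub_apply, Complex.sub_re, hrot, Complex.ofReal_re] at hent
  have hcos : |Real.cos (α - k * (2 * Real.pi * r)) - Real.cos (α - k * truePhase H l Φ)| ≤
      k * (2 * Real.pi * (501 / 1000 * Real.pi ^ 2 / (4 * ((25 * k : ℕ) : ℝ)))) := by
    have h1 : |Real.cos (α - k * (2 * Real.pi * r)) - Real.cos (α - k * truePhase H l Φ)| ≤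
        |(α - k * (2 * Real.pi * r)) - (α - k * truePhase H l Φ)| := by
      have := Real.abs_sin_sub_sin_le (α - k * (2 * Real.pi * r) + Real.pi / 2)
        (α - k * truePhase H l Φ + Real.pi / 2)
      rw [Real.sin_add_pi_div_two, Real.sin_add_pi_div_two] at this
      refine this.trans (le_of_eq ?_)
      congr 1
      ring
    have e : (α - k * (2 * Real.pi * r)) - (α - k * truePhase H l Φ) =
      -(k * (2 * Real.pi * r - truePhase H l Φ)) := by ring
    rw [e, abs_neg, abs_mul, abs_of_pos (by positivity : (0 : ℝ) < k)] at h1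
    refine h1.trans (mul_le_mul_of_nonneg_left ?_ (by positivity))
    exact abs_truePhase_sub_genCoeff_le hH hl Φ (by omega)
  have hcos2 : k * (2 * Real.pi * (501 / 1000 * Real.pi ^ 2 / (4 * ((25 * k : ℕ) : ℝ)))) =
      501 / 50000 * Real.pi ^ 3 := by
    push_cast
    field_simp
    ring
  have hpi_cube : Real.pi ^ 3 ≤ 3.15 ^ 3 := by gcongr
  rw [hcos2] at hcos
  -- Half of 1/14 + 0.01002 · 3.15³ is about 0.193, just below 1/5.
  rw [abs_le] at hcos hent ⊢
  constructor <;> nlinarith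

theorem abs_successProb_zero_sub_le (hH : IsSeed H) {l : ℕ} (hl : 0 < l) (Φ : ℝ) {k : ℕ}
    (hk : 0 < k) : |successProb (evolution H) l Φ Basis.zero k -
      (1 + Real.cos (k * truePhase H l Φ)) / 2| ≤ 1 / 5 := by
  have h := abs_quadForm_heis_le hH hl Φ hk 0
  rw [zero_sub, Real.cos_neg] at h
  rwa [successProb_eq hH.1 hl Φ Basis.zero hk, successOp]

theorem abs_successProb_plus_sub_le (hH : IsSeed H) {l : ℕ} (hl : 0 < l) (Φ : ℝ) {k : ℕ}
    (hk : 0 < k) : |successProb (evolution H) l Φ Basis.plus k -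
      (1 + Real.sin (k * truePhase H l Φ)) / 2| ≤ 1 / 5 := by
  have h := abs_quadForm_heis_le hH hl Φ hk (Real.pi / 2)
  rw [Real.cos_pi_div_two_sub] at h
  rwa [successProb_eq hH.1 hl Φ Basis.plus hk, successOp]

theorem norm_compZ_estimated_sub_one_le (hH : IsSeed H) {l : ℕ} (hl : 0 < l) :
    ‖compZ H l (10 * l ^ 2) - 1‖ ≤ 501 / 400000 * (10 * Real.pi ^ 2) := by
  have hl1 : (1 : ℝ) ≤ l := by exact_mod_cast hl
  have hpi := Real.pi_pos
  have e : ((l : ℤ) : ℝ) * Real.pi / (2 * ((10 * l ^ 2 : ℕ) : ℝ)) = Real.pi / (20 * l) := by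
    push_cast
    field_simp
    ring
  refine (norm_compZ_sub_one_le hH _ _ ?_).trans (le_of_eq ?_)
  · rw [e, abs_of_nonneg (by positivity), div_le_iff₀ (by positivity)]
    nlinarith [Real.pi_lt_d2]
  · rw [e]
    push_cast
    field_simp
    ring

end Success

/-! ### Concentration of the number of successes -/

/-- Indicator of a deviation of more than `M / 10` from the mean number of successes. -/
noncomputable def deviates (M : ℕ) (p : ℝ) (a : ℕ) : ℝ≥0∞ :=
  open Classical in if |(a : ℝ) - M * p| ≤ M / 10 then 0 else 1

theorem expect_bool_ofReal (q : PMF Bool) (f : Bool → ℝ) (hf : ∀ b, 0 ≤ f b) :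
    expect q (fun b => ENNReal.ofReal (f b)) =
      ENNReal.ofReal ((q true).toReal * f true + (1 - (q true).toReal) * f false) := by
  have h1 : q true + q false = 1 := by
    have := q.tsum_coe
    rwa [tsum_fintype, Fintype.sum_bool] at this
  have h2 : 1 - (q true).toReal = (q false).toReal := by
    rw [← ENNReal.toReal_one, ← h1, ENNReal.toReal_add (q.apply_ne_top _) (q.apply_ne_top _)]
    ring
  rw [h2, ENNReal.ofReal_add (mul_nonneg ENNReal.toReal_nonneg (hf _))
    (mul_nonneg ENNReal.toReal_nonneg (hf _)), ENNReal.ofReal_mul ENNReal.toReal_nonneg,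
    ENNReal.ofReal_mul ENNReal.toReal_nonneg, ENNReal.ofReal_toReal (q.apply_ne_top _),
    ENNReal.ofReal_toReal (q.apply_ne_top _)]
  unfold expect
  rw [tsum_fintype, Fintype.sum_bool]

theorem successProb_mem_Icc {n : ℕ} (U : ℝ → Op n) (l : ℕ) (Φ : ℝ) (b : Basis) (k : ℕ) :
    0 ≤ successProb U l Φ b k ∧ successProb U l Φ b k ≤ 1 := by
  refine ⟨ENNReal.toReal_nonneg, ?_⟩
  rw [successProb, ← ENNReal.toReal_one]
  exact ENNReal.toReal_mono ENNReal.one_ne_top (PMF.coe_le_one _ _)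

section Count

variable {n : ℕ} (U : ℝ → Op n) (l : ℕ) (Φ : ℝ) (b : Basis) (k : ℕ)

theorem expect_countSuccesses_exp (x : ℝ) (M : ℕ) :
    expect (Prog.val (countSuccesses U l Φ b k M)) (fun a => ENNReal.ofReal (Real.exp (x * a))) =
      ENNReal.ofReal ((successProb U l Φ b k * Real.exp x + (1 - successProb U l Φ b k)) ^ M) := by
  have hp := successProb_mem_Icc U l Φ b k
  have hb : 0 ≤ successProb U l Φ b k * Real.exp x + (1 - successProb U l Φ b k) :=
    add_nonneg (mul_nonneg hp.1 (Real.exp_pos x).le) (sub_nonneg.2 hp.2)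
  induction M with
  | zero => rw [countSuccesses, Prog.expect_val_pure]; simp
  | succ M ih =>
    rw [countSuccesses, Prog.expect_val_bind, pow_succ, ENNReal.ofReal_mul (pow_nonneg hb M), ← ih,
      mul_comm, ← expect_const_mul]
    congr 1
    funext a
    simp only [Prog.expect_val_bind, Prog.expect_val_pure]
    rw [expect_bool_ofReal _ _ fun r => (Real.exp_pos _).le, ← ENNReal.ofReal_mul hb]
    congr 1
    show successProb U l Φ b k * _ + (1 - successProb U l Φ b k) * _ = _
    simp only [if_true, Bool.false_eq_true, if_false]
    push_cast
    rw [mul_add, mul_one, Real.exp_add]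
    ring

/-- Chernoff bound with tilts ±1/20. The remainder x² = 1/400 of the exponential costs M/400 in the
exponent, while the deviation M/10 gains M/200. The factor 2 accounts for the two tails. -/
theorem expect_deviates_le (M : ℕ) :
    expect (Prog.val (countSuccesses U l Φ b k M)) (deviates M (successProb U l Φ b k)) ≤
      ENNReal.ofReal (2 * Real.exp (-(M / 400 : ℝ))) := by
  set p := successProb U l Φ b k with hp_def
  have hp := successProb_mem_Icc U l Φ b k
  rw [← hp_def] at hp
  have hmgf : ∀ x : ℝ, |x| = 1 / 20 →
      Real.exp (-x * (M * p) - M / 200) * (p * Real.exp x + (1 - p)) ^ M ≤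
        Real.exp (-(M / 400 : ℝ)) := by
    intro x hx
    have h1 := Real.norm_exp_sub_one_sub_id_le (x := x) (by rw [Real.norm_eq_abs, hx]; norm_num)
    rw [Real.norm_eq_abs, Real.norm_eq_abs, hx] at h1
    have h2 : p * Real.exp x + (1 - p) ≤ Real.exp (p * x + 1 / 400) := by
      refine le_trans ?_ (Real.add_one_le_exp _)
      have h3 := (abs_le.1 h1).2
      nlinarith [mul_le_mul_of_nonneg_left h3 hp.1]
    have h0 : 0 ≤ p * Real.exp x + (1 - p) :=
      add_nonneg (mul_nonneg hp.1 (Real.exp_pos x).le) (sub_nonneg.2 hp.2)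
    have h4 := pow_le_pow_left₀ h0 h2 M
    rw [← Real.exp_nat_mul] at h4
    refine (mul_le_mul_of_nonneg_left h4 (Real.exp_pos _).le).trans (le_of_eq ?_)
    rw [← Real.exp_add]
    congr 1
    ring
  have hpt : ∀ a : ℕ, deviates M p a ≤
      ENNReal.ofReal (Real.exp (-(1 / 20) * (M * p) - M / 200)) *
        ENNReal.ofReal (Real.exp (1 / 20 * a)) +
      ENNReal.ofReal (Real.exp (-(-(1 / 20)) * (M * p) - M / 200)) *
        ENNReal.ofReal (Real.exp (-(1 / 20) * a)) := by
    intro a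
    unfold deviates
    split_ifs with h
    · exact zero_le
    · rw [← ENNReal.ofReal_mul (Real.exp_pos _).le, ← ENNReal.ofReal_mul (Real.exp_pos _).le,
        ← Real.exp_add, ← Real.exp_add]
      rw [not_le, lt_abs] at h
      rcases h with h | h
      · refine le_trans ?_ le_self_add
        rw [← ENNReal.ofReal_one]
        refine ENNReal.ofReal_le_ofReal (Real.one_le_exp ?_)
        linarith
      · refine le_trans ?_ le_add_self
        rw [← ENNReal.ofReal_one]
        refine ENNReal.ofReal_le_ofReal (Real.one_le_exp ?_)
        linarith
  refine (expect_mono _ hpt).trans ?_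
  rw [expect_add, expect_const_mul, expect_const_mul, expect_countSuccesses_exp,
    expect_countSuccesses_exp, ← ENNReal.ofReal_mul (Real.exp_pos _).le,
    ← ENNReal.ofReal_mul (Real.exp_pos _).le, two_mul,
    ENNReal.ofReal_add (Real.exp_pos _).le (Real.exp_pos _).le]
  refine add_le_add (ENNReal.ofReal_le_ofReal ?_) (ENNReal.ofReal_le_ofReal ?_)
  · exact hmgf (1 / 20) (abs_of_pos (by norm_num))
  · exact hmgf (-(1 / 20)) (by rw [abs_neg]; exact abs_of_pos (by norm_num))

end Count

/-! ### One refinement of the phase estimate -/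

/-- Rotating by -κ moves the ideal point to 1. The given point then has squared distance at most
18/25 < 3/4 from 1, and the disc of radius √3/2 around 1 is seen from the origin under angles below
π/3. -/
theorem exists_arg_eq_add (x y κ : ℝ) (hx : |x - Real.cos κ| ≤ 3 / 5)
    (hy : |y - Real.sin κ| ≤ 3 / 5) :
    ∃ d : ℝ, |d| < Real.pi / 3 ∧ ∃ m : ℤ, Complex.arg ⟨x, y⟩ = κ + d + m * (2 * Real.pi) := by
  set ω : ℂ := ⟨x * Real.cos κ + y * Real.sin κ, y * Real.cos κ - x * Real.sin κ⟩ with hω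
  have hcs := Real.sin_sq_add_cos_sq κ
  have hx2 : (x - Real.cos κ) ^ 2 ≤ (3 / 5) ^ 2 := sq_le_sq' (abs_le.1 hx).1 (abs_le.1 hx).2
  have hy2 : (y - Real.sin κ) ^ 2 ≤ (3 / 5) ^ 2 := sq_le_sq' (abs_le.1 hy).1 (abs_le.1 hy).2
  have hw : (⟨x, y⟩ : ℂ) = ω * Complex.exp (κ * Complex.I) := by
    rw [Complex.exp_mul_I, ← Complex.ofReal_cos, ← Complex.ofReal_sin]
    apply Complex.ext
    · simp only [hω, Complex.mul_re, Complex.mul_im, Complex.add_re, Complex.add_im,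
        Complex.ofReal_re, Complex.ofReal_im, Complex.I_re, Complex.I_im]
      linear_combination (-x) * hcs
    · simp only [hω, Complex.mul_re, Complex.mul_im, Complex.add_re, Complex.add_im,
        Complex.ofReal_re, Complex.ofReal_im, Complex.I_re, Complex.I_im]
      linear_combination (-y) * hcs
  have hsum : (ω.re - 1) ^ 2 + ω.im ^ 2 ≤ 18 / 25 := by
    have : (ω.re - 1) ^ 2 + ω.im ^ 2 = (x - Real.cos κ) ^ 2 + (y - Real.sin κ) ^ 2 := by
      simp only [hω]
      linear_combination (x ^ 2 + y ^ 2 - 1) * hcs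
    linarith
  have hre : 0 < ω.re := by nlinarith [sq_nonneg ω.im]
  have hωne : ω ≠ 0 := fun h => by rw [h] at hre; simp at hre
  -- This amounts to Im² < 3 Re², and with Im² ≤ 18/25 - (Re - 1)² the difference is at least ((4 Re
  -- - 1)² + 3/25)/4.
  have hnorm : ‖ω‖ < 2 * ω.re := by
    rw [← abs_of_pos (by positivity : 0 < 2 * ω.re)]
    refine lt_of_pow_lt_pow_left₀ 2 (abs_nonneg _) ?_
    rw [sq_abs, Complex.sq_norm, Complex.normSq_apply]
    nlinarith [sq_nonneg (4 * ω.re - 1)]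
  have hcos : 1 / 2 < Real.cos ω.arg := by
    rw [Complex.cos_arg hωne, lt_div_iff₀ (norm_pos_iff.2 hωne)]
    linarith
  refine ⟨ω.arg, ?_, ?_⟩
  · by_contra! h
    have := Real.cos_le_cos_of_nonneg_of_le_pi (by positivity) (Complex.abs_arg_le_pi ω) h
    rw [Real.cos_abs, Real.cos_pi_div_three] at this
    linarith
  · have h1 : Complex.arg ⟨x, y⟩ = toIocMod Real.two_pi_pos (-Real.pi) (ω.arg + κ) := by
      rw [← Complex.arg_exp_mul_I, hw]
      conv_lhs => rw [← Complex.norm_mul_exp_arg_mul_I ω]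
      rw [mul_assoc, Complex.arg_real_mul _ (norm_pos_iff.2 hωne), ← Complex.exp_add]
      congr 2
      push_cast
      ring
    refine ⟨-toIocDiv Real.two_pi_pos (-Real.pi) (ω.arg + κ), ?_⟩
    rw [h1, toIocMod, zsmul_eq_mul]
    push_cast
    ring

theorem abs_rpeUpdate_sub_le {k : ℕ} (hk : 0 < k) (M a b : ℕ) (v : ℝ) :
    |rpeUpdate k M a b v - v| ≤ Real.pi / k := by
  have hk' : (0 : ℝ) < k := Nat.cast_pos.2 hk
  have h := toIocMod_mem_Ioc Real.two_pi_pos (k * v - Real.pi)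
    (Complex.arg ⟨2 * (a : ℝ) / M - 1, 2 * (b : ℝ) / M - 1⟩)
  have e : rpeUpdate k M a b v - v = (toIocMod Real.two_pi_pos (k * v - Real.pi)
    (Complex.arg ⟨2 * (a : ℝ) / M - 1, 2 * (b : ℝ) / M - 1⟩) - k * v) / k := by
    rw [rpeUpdate]
    field_simp
  rw [e, abs_div, abs_of_pos hk']
  gcongr
  rw [abs_le]
  constructor <;> linarith [h.1, h.2]

/-- The bias 1/5 and the sampling error 1/10 are doubled to 3/5 in each coordinate, so the angle is
known up to π/3. The chosen lift differs from kφ by that angle error plus a multiple of 2π, and by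
at most π + 2π/3; the multiple must therefore vanish. -/
theorem abs_rpeUpdate_sub_lt {k : ℕ} (hk : 0 < k) {M : ℕ} (hM : 0 < M) {a b : ℕ} {v φ p q : ℝ}
    (hp : |p - (1 + Real.cos (k * φ)) / 2| ≤ 1 / 5) (hq : |q - (1 + Real.sin (k * φ)) / 2| ≤ 1 / 5)
    (ha : |(a : ℝ) - M * p| ≤ M / 10) (hb : |(b : ℝ) - M * q| ≤ M / 10)
    (hv : k * |v - φ| ≤ 2 * Real.pi / 3) :
    k * |rpeUpdate k M a b v - φ| < Real.pi / 3 := by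
  have hk' : (0 : ℝ) < k := Nat.cast_pos.2 hk
  have hM' : (0 : ℝ) < M := Nat.cast_pos.2 hM
  have hfreq : ∀ (c : ℕ) (r t : ℝ), |r - (1 + t) / 2| ≤ 1 / 5 → |(c : ℝ) - M * r| ≤ M / 10 →
      |2 * (c : ℝ) / M - 1 - t| ≤ 3 / 5 := by
    intro c r t h1 h2
    have h3 : |(c : ℝ) / M - r| ≤ 1 / 10 := by
      have : (c : ℝ) / M - r = ((c : ℝ) - M * r) / M := by field_simp
      rw [this, abs_div, abs_of_pos hM', div_le_iff₀ hM']
      linarith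
    have h4 : 2 * (c : ℝ) / M = 2 * ((c : ℝ) / M) := by ring
    rw [h4]
    rw [abs_le] at *
    constructor <;> linarith [h1.1, h1.2, h3.1, h3.2]
  obtain ⟨d, hd, m, hm⟩ := exists_arg_eq_add _ _ (k * φ) (hfreq a p _ hp ha) (hfreq b q _ hq hb)
  have h := toIocMod_mem_Ioc Real.two_pi_pos (k * v - Real.pi)
    (Complex.arg ⟨2 * (a : ℝ) / M - 1, 2 * (b : ℝ) / M - 1⟩)
  have hup : k * rpeUpdate k M a b v = toIocMod Real.two_pi_pos (k * v - Real.pi)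
    (Complex.arg ⟨2 * (a : ℝ) / M - 1, 2 * (b : ℝ) / M - 1⟩) := by
    rw [rpeUpdate]
    field_simp
  have hdiff : ∃ m' : ℤ, k * rpeUpdate k M a b v - k * φ = d + m' * (2 * Real.pi) := by
    refine ⟨m - toIocDiv Real.two_pi_pos (k * v - Real.pi)
      (Complex.arg ⟨2 * (a : ℝ) / M - 1, 2 * (b : ℝ) / M - 1⟩), ?_⟩
    rw [hup, toIocMod, zsmul_eq_mul]
    push_cast
    linear_combination hm
  obtain ⟨m', hm'⟩ := hdiff
  rw [← hup] at h
  have hpi := Real.pi_pos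
  have hv' : |k * v - k * φ| ≤ 2 * Real.pi / 3 := by
    rw [← mul_sub, abs_mul, abs_of_pos hk']
    exact hv
  rw [abs_le] at hv'
  have hd' := abs_lt.1 hd
  have hm1 : (m' : ℝ) < 1 := by
    by_contra! hc
    nlinarith [h.2, mul_le_mul_of_nonneg_right hc hpi.le]
  have hm2 : (-1 : ℝ) < m' := by
    by_contra! hc
    nlinarith [h.1, mul_le_mul_of_nonneg_right hc hpi.le]
  have hm0 : m' = 0 := by
    have h1 : m' < 1 := by exact_mod_cast hm1
    have h2 : -1 < m' := by exact_mod_cast hm2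
    omega
  rw [hm0, Int.cast_zero, zero_mul, add_zero] at hm'
  have : (k : ℝ) * |rpeUpdate k M a b v - φ| = |d| := by
    rw [← hm', ← mul_sub, abs_mul, abs_of_pos hk']
  rw [this]
  exact hd

/-! ### Mean square error of robust phase estimation -/

/-- A bound for the squared error after the last stage if the error after `J` stages is `x` and
the later stages succeed, up to the resolution of the last stage. -/
noncomputable def rpePotential (J : ℕ) (x : ℝ) : ℝ :=
  open Classical in if 2 ^ J * x ≤ 2 * Real.pi / 3 then 0 else (x + 2 * Real.pi / 2 ^ J) ^ 2

theorem rpePotential_nonneg (J : ℕ) (x : ℝ) : 0 ≤ rpePotential J x := by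
  unfold rpePotential
  split_ifs
  · exact le_rfl
  · exact sq_nonneg _

theorem sq_le_add_rpePotential (J : ℕ) {x : ℝ} (hx : 0 ≤ x) :
    x ^ 2 ≤ 4 / 9 * Real.pi ^ 2 / 4 ^ J + rpePotential J x := by
  have hpi := Real.pi_pos
  unfold rpePotential
  split_ifs with h
  · have h1 : x ≤ 2 * Real.pi / 3 / 2 ^ J := by
      rw [le_div_iff₀ (by positivity)]
      linarith
    have h2 : (2 * Real.pi / 3 / 2 ^ J) ^ 2 = 4 / 9 * Real.pi ^ 2 / 4 ^ J := by
      rw [div_pow, ← pow_mul, mul_comm J 2, pow_mul]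
      norm_num
      ring
    rw [add_zero, ← h2]
    gcongr
  · have h1 : x ^ 2 ≤ (x + 2 * Real.pi / 2 ^ J) ^ 2 := by
      gcongr
      have : 0 ≤ 2 * Real.pi / 2 ^ J := by positivity
      linarith
    have h2 : 0 ≤ 4 / 9 * Real.pi ^ 2 / 4 ^ J := by positivity
    linarith

/-- The worst case is losing track in this stage: then y + π/2^J is at most (2π/3 + 2π)/2^J, whose
square is the increment. Off track the potential does not increase at all. -/
theorem rpePotential_succ_le (J : ℕ) {x y : ℝ} (hy : y ≤ x + Real.pi / 2 ^ J) :
    rpePotential (J + 1) y ≤ rpePotential J x + 64 / 9 * Real.pi ^ 2 / 4 ^ J := by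
  have hpi := Real.pi_pos
  have hJ : 0 < (2 : ℝ) ^ J := by positivity
  have hc : 0 ≤ 64 / 9 * Real.pi ^ 2 / 4 ^ J := by positivity
  unfold rpePotential
  split_ifs with h1 h2 h2
  · linarith
  · have := sq_nonneg (x + 2 * Real.pi / 2 ^ J)
    linarith
  · rw [zero_add]
    have hx' : x ≤ 2 * Real.pi / 3 / 2 ^ J := by
      rw [le_div_iff₀ hJ]
      linarith
    have h3 : (8 / 3 * Real.pi / 2 ^ J) ^ 2 = 64 / 9 * Real.pi ^ 2 / 4 ^ J := by
      rw [div_pow, ← pow_mul, mul_comm J 2, pow_mul]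
      norm_num
      ring
    have hy0 : 0 ≤ y + 2 * Real.pi / 2 ^ (J + 1) := by
      have : 0 < y := by
        by_contra! hc
        apply h1
        have : 2 ^ (J + 1) * y ≤ 0 := mul_nonpos_of_nonneg_of_nonpos (by positivity) hc
        linarith
      positivity
    rw [← h3]
    gcongr
    have e1 : 2 * Real.pi / 2 ^ (J + 1) = Real.pi / 2 ^ J := by
      rw [pow_succ]; field_simp
    have e2 : 8 / 3 * Real.pi / 2 ^ J = 2 * Real.pi / 3 / 2 ^ J + Real.pi / 2 ^ J + Real.pi / 2 ^ J := by
      ring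
    rw [e1, e2]
    linarith
  · have hy0 : 0 ≤ y + 2 * Real.pi / 2 ^ (J + 1) := by
      have : 0 < y := by
        by_contra! hc
        apply h1
        have : 2 ^ (J + 1) * y ≤ 0 := mul_nonpos_of_nonneg_of_nonpos (by positivity) hc
        linarith
      positivity
    have e1 : 2 * Real.pi / 2 ^ (J + 1) = Real.pi / 2 ^ J := by
      rw [pow_succ]; field_simp
    have h3 : (y + 2 * Real.pi / 2 ^ (J + 1)) ^ 2 ≤ (x + 2 * Real.pi / 2 ^ J) ^ 2 := by
      refine pow_le_pow_left₀ hy0 ?_ 2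
      rw [e1]
      have : 2 * Real.pi / 2 ^ J = Real.pi / 2 ^ J + Real.pi / 2 ^ J := by ring
      linarith
    linarith

/-- The summand 2π/2^J is the total length of all possible later moves π/2^J + π/2^{J+1} + ⋯. A move
spends its share, so an estimate that is off track cannot raise the potential; one on track stays on
track by hypothesis. -/
theorem rpePotential_succ_le_of_on_track (J : ℕ) {x y : ℝ}
    (hy : y ≤ x + Real.pi / 2 ^ J)
    (h : 2 ^ J * x ≤ 2 * Real.pi / 3 → 2 ^ J * y < Real.pi / 3) :
    rpePotential (J + 1) y ≤ rpePotential J x := by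
  have hpi := Real.pi_pos
  by_cases hxt : 2 ^ J * x ≤ 2 * Real.pi / 3
  · have h1 : 2 ^ (J + 1) * y ≤ 2 * Real.pi / 3 := by
      rw [pow_succ]
      linarith [h hxt]
    have h2 : rpePotential (J + 1) y = 0 := by
      unfold rpePotential
      rw [if_pos h1]
    rw [h2]
    exact rpePotential_nonneg J x
  · unfold rpePotential
    rw [if_neg hxt]
    split_ifs with h1
    · exact sq_nonneg _
    · have hy0 : 0 ≤ y + 2 * Real.pi / 2 ^ (J + 1) := by
        have : 0 < y := by
          by_contra! hc
          apply h1
          have : 2 ^ (J + 1) * y ≤ 0 := mul_nonpos_of_nonneg_of_nonpos (by positivity) hc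
          linarith
        positivity
      have e1 : 2 * Real.pi / 2 ^ (J + 1) = Real.pi / 2 ^ J := by
        rw [pow_succ]; field_simp
      refine pow_le_pow_left₀ hy0 ?_ 2
      rw [e1]
      have : 2 * Real.pi / 2 ^ J = Real.pi / 2 ^ J + Real.pi / 2 ^ J := by ring
      linarith

section Rpe

variable {n : ℕ} {U : ℝ → Op n} {l : ℕ} {Φ δ φ v₀ : ℝ}

/-- The success probabilities deviate by at most `1/5` from those of an exact phase gate. -/
def CloseToPhase (U : ℝ → Op n) (l : ℕ) (Φ φ : ℝ) : Prop := ∀ k : ℕ, 0 < k →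
  |successProb U l Φ Basis.zero k - (1 + Real.cos (k * φ)) / 2| ≤ 1 / 5 ∧
  |successProb U l Φ Basis.plus k - (1 + Real.sin (k * φ)) / 2| ≤ 1 / 5

theorem rpePotential_update_le (h : CloseToPhase U l Φ φ) (J : ℕ) {M : ℕ} (hM : 0 < M) (a b : ℕ)
    (v : ℝ) : ENNReal.ofReal (rpePotential (J + 1) |rpeUpdate (2 ^ J) M a b v - φ|) ≤
      ENNReal.ofReal (rpePotential J |v - φ|) + ENNReal.ofReal (64 / 9 * Real.pi ^ 2 / 4 ^ J) *
        (deviates M (successProb U l Φ Basis.zero (2 ^ J)) a +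
          deviates M (successProb U l Φ Basis.plus (2 ^ J)) b) := by
  have hk : 0 < 2 ^ J := by positivity
  have hup := abs_rpeUpdate_sub_le hk M a b v
  push_cast at hup
  have hy : |rpeUpdate (2 ^ J) M a b v - φ| ≤ |v - φ| + Real.pi / 2 ^ J := by
    have := abs_sub_le (rpeUpdate (2 ^ J) M a b v) v φ
    linarith
  have hjump := rpePotential_succ_le J hy
  have hc : 0 ≤ 64 / 9 * Real.pi ^ 2 / 4 ^ J := by positivity
  have hbad : ∀ x : ℝ≥0∞, 1 ≤ x →
      ENNReal.ofReal (rpePotential (J + 1) |rpeUpdate (2 ^ J) M a b v - φ|) ≤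
      ENNReal.ofReal (rpePotential J |v - φ|) +
        ENNReal.ofReal (64 / 9 * Real.pi ^ 2 / 4 ^ J) * x := by
    intro x hx
    refine (ENNReal.ofReal_le_ofReal hjump).trans ?_
    rw [ENNReal.ofReal_add (rpePotential_nonneg _ _) hc]
    gcongr
    exact le_mul_of_one_le_right' hx
  by_cases ha : |(a : ℝ) - M * successProb U l Φ Basis.zero (2 ^ J)| ≤ M / 10
  · by_cases hb : |(b : ℝ) - M * successProb U l Φ Basis.plus (2 ^ J)| ≤ M / 10
    · refine le_trans (ENNReal.ofReal_le_ofReal ?_) le_self_add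
      refine rpePotential_succ_le_of_on_track J hy fun hv => ?_
      have := abs_rpeUpdate_sub_lt hk hM (h _ hk).1 (h _ hk).2 ha hb (v := v)
      push_cast at this
      exact this hv
    · refine hbad _ (le_trans ?_ le_add_self)
      rw [deviates, if_neg hb]
  · refine hbad _ (le_trans ?_ le_self_add)
    rw [deviates, if_neg ha]

theorem expect_rpe_succ_le (h : CloseToPhase U l Φ φ) (K J : ℕ) (hF : 0 < rpeF δ) :
    expect (Prog.val (rpe U l Φ δ K v₀ (J + 1)))
        (fun v => ENNReal.ofReal (rpePotential (J + 1) |v - φ|)) ≤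
      expect (Prog.val (rpe U l Φ δ K v₀ J)) (fun v => ENNReal.ofReal (rpePotential J |v - φ|)) +
        ENNReal.ofReal (64 / 9 * Real.pi ^ 2 / 4 ^ J *
          (4 * Real.exp (-(rpeM δ K (J + 1) / 400 : ℝ)))) := by
  have hM : 0 < rpeM δ K (J + 1) := Nat.mul_pos hF (by omega)
  have hc : 0 ≤ 64 / 9 * Real.pi ^ 2 / 4 ^ J := by positivity
  have he := Real.exp_pos (-(rpeM δ K (J + 1) / 400 : ℝ))
  have key : ∀ v, expect (Prog.val (countSuccesses U l Φ Basis.zero (2 ^ J) (rpeM δ K (J + 1))))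
      (fun a => expect (Prog.val (countSuccesses U l Φ Basis.plus (2 ^ J) (rpeM δ K (J + 1))))
        (fun b => ENNReal.ofReal
          (rpePotential (J + 1) |rpeUpdate (2 ^ J) (rpeM δ K (J + 1)) a b v - φ|))) ≤
      ENNReal.ofReal (rpePotential J |v - φ|) + ENNReal.ofReal (64 / 9 * Real.pi ^ 2 / 4 ^ J *
          (4 * Real.exp (-(rpeM δ K (J + 1) / 400 : ℝ)))) := by
    intro v
    refine (expect_mono _ fun a => expect_mono _ fun b =>
      rpePotential_update_le h J hM a b v).trans ?_
    simp only [expect_add, expect_const_mul, expect_const]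
    rw [ENNReal.ofReal_mul hc]
    gcongr
    have e4 : 4 * Real.exp (-(rpeM δ K (J + 1) / 400 : ℝ)) =
      2 * Real.exp (-(rpeM δ K (J + 1) / 400 : ℝ)) + 2 * Real.exp (-(rpeM δ K (J + 1) / 400 : ℝ)) :=
      by ring
    rw [e4, ENNReal.ofReal_add (by positivity) (by positivity)]
    exact add_le_add (expect_deviates_le _ _ _ _ _ _) (expect_deviates_le _ _ _ _ _ _)
  rw [rpe, Prog.expect_val_bind]
  simp only [Prog.expect_val_bind, Prog.expect_val_pure, Prog.expect_val_tick]
  refine (expect_mono _ key).trans ?_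
  rw [expect_add, expect_const]

/-- A bad stage costs O(4^{-J}) with probability O(8^{-(K-J)}), that is O(2^J/8^K). These
contributions form a geometric series dominated by the last stage. -/
theorem expect_rpePotential_le (h : CloseToPhase U l Φ φ) (hF : 4000 ≤ rpeF δ) (K : ℕ)
    (h₀ : |v₀ - φ| ≤ 2 * Real.pi / 3) (J : ℕ) (hJ : J ≤ K) :
    expect (Prog.val (rpe U l Φ δ K v₀ J)) (fun v => ENNReal.ofReal (rpePotential J |v - φ|)) ≤
      ENNReal.ofReal (Real.pi ^ 2 / 18 * (2 ^ J / 8 ^ K)) := by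
  induction J with
  | zero =>
    rw [rpe, Prog.expect_val_pure, rpePotential, if_pos (by simpa using h₀)]
    simp
  | succ J ih =>
    refine (expect_rpe_succ_le h K J (by omega)).trans ?_
    refine (add_le_add_left (ih (by omega)) _).trans ?_
    rw [← ENNReal.ofReal_add (by positivity) (by positivity)]
    apply ENNReal.ofReal_le_ofReal
    -- Here m counts the stages still to come; by the choice of M_j each of them gains a factor of
    -- at least 8 in the failure probability.
    obtain ⟨m, rfl⟩ : ∃ m, K = J + 1 + m := ⟨K - (J + 1), by omega⟩
    have hq : Real.exp (-(rpeF δ / 400 : ℝ)) ≤ 1 / 4096 := by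
      have h1 : (4000 : ℝ) ≤ rpeF δ := by exact_mod_cast hF
      have h2 : Real.exp (-(rpeF δ / 400 : ℝ)) ≤ Real.exp (-10) := by
        apply Real.exp_le_exp.2
        linarith
      refine h2.trans ?_
      rw [Real.exp_neg, one_div]
      refine inv_anti₀ (by norm_num) ?_
      have h3 : Real.exp 10 = Real.exp 1 ^ 10 := by
        rw [← Real.exp_nat_mul]
        norm_num
      rw [h3]
      calc (4096 : ℝ) ≤ 2.7 ^ 10 := by norm_num
        _ ≤ Real.exp 1 ^ 10 := by
          gcongr
          linarith [Real.exp_one_gt_d9]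
    have hM : Real.exp (-(rpeM δ (J + 1 + m) (J + 1) / 400 : ℝ)) ≤ 1 / 4096 * (1 / 8) ^ m := by
      have e : Real.exp (-(rpeM δ (J + 1 + m) (J + 1) / 400 : ℝ)) =
          Real.exp (-(rpeF δ / 400 : ℝ)) * (Real.exp (-(rpeF δ / 400 : ℝ)) ^ 3) ^ m := by
        rw [← pow_mul, ← pow_succ', ← Real.exp_nat_mul, rpeM]
        congr 1
        rw [Nat.add_sub_cancel_left]
        push_cast
        ring
      rw [e]
      have hpos := Real.exp_pos (-(rpeF δ / 400 : ℝ))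
      gcongr
      calc Real.exp (-(rpeF δ / 400 : ℝ)) ^ 3 ≤ (1 / 4096) ^ 3 := by gcongr
        _ ≤ 1 / 8 := by norm_num
    have h1 : 64 / 9 * Real.pi ^ 2 / 4 ^ J *
        (4 * Real.exp (-(rpeM δ (J + 1 + m) (J + 1) / 400 : ℝ))) ≤
        64 / 9 * Real.pi ^ 2 / 4 ^ J * (4 * (1 / 4096 * (1 / 8) ^ m)) := by gcongr
    have h8 : (8 : ℝ) ^ (J + 1 + m) = 8 * (2 ^ J * 4 ^ J) * 8 ^ m := by
      rw [← mul_pow]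
      norm_num
      ring
    -- 64/9 · 4/4096 = 1/144, and 8/144 = 1/18. The new stage contributes exactly as much as the
    -- inductive bound, which therefore doubles.
    have e2 : 64 / 9 * Real.pi ^ 2 / 4 ^ J * (4 * (1 / 4096 * (1 / 8) ^ m)) =
        Real.pi ^ 2 / 18 * (2 ^ J / 8 ^ (J + 1 + m)) := by
      rw [h8, one_div_pow]
      field_simp
      norm_num
    have e3 : (2 : ℝ) ^ (J + 1) = 2 ^ J + 2 ^ J := by ring
    rw [e3]
    rw [e2] at h1
    refine (add_le_add_right h1 _).trans (le_of_eq ?_)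
    ring

/-- The resolution of the last stage contributes 4π²/9 and the failures π²/18, together π²/2 in
units of 4^{-K}. -/
theorem expect_rpe_sq_le (h : CloseToPhase U l Φ φ) (hF : 4000 ≤ rpeF δ) (K : ℕ)
    (h₀ : |v₀ - φ| ≤ 2 * Real.pi / 3) :
    expect (Prog.val (rpe U l Φ δ K v₀ K)) (fun v => ENNReal.ofReal ((v - φ) ^ 2)) ≤
      ENNReal.ofReal (Real.pi ^ 2 / 2 / 4 ^ K) := by
  have hpt : ∀ v, ENNReal.ofReal ((v - φ) ^ 2) ≤ ENNReal.ofReal (4 / 9 * Real.pi ^ 2 / 4 ^ K) +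
      ENNReal.ofReal (rpePotential K |v - φ|) := by
    intro v
    rw [← ENNReal.ofReal_add (by positivity) (rpePotential_nonneg _ _), ← sq_abs]
    exact ENNReal.ofReal_le_ofReal (sq_le_add_rpePotential K (abs_nonneg _))
  refine (expect_mono _ hpt).trans ?_
  rw [expect_add, expect_const]
  refine (add_le_add_right (expect_rpePotential_le h hF K h₀ K le_rfl) _).trans ?_
  rw [← ENNReal.ofReal_add (by positivity) (by positivity)]
  apply ENNReal.ofReal_le_ofReal
  have h8 : (8 : ℝ) ^ K = 2 ^ K * 4 ^ K := by
    rw [← mul_pow]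
    norm_num
  rw [h8]
  apply le_of_eq
  field_simp
  norm_num

end Rpe

/-! ### Step counts -/

theorem Prog.HasCost.of_eq {α : Type} {p : Prog α} {c d : ℕ} (h : p.HasCost c) (e : c = d) :
    p.HasCost d := e ▸ h

/-- Number of steps of one experiment. -/
noncomputable def expCost (n l k : ℕ) : ℕ :=
  n + 1 + iterN k * (10 * l ^ 2 * n + l ^ 2 * (25 * k) * n + 1 +
    (2 * (1 + (l ^ 2 * (25 * k) + 10 * l ^ 2) * (2 * n + 1)) + 1)) + 1

/-- Number of steps of the first `J` of `K` stages of robust phase estimation. -/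
noncomputable def rpeCost (n l : ℕ) (δ : ℝ) (K J : ℕ) : ℕ :=
  ∑ i ∈ Finset.range J, (2 * (rpeM δ K (i + 1) * expCost n l (2 ^ i)) + 1)

section Cost

variable {n : ℕ}

theorem ladder_cost {N : ℕ} (τ : ℝ) (v : Fin N → Fin n → Fin 4) :
    (ladder τ v).cost = N * (2 * n + 1) := by
  have h : ∀ L : List (Fin n → Fin 4),
      Circuit.cost (L.flatMap fun a => [Gate.ctrlPauli a, Gate.query τ, Gate.ctrlPauli a]) =
        L.length * (2 * n + 1) := by
    intro L
    unfold Circuit.cost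
    induction L with
    | nil => simp
    | cons a L ih =>
      rw [List.flatMap_cons, List.map_append, List.sum_append, ih]
      simp [Gate.cost]
      ring
  rw [ladder, h, List.length_ofFn]

theorem Circuit.cost_append (C D : Circuit n) : Circuit.cost (C ++ D) = C.cost + D.cost := by
  simp [Circuit.cost]

theorem Circuit.cost_inverse (C : Circuit n) : C.inverse.cost = C.cost := by
  have h : ∀ g : Gate n, g.inverse.cost = g.cost := by
    intro g
    cases g <;> rfl
  unfold Circuit.inverse Circuit.cost
  rw [List.map_reverse, List.sum_reverse, List.map_map]
  congr 2
  funext g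
  exact h g

theorem stepCircuit_cost (l M : ℕ) (γ Φ : ℝ) (u : Fin (10 * l ^ 2) → Fin n → Fin 4)
    (w : Fin (l ^ 2 * M) → Fin n → Fin 4) (s : ℤˣ) : (stepCircuit l M γ Φ u w s).cost =
      2 * (1 + (l ^ 2 * M + 10 * l ^ 2) * (2 * n + 1)) + 1 := by
  have h1 : (circuitWTilde l M Φ u w s).cost =
      1 + (l ^ 2 * M + 10 * l ^ 2) * (2 * n + 1) := by
    rw [circuitWTilde, Circuit.cost_append, Circuit.cost_append, ladder_cost, ladder_cost]
    simp [Circuit.cost, Gate.cost]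
    ring
  rw [stepCircuit, Circuit.cost_append, Circuit.cost_append, Circuit.cost_inverse, h1]
  simp [Circuit.cost, Gate.cost]
  ring

variable (U : ℝ → Op n)

theorem hasCost_genState (l : ℕ) (γ : ℝ) (M : ℕ) (Φ : ℝ) (N : ℕ) :
    (genState U l γ M Φ N).HasCost (n + 1 + N * (10 * l ^ 2 * n + l ^ 2 * M * n + 1 +
      (2 * (1 + (l ^ 2 * M + 10 * l ^ 2) * (2 * n + 1)) + 1))) := by
  induction N with
  | zero =>
    rw [genState]
    exact (Prog.hasCost_bind (Prog.hasCost_tick _) fun _ => Prog.hasCost_pure _).of_eq (by ring)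
  | succ N ih =>
    rw [genState]
    refine (Prog.hasCost_bind ih fun ψ => Prog.hasCost_bind (Prog.hasCost_uniform _) fun u =>
      Prog.hasCost_bind (Prog.hasCost_uniform _) fun w =>
      Prog.hasCost_bind (Prog.hasCost_uniform _) fun s =>
      Prog.hasCost_bind ((Prog.hasCost_tick _).of_eq (stepCircuit_cost l M γ Φ u w s)) fun _ =>
      Prog.hasCost_pure _).of_eq ?_
    ring

theorem hasCost_experiment (l : ℕ) (Φ : ℝ) (b : Basis) (k : ℕ) :
    (experiment U l Φ b k).HasCost (expCost n l k) :=
  Prog.hasCost_bind (hasCost_genState U l _ _ Φ _) fun _ => Prog.hasCost_coin _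

theorem hasCost_countSuccesses (l : ℕ) (Φ : ℝ) (b : Basis) (k M : ℕ) :
    (countSuccesses U l Φ b k M).HasCost (M * expCost n l k) := by
  induction M with
  | zero =>
    rw [countSuccesses]
    exact (Prog.hasCost_pure _).of_eq (by ring)
  | succ M ih =>
    rw [countSuccesses]
    refine (Prog.hasCost_bind ih fun a => Prog.hasCost_bind (hasCost_experiment U l Φ b k) fun r =>
      Prog.hasCost_pure _).of_eq ?_
    ring

theorem hasCost_rpe (l : ℕ) (Φ δ : ℝ) (K : ℕ) (v₀ : ℝ) (J : ℕ) :
    (rpe U l Φ δ K v₀ J).HasCost (rpeCost n l δ K J) := by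
  induction J with
  | zero =>
    rw [rpe]
    exact Prog.hasCost_pure _
  | succ J ih =>
    rw [rpe]
    refine (Prog.hasCost_bind ih fun v => Prog.hasCost_bind
      (hasCost_countSuccesses U l Φ _ _ _) fun a => Prog.hasCost_bind
      (hasCost_countSuccesses U l Φ _ _ _) fun b => Prog.hasCost_bind (Prog.hasCost_tick 1)
      fun _ => Prog.hasCost_pure _).of_eq ?_
    rw [rpeCost, rpeCost, Finset.sum_range_succ]
    ring

theorem hasCost_onePass (l : ℕ) (ε t δ : ℝ) : (onePass U l ε t δ).HasCost
    (2 * rpeCost n l δ (rpeK (ε / (Real.sqrt 2 * t))) (rpeK (ε / (Real.sqrt 2 * t))) + 1) := by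
  refine (Prog.hasCost_bind (hasCost_rpe U l 0 δ _ _ _) fun v => Prog.hasCost_bind
    (hasCost_rpe U l (Real.pi / 2) δ _ _ _) fun v' => Prog.hasCost_bind (Prog.hasCost_tick 1)
      fun _ => Prog.hasCost_pure _).of_eq ?_
  ring

end Cost

/-! ### Two-sided bounds for the step counts. -/

theorem iterN_le {k : ℕ} (hk : 0 < k) : (iterN k : ℝ) ≤ 563 * k ^ 2 := by
  have hk1 : (1 : ℝ) ≤ k := by exact_mod_cast hk
  have hpi := Real.pi_pos
  have hpi2 := Real.pi_lt_d2
  have hs : Real.sqrt 2 ≤ 1.4143 := by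
    rw [Real.sqrt_le_left (by norm_num)]
    norm_num
  have h0 : 0 ≤ max (10 * 1 ^ 2 * (k * Real.pi) ^ 2 / (1 / (4 * Real.sqrt 2)))
      (5 * 1 * (k * Real.pi) / 2) := le_max_of_le_right (by positivity)
  have h : (iterN k : ℝ) < max (10 * 1 ^ 2 * (k * Real.pi) ^ 2 / (1 / (4 * Real.sqrt 2)))
      (5 * 1 * (k * Real.pi) / 2) + 1 := Nat.ceil_lt_add_one h0
  have hkk : (k : ℝ) ≤ k ^ 2 := by nlinarith
  have h1 : max (10 * 1 ^ 2 * (k * Real.pi) ^ 2 / (1 / (4 * Real.sqrt 2)))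
      (5 * 1 * (k * Real.pi) / 2) ≤ 562 * k ^ 2 := by
    apply max_le
    · have e : 10 * 1 ^ 2 * (k * Real.pi) ^ 2 / (1 / (4 * Real.sqrt 2)) =
        (40 * Real.sqrt 2 * Real.pi ^ 2) * k ^ 2 := by
        field_simp
        ring
      rw [e]
      gcongr
      calc 40 * Real.sqrt 2 * Real.pi ^ 2 ≤ 40 * 1.4143 * 3.15 ^ 2 := by gcongr
        _ ≤ 562 := by norm_num
    · nlinarith
  nlinarith

theorem expCost_le {n l k : ℕ} (hn : 0 < n) (hl : 0 < l) (hk : 0 < k) :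
    (expCost n l k : ℝ) ≤ 141000 * (l ^ 2 * n * k ^ 3) := by
  have hn1 : (1 : ℝ) ≤ n := by exact_mod_cast hn
  have hl1 : (1 : ℝ) ≤ (l : ℝ) ^ 2 := one_le_pow₀ (by exact_mod_cast hl)
  have hk1 : (1 : ℝ) ≤ k := by exact_mod_cast hk
  have hN := iterN_le hk
  unfold expCost
  push_cast
  set L : ℝ := (l : ℝ) ^ 2
  have hX1 : (1 : ℝ) ≤ L * n := by nlinarith
  have hX2 : L * n ≤ L * n * k := le_mul_of_one_le_right (by linarith) hk1
  have hX3 : (n : ℝ) ≤ L * n := le_mul_of_one_le_left (by linarith) hl1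
  have hX4 : L ≤ L * n := le_mul_of_one_le_right (by linarith) hn1
  have hX5 : L * k ≤ L * n * k := by gcongr
  -- Term by term, 35 for drawing the strings, 2·35·3 for the ladders and 4 for the rest give 249.
  have hin : 10 * L * n + L * (25 * k) * n + 1 +
      (2 * (1 + (L * (25 * k) + 10 * L) * (2 * n + 1)) + 1) ≤ 249 * (L * n * k) := by
    nlinarith
  have hin0 : 0 ≤ 10 * L * n + L * (25 * k) * n + 1 +
      (2 * (1 + (L * (25 * k) + 10 * L) * (2 * n + 1)) + 1) := by positivity
  have hmul := mul_le_mul hN hin hin0 (by positivity)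
  have hX6 : L * n * k ≤ L * n * k ^ 3 := by
    have : (k : ℝ) ≤ k ^ 3 := le_self_pow₀ hk1 (by norm_num)
    gcongr
  have e : 563 * (k : ℝ) ^ 2 * (249 * (L * n * k)) = 140187 * (L * n * k ^ 3) := by ring
  linarith

theorem le_expCost {n l k : ℕ} (hk : 0 < k) :
    ((l : ℝ) ^ 2 * n * k ^ 3) ≤ expCost n l k := by
  have hk1 : (1 : ℝ) ≤ k := by exact_mod_cast hk
  have hN := le_iterN hk
  have hpi := Real.pi_gt_three
  have hs : 1 ≤ Real.sqrt 2 := Real.one_le_sqrt.2 (by norm_num)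
  have hN2 : (k : ℝ) ^ 2 ≤ iterN k := by
    refine le_trans ?_ hN
    rw [mul_pow]
    have h1 : 1 ≤ 40 * Real.sqrt 2 * Real.pi ^ 2 := by nlinarith
    nlinarith [sq_nonneg (k : ℝ)]
  unfold expCost
  push_cast
  have hin : (l : ℝ) ^ 2 * n * k ≤ 10 * (l : ℝ) ^ 2 * n + (l : ℝ) ^ 2 * (25 * k) * n + 1 +
      (2 * (1 + ((l : ℝ) ^ 2 * (25 * k) + 10 * (l : ℝ) ^ 2) * (2 * n + 1)) + 1) := by
    have h1 : 0 ≤ (l : ℝ) ^ 2 * n * k := by positivity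
    have h2 : 0 ≤ 10 * (l : ℝ) ^ 2 * n := by positivity
    have h3 : 0 ≤ ((l : ℝ) ^ 2 * (25 * k) + 10 * (l : ℝ) ^ 2) * (2 * n + 1) := by positivity
    linarith
  have hmul := mul_le_mul hN2 hin (by positivity) (by positivity)
  have e : (k : ℝ) ^ 2 * ((l : ℝ) ^ 2 * n * k) = (l : ℝ) ^ 2 * n * k ^ 3 := by ring
  have hn : (0 : ℝ) ≤ n := Nat.cast_nonneg n
  linarith

/-- The stage costs grow like 8^J while the weights 3(K - J) + 1 decrease only linearly, so the last
stage dominates. Keeping the weight in the bound is what closes the induction: at J = K it equals 1,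
and no factor K is lost. -/
theorem rpeCost_le {n l : ℕ} (hn : 0 < n) (hl : 0 < l) (δ : ℝ) (K J : ℕ) (hJ : J ≤ K) :
    (rpeCost n l δ K J : ℝ) ≤
      (282000 * rpeF δ + 1) * (l ^ 2 * n * 8 ^ J) * (3 * (K - J : ℕ) + 1) := by
  have hn1 : (1 : ℝ) ≤ n := by exact_mod_cast hn
  have hl1 : (1 : ℝ) ≤ (l : ℝ) ^ 2 := one_le_pow₀ (by exact_mod_cast hl)
  have hln : (1 : ℝ) ≤ (l : ℝ) ^ 2 * n := by nlinarith
  induction J with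
  | zero =>
    rw [rpeCost, Finset.sum_range_zero, Nat.cast_zero]
    positivity
  | succ J ih =>
    have h1 := ih (by omega)
    obtain ⟨m, rfl⟩ : ∃ m, K = J + 1 + m := ⟨K - (J + 1), by omega⟩
    have e1 : J + 1 + m - J = m + 1 := by omega
    rw [e1] at h1
    rw [rpeCost, Finset.sum_range_succ, ← rpeCost, rpeM, Nat.add_sub_cancel_left]
    push_cast at h1 ⊢
    have h2 := expCost_le hn hl (k := 2 ^ J) (by positivity)
    push_cast at h2
    have e8 : ((2 : ℝ) ^ J) ^ 3 = 8 ^ J := by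
      rw [← pow_mul, mul_comm, pow_mul]
      norm_num
    rw [e8] at h2
    have hX : (1 : ℝ) ≤ (l : ℝ) ^ 2 * n * 8 ^ J :=
      one_le_mul_of_one_le_of_one_le hln (one_le_pow₀ (by norm_num))
    have eX : (l : ℝ) ^ 2 * n * 8 ^ (J + 1) = 8 * ((l : ℝ) ^ 2 * n * 8 ^ J) := by ring
    rw [eX]
    set X := (l : ℝ) ^ 2 * n * 8 ^ J
    have hm : (0 : ℝ) ≤ m := Nat.cast_nonneg m
    have hF : (0 : ℝ) ≤ rpeF δ := Nat.cast_nonneg _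
    have h3 : (rpeF δ : ℝ) * (3 * m + 1) * expCost n l (2 ^ J) ≤
        (rpeF δ : ℝ) * (3 * m + 1) * (141000 * X) := by gcongr
    have h4 : 1 ≤ X * (3 * m + 1) := by nlinarith
    have h5 : 0 ≤ (282000 * rpeF δ + 1) * X * (18 * m + 3) := by positivity
    nlinarith

theorem le_rpeCost {n l : ℕ} {δ : ℝ} (hF : 0 < rpeF δ) {K : ℕ} (hK : 0 < K) :
    (l : ℝ) ^ 2 * n * 8 ^ K / 8 ≤ rpeCost n l δ K K := by
  obtain ⟨J, rfl⟩ : ∃ J, K = J + 1 := ⟨K - 1, by omega⟩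
  have h2 := le_expCost (n := n) (l := l) (k := 2 ^ J) (by positivity)
  push_cast at h2
  have e8 : ((2 : ℝ) ^ J) ^ 3 = 8 ^ J := by
    rw [← pow_mul, mul_comm, pow_mul]
    norm_num
  rw [e8] at h2
  have hF1 : (1 : ℝ) ≤ rpeF δ := by exact_mod_cast hF
  have h4 : (expCost n l (2 ^ J) : ℝ) ≤ rpeF δ * expCost n l (2 ^ J) :=
    le_mul_of_one_le_left (Nat.cast_nonneg _) hF1
  have h5 : (l : ℝ) ^ 2 * n * 8 ^ (J + 1) / 8 = (l : ℝ) ^ 2 * n * 8 ^ J := by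
    rw [pow_succ]
    ring
  have h6 : rpeF δ * expCost n l (2 ^ J) ≤ rpeCost n l δ (J + 1) (J + 1) := by
    have h7 : rpeM δ (J + 1) (J + 1) = rpeF δ := by simp [rpeM]
    rw [rpeCost, Finset.sum_range_succ, h7]
    omega
  have h8 : (rpeF δ : ℝ) * expCost n l (2 ^ J) ≤ rpeCost n l δ (J + 1) (J + 1) := by
    exact_mod_cast h6
  rw [h5]
  exact h2.trans (h4.trans h8)

/-! ### Repetition until acceptance -/

section Repetition

open MeasureTheory

variable {X : Type} [MeasurableSpace X] (μ : Measure X) [IsProbabilityMeasure μ] {R : Set X}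

theorem infinitePi_prefix_inter (hR : MeasurableSet R) {B : Set X} (hB : MeasurableSet B) (i : ℕ) :
    Measure.infinitePi (fun _ : ℕ => μ) {ω | (∀ j < i, ω j ∈ R) ∧ ω i ∈ B} = μ R ^ i * μ B := by
  have h : {ω : ℕ → X | (∀ j < i, ω j ∈ R) ∧ ω i ∈ B} =
      Set.pi (Finset.range (i + 1) : Set ℕ) (fun j => if j < i then R else B) := by
    ext ω
    simp only [Set.mem_ofPred_eq, Set.mem_pi, Finset.coe_range, Set.mem_Iio]
    constructor
    · rintro ⟨h1, h2⟩ j hj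
      split_ifs with hji
      · exact h1 j hji
      · have : j = i := by omega
        rwa [this]
    · intro h
      refine ⟨fun j hj => ?_, ?_⟩
      · have := h j (by omega)
        rwa [if_pos hj] at this
      · have := h i (by omega)
        rwa [if_neg (lt_irrefl i)] at this
  rw [h, Measure.infinitePi_pi, Finset.prod_range_succ, if_neg (lt_irrefl i)]
  · congr 1
    rw [← Finset.card_range i, ← Finset.prod_const, Finset.card_range]
    refine Finset.prod_congr rfl fun j hj => ?_
    rw [if_pos (Finset.mem_range.1 hj)]
  · intro j _
    split_ifs
    · exact hR
    · exact hB

theorem measurableSet_prefix (hR : MeasurableSet R) (i : ℕ) :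
    MeasurableSet {ω : ℕ → X | ∀ j < i, ω j ∈ R} := by
  have : {ω : ℕ → X | ∀ j < i, ω j ∈ R} = ⋂ j, ⋂ (_ : j < i), (fun ω => ω j) ⁻¹' R := by
    ext ω
    simp
  rw [this]
  exact MeasurableSet.iInter fun j => MeasurableSet.iInter fun _ => measurable_pi_apply j hR

/-- Independence: restricted to the event that the first i passes are rejected, the i-th pass still
has law μ, with total mass μ(R)^i. -/
theorem lintegral_prefix (hR : MeasurableSet R) {f : X → ℝ≥0∞} (hf : Measurable f) (i : ℕ) :
    ∫⁻ ω in {ω | ∀ j < i, ω j ∈ R}, f (ω i) ∂Measure.infinitePi (fun _ : ℕ => μ) =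
      μ R ^ i * ∫⁻ x, f x ∂μ := by
  have h : ((Measure.infinitePi (fun _ : ℕ => μ)).restrict {ω | ∀ j < i, ω j ∈ R}).map
      (fun ω => ω i) = μ R ^ i • μ := by
    ext B hB
    rw [Measure.map_apply (measurable_pi_apply i) hB,
      Measure.restrict_apply (measurable_pi_apply i hB), Measure.smul_apply, smul_eq_mul,
      ← infinitePi_prefix_inter μ hR hB i]
    congr 1
    ext ω
    simp [and_comm]
  rw [← lintegral_map hf (measurable_pi_apply i), h, lintegral_smul_measure, smul_eq_mul]

/-- A form of Wald's identity. It serves both the runtime, with f the step count, and the mean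
square error, with f the squared error of a pass. -/
theorem lintegral_tsum_prefix (hR : MeasurableSet R) {f : X → ℝ≥0∞} (hf : Measurable f) :
    ∫⁻ ω, ∑' i, Set.indicator {ω | ∀ j < i, ω j ∈ R} (fun ω => f (ω i)) ω
      ∂Measure.infinitePi (fun _ : ℕ => μ) = (1 - μ R)⁻¹ * ∫⁻ x, f x ∂μ := by
  have hm : ∀ i : ℕ, Measurable (Set.indicator {ω : ℕ → X | ∀ j < i, ω j ∈ R}
      (fun ω => f (ω i))) := fun i =>
    (hf.comp (measurable_pi_apply i)).indicator (measurableSet_prefix hR i)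
  rw [lintegral_tsum fun i => (hm i).aemeasurable]
  simp only [lintegral_indicator (measurableSet_prefix hR _), lintegral_prefix μ hR hf]
  rw [ENNReal.tsum_mul_right, ENNReal.tsum_geometric]

theorem ae_exists_notMem (hR : MeasurableSet R) (h : μ R < 1) :
    ∀ᵐ ω ∂Measure.infinitePi (fun _ : ℕ => μ), ∃ i, ω i ∉ R := by
  rw [ae_iff]
  have hle : ∀ i : ℕ, Measure.infinitePi (fun _ : ℕ => μ) {ω | ¬ ∃ i, ω i ∉ R} ≤ μ R ^ i := by
    intro i
    have := infinitePi_prefix_inter μ hR MeasurableSet.univ i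
    rw [measure_univ, mul_one] at this
    rw [← this]
    refine measure_mono fun ω hω => ?_
    simp only [not_exists, not_not, Set.mem_ofPred_eq] at hω
    exact ⟨fun j _ => hω j, trivial⟩
  exact le_antisymm (ge_of_tendsto' (ENNReal.tendsto_pow_atTop_nhds_zero_of_lt_one h) hle)
    zero_le

end Repetition

/-! ### The estimation subroutine -/

/-- Only an upper bound for the actual deviation 1/5 is required of δ. Taking it close to 1/√8 makes
F(δ) so large that a crude Chernoff bound suffices: the quotient is log 200 / log(20000/19999) ≥
19999. -/
theorem le_rpeF : 4000 ≤ rpeF (99 / 100 / Real.sqrt 8) := by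
  have h8 : Real.sqrt 8 * (99 / 100 / Real.sqrt 8) = 99 / 100 := by field_simp
  have h1 : (4000 : ℝ) ≤ rpeF (99 / 100 / Real.sqrt 8) := by
    rw [rpeF, h8]
    refine le_trans ?_ (Nat.le_ceil _)
    have e1 : (1 / 2 * (1 - 99 / 100) : ℝ) = 200⁻¹ := by norm_num
    have e2 : (1 - 1 / 2 * (1 - 99 / 100) ^ 2 : ℝ) = (20000 / 19999 : ℝ)⁻¹ := by norm_num
    rw [e1, e2, Real.log_inv, Real.log_inv, neg_div_neg_eq]
    have h2 : 1 ≤ Real.log 200 := by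
      rw [Real.le_log_iff_exp_le (by norm_num)]
      linarith [Real.exp_one_lt_d9]
    have h3 : 0 < Real.log (20000 / 19999) := Real.log_pos (by norm_num)
    have h4 : Real.log (20000 / 19999) ≤ 1 / 19999 := by
      have := Real.log_le_sub_one_of_pos (x := 20000 / 19999) (by norm_num)
      linarith
    rw [le_div_iff₀ h3]
    linarith
  exact_mod_cast h1

theorem le_two_pow_rpeK {σ : ℝ} (hσ : 0 < σ) : 3 * Real.pi / σ ≤ 2 ^ rpeK σ := by
  have hpos : 0 < 3 * Real.pi / σ := by positivity
  have h := Nat.le_ceil (Real.logb 2 (3 * Real.pi / σ))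
  rw [Real.logb_le_iff_le_rpow one_lt_two hpos, Real.rpow_natCast] at h
  exact h

/-- The lower bound on 3π/σ makes the logarithm nonnegative; otherwise the natural number ceiling
would be truncated at 0. -/
theorem two_pow_rpeK_le {σ : ℝ} (hσ : 0 < σ) (h1 : 1 ≤ 3 * Real.pi / σ) :
    2 ^ rpeK σ ≤ 2 * (3 * Real.pi / σ) := by
  have hpos : 0 < 3 * Real.pi / σ := by positivity
  have h := Nat.ceil_lt_add_one (Real.logb_nonneg one_lt_two h1)
  have h2 : ((rpeK σ : ℕ) : ℝ) - 1 < Real.logb 2 (3 * Real.pi / σ) := by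
    rw [rpeK]
    linarith
  rw [Real.lt_logb_iff_rpow_lt one_lt_two hpos, Real.rpow_sub two_pos, Real.rpow_natCast,
    Real.rpow_one, div_lt_iff₀ two_pos] at h2
  linarith

section Subroutine

variable {n l : ℕ} {H : Op n}

theorem norm_compZ_sub_one_le_eighth (hH : IsSeed H) (hl : 0 < l) :
    ‖compZ H l (10 * l ^ 2) - 1‖ ≤ 1 / 8 := by
  refine (norm_compZ_estimated_sub_one_le hH hl).trans ?_
  nlinarith [Real.pi_lt_d2, Real.pi_pos]

theorem compZ_ne_zero (hH : IsSeed H) (hl : 0 < l) : compZ H l (10 * l ^ 2) ≠ 0 := by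
  intro h
  have := norm_compZ_sub_one_le_eighth hH hl
  rw [h, zero_sub, norm_neg, norm_one] at this
  norm_num at this

theorem truePhase_zero (l : ℕ) : truePhase H l 0 = 2 * Real.pi * (compZ H l (10 * l ^ 2)).re := by
  rw [truePhase_eq]
  simp

theorem truePhase_pi_div_two (l : ℕ) :
    truePhase H l (Real.pi / 2) = -(2 * Real.pi * (compZ H l (10 * l ^ 2)).im) := by
  rw [truePhase_eq]
  push_cast
  rw [mul_comm Complex.I, Complex.exp_pi_div_two_mul_I]
  simp

theorem closeToPhase (hH : IsSeed H) (hl : 0 < l) (Φ : ℝ) :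
    CloseToPhase (evolution H) l Φ (truePhase H l Φ) := fun _ hk =>
  ⟨abs_successProb_zero_sub_le hH hl Φ hk, abs_successProb_plus_sub_le hH hl Φ hk⟩

theorem abs_two_pi_sub_truePhase_le (hH : IsSeed H) (hl : 0 < l) :
    |2 * Real.pi - truePhase H l 0| ≤ Real.pi / 4 := by
  have h := (Complex.abs_re_le_norm _).trans (norm_compZ_sub_one_le_eighth hH hl)
  rw [Complex.sub_re, Complex.one_re, abs_le] at h
  rw [truePhase_zero, abs_le]
  constructor <;> nlinarith [Real.pi_pos]

theorem abs_truePhase_pi_div_two_le (hH : IsSeed H) (hl : 0 < l) :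
    |0 - truePhase H l (Real.pi / 2)| ≤ Real.pi / 4 := by
  have h := (Complex.abs_im_le_norm _).trans (norm_compZ_sub_one_le_eighth hH hl)
  rw [Complex.sub_im, Complex.one_im, abs_le] at h
  rw [truePhase_pi_div_two, abs_le]
  constructor <;> nlinarith [Real.pi_pos]

variable {ε t δ : ℝ}

/-- The number of stages in one pass. -/
noncomputable def passK (ε t : ℝ) : ℕ := rpeK (ε / (Real.sqrt 2 * t))

theorem expect_onePass (U : ℝ → Op n) (a b : ℝ → ℝ≥0∞) :
    expect (onePass U l ε t δ).law (fun x => a x.1.1 + b x.1.2) =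
      expect (Prog.val (rpe U l 0 δ (passK ε t) (2 * Real.pi) (passK ε t))) a +
      expect (Prog.val (rpe U l (Real.pi / 2) δ (passK ε t) 0 (passK ε t))) b := by
  have h := expect_map (onePass U l ε t δ).law Prod.fst (fun v : ℝ × ℝ => a v.1 + b v.2)
  rw [← h]
  show expect (Prog.val (onePass U l ε t δ)) _ = _
  simp only [onePass, Prog.expect_val_bind, Prog.expect_val_pure, expect_add,
    expect_const]
  rfl

/-- The sum of the squared errors of the two phase estimates. -/
theorem expect_sqError_le (hH : IsSeed H) (hl : 0 < l) (hF : 4000 ≤ rpeF δ) :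
    expect (onePass (evolution H) l ε t δ).law
      (fun x => ENNReal.ofReal ((x.1.1 - truePhase H l 0) ^ 2) +
        ENNReal.ofReal ((x.1.2 - truePhase H l (Real.pi / 2)) ^ 2)) ≤
      ENNReal.ofReal (Real.pi ^ 2 / 4 ^ passK ε t) := by
  have hpi := Real.pi_pos
  rw [expect_onePass (evolution H) (fun v => ENNReal.ofReal ((v - truePhase H l 0) ^ 2))
    (fun v => ENNReal.ofReal ((v - truePhase H l (Real.pi / 2)) ^ 2))]
  have e : Real.pi ^ 2 / 4 ^ passK ε t =
      Real.pi ^ 2 / 2 / 4 ^ passK ε t + Real.pi ^ 2 / 2 / 4 ^ passK ε t := by ring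
  rw [e, ENNReal.ofReal_add (by positivity) (by positivity)]
  refine add_le_add ?_ ?_
  · exact expect_rpe_sq_le (closeToPhase hH hl _) hF _
      ((abs_two_pi_sub_truePhase_le hH hl).trans (by linarith))
  · exact expect_rpe_sq_le (closeToPhase hH hl _) hF _
      ((abs_truePhase_pi_div_two_le hH hl).trans (by linarith))

theorem expect_sqError_fst_le (hH : IsSeed H) (hl : 0 < l) (hF : 4000 ≤ rpeF δ) :
    expect (onePass (evolution H) l ε t δ).law
      (fun x => ENNReal.ofReal ((x.1.1 - truePhase H l 0) ^ 2)) ≤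
      ENNReal.ofReal (Real.pi ^ 2 / 2) := by
  have hpi := Real.pi_pos
  have h := expect_onePass (l := l) (ε := ε) (t := t) (δ := δ) (evolution H)
    (fun v => ENNReal.ofReal ((v - truePhase H l 0) ^ 2)) (fun _ => 0)
  simp only [add_zero, expect_const] at h
  rw [h]
  refine (expect_rpe_sq_le (closeToPhase hH hl _) hF _
    ((abs_two_pi_sub_truePhase_le hH hl).trans (by linarith))).trans ?_
  apply ENNReal.ofReal_le_ofReal
  exact div_le_self (by positivity) (one_le_pow₀ (by norm_num))

/-- The rejected outcomes. -/
def rejectedSet : Set ((ℝ × ℝ) × ℕ) := {x | Rejected x.1}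

theorem measurableSet_rejectedSet : MeasurableSet rejectedSet := by
  unfold rejectedSet Rejected
  exact measurableSet_le (by fun_prop) measurable_const

/-- Rejection forces |v̂_0| ≤ π, whereas the true phase is at least 7π/4. So a rejection is always
the fault of a large error in v̂_0, at least 3π/4. -/
theorem sq_le_of_rejected (hH : IsSeed H) (hl : 0 < l) {v : ℝ × ℝ} (h : Rejected v) :
    9 / 16 * Real.pi ^ 2 ≤ (v.1 - truePhase H l 0) ^ 2 := by
  have hpi := Real.pi_pos
  have h1 : Real.sqrt (v.1 ^ 2 + v.2 ^ 2) ≤ Real.pi := by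
    unfold Rejected at h
    rw [one_div, inv_mul_le_iff₀ (by positivity)] at h
    linarith
  have h2 : |v.1| ≤ Real.sqrt (v.1 ^ 2 + v.2 ^ 2) :=
    Real.abs_le_sqrt (by nlinarith [sq_nonneg v.2])
  have h3 := (le_abs_self v.1).trans (h2.trans h1)
  have h4 := (abs_le.1 (abs_two_pi_sub_truePhase_le hH hl)).2
  nlinarith

/-- Markov's inequality: (π²/2) / (9π²/16) = 8/9. The bound holds for every ε and t, since already K
= 0 gives the mean square error π²/2. -/
theorem measure_rejectedSet_le (hH : IsSeed H) (hl : 0 < l) (hF : 4000 ≤ rpeF δ) :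
    (onePass (evolution H) l ε t δ).law.toMeasure rejectedSet ≤ ENNReal.ofReal (8 / 9) := by
  have hpi := Real.pi_pos
  have h := MeasureTheory.mul_meas_ge_le_lintegral
    (μ := (onePass (evolution H) l ε t δ).law.toMeasure)
    (f := fun x : (ℝ × ℝ) × ℕ => ENNReal.ofReal ((x.1.1 - truePhase H l 0) ^ 2)) (by fun_prop)
    (ENNReal.ofReal (9 / 16 * Real.pi ^ 2))
  rw [lintegral_toMeasure _ (by fun_prop)] at h
  have h1 := h.trans (expect_sqError_fst_le hH hl hF)
  have h2 : (onePass (evolution H) l ε t δ).law.toMeasure rejectedSet ≤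
      (onePass (evolution H) l ε t δ).law.toMeasure {x | ENNReal.ofReal (9 / 16 * Real.pi ^ 2) ≤
        ENNReal.ofReal ((x.1.1 - truePhase H l 0) ^ 2)} :=
    MeasureTheory.measure_mono fun x hx => ENNReal.ofReal_le_ofReal (sq_le_of_rejected hH hl hx)
  have h3 := (mul_le_mul_right h2 (ENNReal.ofReal (9 / 16 * Real.pi ^ 2))).trans h1
  have hc : 0 < 9 / 16 * Real.pi ^ 2 := by positivity
  have e : Real.pi ^ 2 / 2 = 9 / 16 * Real.pi ^ 2 * (8 / 9) := by ring
  rw [e, ENNReal.ofReal_mul hc.le] at h3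
  exact (ENNReal.mul_le_mul_iff_right (ENNReal.ofReal_pos.2 hc).ne' ENNReal.ofReal_ne_top).1 h3

theorem inv_one_sub_le {r : ℝ≥0∞} (h : r ≤ ENNReal.ofReal (8 / 9)) : (1 - r)⁻¹ ≤ 9 := by
  have h1 : ENNReal.ofReal (1 / 9) ≤ 1 - r := by
    refine le_trans ?_ (tsub_le_tsub_left h 1)
    rw [← ENNReal.ofReal_one, ← ENNReal.ofReal_sub _ (by norm_num)]
    exact ENNReal.ofReal_le_ofReal (by norm_num)
  refine (ENNReal.inv_le_inv.2 h1).trans ?_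
  rw [← ENNReal.ofReal_inv_of_pos (by norm_num)]
  norm_num

theorem one_half_lt_norm_outputZ {ω : History} (h : ¬ Rejected (accepted ω)) :
    1 / 2 < ‖outputZ ω‖ := by
  unfold Rejected at h
  rw [not_le] at h
  have hpi := Real.pi_pos
  refine h.trans_le (le_of_eq ?_)
  have e : ‖outputZ ω‖ ^ 2 =
      (1 / (2 * Real.pi) * Real.sqrt ((accepted ω).1 ^ 2 + (accepted ω).2 ^ 2)) ^ 2 := by
    rw [Complex.sq_norm, Complex.normSq_apply, mul_pow, Real.sq_sqrt (by positivity), outputZ]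
    field_simp
  exact ((pow_left_inj₀ (norm_nonneg _) (by positivity) two_ne_zero).1 e).symm

theorem not_rejected_accepted {ω : History} (h : Halts ω) : ¬ Rejected (accepted ω) :=
  Nat.sInf_mem h

/-! ### Error of the accepted pass. -/

theorem enorm_error_sq_le {ω : History} (hω : Halts ω) :
    ‖1 - (compA H l (10 * l ^ 2) * Complex.exp (Complex.I * compTheta H l (10 * l ^ 2))) /
      (outputA ω * Complex.exp (Complex.I * outputTheta ω))‖ₑ ^ 2 ≤
    ENNReal.ofReal (1 / Real.pi ^ 2) *
      (ENNReal.ofReal (((accepted ω).1 - truePhase H l 0) ^ 2) +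
      ENNReal.ofReal (((accepted ω).2 - truePhase H l (Real.pi / 2)) ^ 2)) := by
  have hpi := Real.pi_pos
  have hz : (outputA ω : ℂ) * Complex.exp (Complex.I * outputTheta ω) = outputZ ω :=
    norm_mul_exp_toIcoMod_arg _
  have hn := one_half_lt_norm_outputZ (not_rejected_accepted hω)
  have hne : outputZ ω ≠ 0 := norm_pos_iff.1 (by linarith)
  rw [compTheta_identity, hz, ← ENNReal.ofReal_add (sq_nonneg _) (sq_nonneg _),
    ← ENNReal.ofReal_mul (by positivity), ← ofReal_norm, ← ENNReal.ofReal_pow (norm_nonneg _)]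
  apply ENNReal.ofReal_le_ofReal
  have e : 1 - compZ H l (10 * l ^ 2) / outputZ ω =
      (outputZ ω - compZ H l (10 * l ^ 2)) / outputZ ω := by
    field_simp
  have e2 : ‖outputZ ω - compZ H l (10 * l ^ 2)‖ ^ 2 = 1 / (4 * Real.pi ^ 2) *
      (((accepted ω).1 - truePhase H l 0) ^ 2 +
        ((accepted ω).2 - truePhase H l (Real.pi / 2)) ^ 2) := by
    rw [Complex.sq_norm, Complex.normSq_apply, Complex.sub_re, Complex.sub_im, truePhase_zero,
      truePhase_pi_div_two, outputZ]
    field_simp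
    ring
  rw [e, norm_div, div_pow, e2, div_le_iff₀ (by positivity)]
  -- Acceptance keeps the denominator away from 0, so the relative squared error is at most four
  -- times the absolute one.
  have h4 : 1 / 4 ≤ ‖outputZ ω‖ ^ 2 := by nlinarith
  have h5 : 0 ≤ 1 / Real.pi ^ 2 * (((accepted ω).1 - truePhase H l 0) ^ 2 +
        ((accepted ω).2 - truePhase H l (Real.pi / 2)) ^ 2) := by positivity
  calc _ = 1 / Real.pi ^ 2 * (((accepted ω).1 - truePhase H l 0) ^ 2 +
        ((accepted ω).2 - truePhase H l (Real.pi / 2)) ^ 2) * (1 / 4) := by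
        field_simp
    _ ≤ _ := mul_le_mul_of_nonneg_left h4 h5

theorem ae_halts (hH : IsSeed H) (hl : 0 < l) (hF : 4000 ≤ rpeF δ) :
    ∀ᵐ ω ∂(runLaw (evolution H) l ε t δ), Halts ω := by
  refine ae_exists_notMem _ measurableSet_rejectedSet
    ((measure_rejectedSet_le hH hl hF).trans_lt ?_)
  rw [← ENNReal.ofReal_one]
  exact (ENNReal.ofReal_lt_ofReal_iff one_pos).2 (by norm_num)

/-- The error of the accepted pass is one term in the sum of the errors of all passes that are run.
Its expectation is thus at most the expected number of passes times the mean square error of one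
pass. -/
theorem lintegral_error_sq_le (hH : IsSeed H) (hl : 0 < l) (hF : 4000 ≤ rpeF δ) :
    ∫⁻ ω, ‖1 - (compA H l (10 * l ^ 2) * Complex.exp (Complex.I * compTheta H l (10 * l ^ 2))) /
      (outputA ω * Complex.exp (Complex.I * outputTheta ω))‖ₑ ^ 2 ∂(runLaw (evolution H) l ε t δ) ≤
      ENNReal.ofReal (9 / 4 ^ passK ε t) := by
  have hpi := Real.pi_pos
  set f : (ℝ × ℝ) × ℕ → ℝ≥0∞ := fun x => ENNReal.ofReal (1 / Real.pi ^ 2) *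
      (ENNReal.ofReal ((x.1.1 - truePhase H l 0) ^ 2) +
      ENNReal.ofReal ((x.1.2 - truePhase H l (Real.pi / 2)) ^ 2)) with hf
  have hfm : Measurable f := by fun_prop
  have hle : ∀ᵐ ω ∂(runLaw (evolution H) l ε t δ),
      ‖1 - (compA H l (10 * l ^ 2) * Complex.exp (Complex.I * compTheta H l (10 * l ^ 2))) /
        (outputA ω * Complex.exp (Complex.I * outputTheta ω))‖ₑ ^ 2 ≤
      ∑' i, Set.indicator {ω : History | ∀ j < i, ω j ∈ rejectedSet} (fun ω => f (ω i)) ω := by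
    filter_upwards [ae_halts hH hl hF] with ω hω
    refine (enorm_error_sq_le hω).trans ?_
    -- The index of the first accepted pass; all passes before it are rejected, so its indicator is
    -- 1.
    refine le_trans (le_of_eq ?_) (ENNReal.le_tsum (sInf {i | ¬ Rejected (ω i).1}))
    rw [Set.indicator_of_mem]
    · rfl
    · intro j hj
      have := Nat.notMem_of_lt_sInf hj
      exact not_not.1 this
  refine (MeasureTheory.lintegral_mono_ae hle).trans ?_
  rw [runLaw, lintegral_tsum_prefix _ measurableSet_rejectedSet hfm, lintegral_toMeasure _ hfm, hf,
    expect_const_mul]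
  have e : 9 / 4 ^ passK ε t = 9 * (1 / Real.pi ^ 2 * (Real.pi ^ 2 / 4 ^ passK ε t)) := by
    field_simp
  rw [e, ENNReal.ofReal_mul (by norm_num), ENNReal.ofReal_mul (by positivity), ENNReal.ofReal_ofNat]
  gcongr
  · exact inv_one_sub_le (measure_rejectedSet_le hH hl hF)
  · exact expect_sqError_le hH hl hF

theorem eLpNorm_error_le (hH : IsSeed H) (hl : 0 < l) (hF : 4000 ≤ rpeF δ) (hε : 0 < ε)
    (ht : 0 < t) : MeasureTheory.eLpNorm (fun ω : History =>
      1 - (compA H l (10 * l ^ 2) * Complex.exp (Complex.I * compTheta H l (10 * l ^ 2))) /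
        (outputA ω * Complex.exp (Complex.I * outputTheta ω)))
      2 (runLaw (evolution H) l ε t δ) ≤ ENNReal.ofReal (ε / t) := by
  have hpi := Real.pi_gt_three
  have hK := le_two_pow_rpeK (σ := ε / (Real.sqrt 2 * t)) (by positivity)
  change _ ≤ (2 : ℝ) ^ passK ε t at hK
  have hs : 1 ≤ Real.sqrt 2 := Real.one_le_sqrt.2 (by norm_num)
  have h1 : 3 * (t / ε) ≤ 2 ^ passK ε t := by
    refine le_trans ?_ hK
    have e : 3 * Real.pi / (ε / (Real.sqrt 2 * t)) = 3 * (Real.pi * Real.sqrt 2) * (t / ε) := by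
      field_simp
    rw [e]
    have : 1 ≤ Real.pi * Real.sqrt 2 := by nlinarith
    gcongr
    linarith
  have h2 : 9 / 4 ^ passK ε t ≤ (ε / t) ^ 2 := by
    have h3 : (3 * (t / ε)) ^ 2 ≤ (2 ^ passK ε t) ^ 2 := by gcongr
    have e4 : ((2 : ℝ) ^ passK ε t) ^ 2 = 4 ^ passK ε t := by
      rw [← pow_mul, mul_comm, pow_mul]
      norm_num
    rw [e4] at h3
    rw [div_le_iff₀ (by positivity)]
    have h4 : (ε / t) ^ 2 * (3 * (t / ε)) ^ 2 = 9 := by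
      field_simp
      norm_num
    rw [← h4]
    gcongr
  rw [MeasureTheory.eLpNorm_eq_lintegral_rpow_enorm_toReal two_ne_zero ENNReal.ofNat_ne_top]
  simp only [ENNReal.toReal_ofNat, ENNReal.rpow_ofNat]
  refine (ENNReal.rpow_le_rpow ((lintegral_error_sq_le hH hl hF).trans
    (ENNReal.ofReal_le_ofReal h2)) (by norm_num)).trans (le_of_eq ?_)
  rw [ENNReal.ofReal_rpow_of_nonneg (by positivity) (by norm_num), ← Real.sqrt_eq_rpow,
    Real.sqrt_sq (by positivity)]

theorem runtime_eq (ω : History) : runtime ω = ∑' i,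
    Set.indicator {ω : History | ∀ j < i, ω j ∈ rejectedSet} (fun ω => ((ω i).2 : ℝ≥0∞)) ω := by
  classical
  unfold runtime
  refine tsum_congr fun i => ?_
  rw [Set.indicator_apply]
  congr 1

/-- The number of steps of one pass. -/
noncomputable def passCost (n l : ℕ) (δ ε t : ℝ) : ℕ :=
  2 * rpeCost n l δ (passK ε t) (passK ε t) + 1

/-- Every run of a pass takes the same number of steps, so the expected runtime is this number times
the expected number of passes. -/
theorem lintegral_runtime (U : ℝ → Op n) : ∫⁻ ω, runtime ω ∂(runLaw U l ε t δ) =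
    (1 - (onePass U l ε t δ).law.toMeasure rejectedSet)⁻¹ * passCost n l δ ε t := by
  have hm : Measurable (fun x : (ℝ × ℝ) × ℕ => (x.2 : ℝ≥0∞)) := by fun_prop
  simp only [runtime_eq]
  rw [runLaw, lintegral_tsum_prefix _ measurableSet_rejectedSet hm, lintegral_toMeasure _ hm,
    expect_congr_support (g := fun _ => (passCost n l δ ε t : ℝ≥0∞)), expect_const]
  intro x hx
  rw [hasCost_onePass U l ε t δ x hx]
  rfl

/-- Up to constants 2^K is t/ε, and the cost is of order l² n 8^K. The assumption ε ≤ t gives K > 0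
and keeps the rounding of K within a factor 2. -/
theorem passCost_bounds (hn : 0 < n) (hl : 0 < l) (hF : 4000 ≤ rpeF δ) (hε : 0 < ε) (ht : 0 < t)
    (hεt : ε ≤ t) : 1 / 8 * (l ^ 2 * t ^ 3 * n / ε ^ 3) ≤ (passCost n l δ ε t : ℝ) ∧
      (passCost n l δ ε t : ℝ) ≤
        3 * (282000 * rpeF δ + 1) * 19683 * (l ^ 2 * t ^ 3 * n / ε ^ 3) := by
  have hpi := Real.pi_gt_three
  have hpi2 := Real.pi_lt_d2
  have hs : 1 ≤ Real.sqrt 2 := Real.one_le_sqrt.2 (by norm_num)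
  have hs2 : Real.sqrt 2 ≤ 1.4143 := by
    rw [Real.sqrt_le_left (by norm_num)]
    norm_num
  have hn1 : (1 : ℝ) ≤ n := by exact_mod_cast hn
  have hl1 : (1 : ℝ) ≤ (l : ℝ) ^ 2 := one_le_pow₀ (by exact_mod_cast hl)
  have hln : (1 : ℝ) ≤ (l : ℝ) ^ 2 * n := by nlinarith
  have hte : 1 ≤ t / ε := (one_le_div hε).2 hεt
  have e : 3 * Real.pi / (ε / (Real.sqrt 2 * t)) = 3 * (Real.pi * Real.sqrt 2) * (t / ε) := by
    field_simp
  have hps : 1 ≤ Real.pi * Real.sqrt 2 := by nlinarith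
  have hσ : 0 < ε / (Real.sqrt 2 * t) := by positivity
  have hK1 := le_two_pow_rpeK hσ
  have hK2 := two_pow_rpeK_le hσ (by rw [e]; nlinarith)
  rw [e] at hK1 hK2
  change _ ≤ (2 : ℝ) ^ passK ε t at hK1
  change (2 : ℝ) ^ passK ε t ≤ _ at hK2
  have hA : 3 * (t / ε) ≤ 2 ^ passK ε t := by nlinarith
  -- 6 · 3.15 · 1.4143 < 27, and 27³ = 19683 below.
  have hB : 2 ^ passK ε t ≤ 27 * (t / ε) := by
    refine hK2.trans ?_
    have : Real.pi * Real.sqrt 2 ≤ 3.15 * 1.4143 := by gcongr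
    nlinarith
  have h8 : (8 : ℝ) ^ passK ε t = (2 ^ passK ε t) ^ 3 := by
    rw [← pow_mul, mul_comm, pow_mul]
    norm_num
  have hA3 : (t / ε) ^ 3 ≤ 8 ^ passK ε t := by
    rw [h8]
    gcongr
    linarith
  have hB3 : (8 : ℝ) ^ passK ε t ≤ 19683 * (t / ε) ^ 3 := by
    rw [h8]
    calc ((2 : ℝ) ^ passK ε t) ^ 3 ≤ (27 * (t / ε)) ^ 3 := by gcongr
      _ = 19683 * (t / ε) ^ 3 := by ring
  have hKpos : 0 < passK ε t := by
    by_contra! hc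
    rw [Nat.le_zero.1 hc, pow_zero] at hA
    linarith
  have hX : (l : ℝ) ^ 2 * t ^ 3 * n / ε ^ 3 = (l : ℝ) ^ 2 * n * (t / ε) ^ 3 := by
    rw [div_pow]
    ring
  have hlow := le_rpeCost (n := n) (l := l) (δ := δ) (by omega) hKpos
  have hup := rpeCost_le hn hl δ (passK ε t) (passK ε t) le_rfl
  rw [Nat.sub_self, Nat.cast_zero, mul_zero, zero_add, mul_one] at hup
  rw [hX, passCost]
  push_cast
  constructor
  · have h1 : (l : ℝ) ^ 2 * n * (t / ε) ^ 3 ≤ (l : ℝ) ^ 2 * n * 8 ^ passK ε t := by gcongr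
    have h2 : (0 : ℝ) ≤ rpeCost n l δ (passK ε t) (passK ε t) := Nat.cast_nonneg _
    linarith
  · have h1 : (1 : ℝ) ≤ (l : ℝ) ^ 2 * n * 8 ^ passK ε t :=
      one_le_mul_of_one_le_of_one_le hln (one_le_pow₀ (by norm_num))
    have hD : (1 : ℝ) ≤ 282000 * rpeF δ + 1 := by
      have : (0 : ℝ) ≤ rpeF δ := Nat.cast_nonneg _
      linarith
    have h2 : (1 : ℝ) ≤ (282000 * rpeF δ + 1) * ((l : ℝ) ^ 2 * n * 8 ^ passK ε t) :=
      one_le_mul_of_one_le_of_one_le hD h1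
    have h3 : 3 * (282000 * rpeF δ + 1) * ((l : ℝ) ^ 2 * n * 8 ^ passK ε t) ≤
        3 * (282000 * rpeF δ + 1) * ((l : ℝ) ^ 2 * n * (19683 * (t / ε) ^ 3)) := by gcongr
    have h4 : 3 * (282000 * rpeF δ + 1) * ((l : ℝ) ^ 2 * n * (19683 * (t / ε) ^ 3)) =
        3 * (282000 * rpeF δ + 1) * 19683 * ((l : ℝ) ^ 2 * n * (t / ε) ^ 3) := by ring
    linarith

end Subroutine

end

end UHET

/-! ### Choice of the universal constants. -/

theorem mainTheorem4 :
    ∃ δ c C : ℝ, 0 < δ ∧ δ < 1 / Real.sqrt 8 ∧ 0 < c ∧ 0 < C ∧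
      ∀ (n : ℕ), 0 < n → ∀ (H : Op n), IsSeed H → ∀ (l : ℕ), 0 < l →
        -- the parameters that are estimated
        IsCompensation H l (10 * l ^ 2) (compA H l (10 * l ^ 2)) (compTheta H l (10 * l ^ 2)) ∧
        -- `δ` bounds the deviations of the success probabilities
        (∀ Φ ∈ ({0, Real.pi / 2} : Set ℝ), ∀ k : ℕ, 0 < k →
          |successProb (evolution H) l Φ Basis.zero k -
            (1 + Real.cos (k * (2 * Real.pi * compA H l (10 * l ^ 2) *
              Real.cos (compTheta H l (10 * l ^ 2) + Φ)))) / 2| ≤ δ ∧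
          |successProb (evolution H) l Φ Basis.plus k -
            (1 + Real.sin (k * (2 * Real.pi * compA H l (10 * l ^ 2) *
              Real.cos (compTheta H l (10 * l ^ 2) + Φ)))) / 2| ≤ δ) ∧
        ∀ ε t : ℝ, 0 < ε → 0 < t →
          -- almost sure termination, range of the output
          (∀ᵐ ω ∂(runLaw (evolution H) l ε t δ),
            Halts ω ∧ 1 / 2 < outputA ω ∧ outputTheta ω ∈ Set.Ico 0 (2 * Real.pi)) ∧
          -- root mean square error
          MeasureTheory.eLpNorm (fun ω : History =>
              1 - (compA H l (10 * l ^ 2) * Complex.exp (Complex.I * compTheta H l (10 * l ^ 2))) /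
                (outputA ω * Complex.exp (Complex.I * outputTheta ω)))
            2 (runLaw (evolution H) l ε t δ) ≤ ENNReal.ofReal (ε / t) ∧
          -- expected runtime
          (ε ≤ t →
            ENNReal.ofReal (c * (l ^ 2 * t ^ 3 * n / ε ^ 3)) ≤
              ∫⁻ ω, runtime ω ∂(runLaw (evolution H) l ε t δ) ∧
            ∫⁻ ω, runtime ω ∂(runLaw (evolution H) l ε t δ) ≤
              ENNReal.ofReal (C * (l ^ 2 * t ^ 3 * n / ε ^ 3))) := by
  have h8 : 0 < Real.sqrt 8 := Real.sqrt_pos.2 (by norm_num)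
  have hF := le_rpeF
  have hδ : 1 / 5 ≤ 99 / 100 / Real.sqrt 8 := by
    rw [le_div_iff₀ h8]
    have : Real.sqrt 8 ≤ 3 := by
      rw [Real.sqrt_le_left (by norm_num)]
      norm_num
    linarith
  -- The constants c and C are the bounds for the cost of one pass, with C enlarged by the bound 9
  -- for the expected number of passes; for c it suffices that at least one pass is run.
  refine ⟨99 / 100 / Real.sqrt 8, 1 / 8,
    9 * (3 * (282000 * rpeF (99 / 100 / Real.sqrt 8) + 1) * 19683), by positivity,
    by gcongr; norm_num, by norm_num, by positivity, fun n hn H hH l hl => ⟨?_, ?_, ?_⟩⟩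
  · exact isCompensation hH.1 l (by positivity) (compZ_ne_zero hH hl)
  · intro Φ _ k hk
    exact ⟨(abs_successProb_zero_sub_le hH hl Φ hk).trans hδ,
      (abs_successProb_plus_sub_le hH hl Φ hk).trans hδ⟩
  · intro ε t hε ht
    refine ⟨?_, eLpNorm_error_le hH hl hF hε ht, fun hεt => ?_⟩
    · filter_upwards [ae_halts hH hl hF] with ω hω
      have hmod := toIcoMod_mem_Ico Real.two_pi_pos 0 (outputZ ω).arg
      rw [zero_add] at hmod
      exact ⟨hω, one_half_lt_norm_outputZ (not_rejected_accepted hω), hmod⟩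
    · have hb := passCost_bounds hn hl hF hε ht hεt
      rw [lintegral_runtime]
      constructor
      · refine (ENNReal.ofReal_le_ofReal hb.1).trans ?_
        rw [ENNReal.ofReal_natCast]
        exact le_mul_of_one_le_left zero_le (ENNReal.one_le_inv.2 tsub_le_self)
      · rw [mul_assoc 9, ENNReal.ofReal_mul (by norm_num), ENNReal.ofReal_ofNat]
        refine mul_le_mul' (inv_one_sub_le (measure_rejectedSet_le hH hl hF)) ?_
        rw [← ENNReal.ofReal_natCast]
        exact ENNReal.ofReal_le_ofReal hb.2
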